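/- Let $p$ be an odd prime, $\mathcal K$ a field of characteristic $p$, $q\in\mathcal K$, $n\ge 2$, and $\mathcal K[t]_p^{(q)}=\mathcal K[t]/(t^p-qt)$. Let $\mathcal O$ be the restricted divided power algebra over $\mathcal K$ in the variables $x_{-n},\dots,x_{-1},x_0,x_1,\dots,x_n$, with basis $x^{(\alpha)}$, $0\le\alpha\le\tau=(p-1,\dots,p-1)$, and partial derivatives $D_i$ ($D_ix^{(\alpha)}=x^{(\alpha-\epsilon_i)}$, where $\epsilon_i$ is the $i$-th unit multi-index). For $f\in\mathcal O$ put $$\mathcal D_K(f)=\Big(2f-\sum_{i=1}^n(x_iD_if+x_{-i}D_{-i}f)\Big)D_0+\sum_{i=1}^n D_0(f)\,(x_iD_i+x_{-i}D_{-i})+\sum_{i=1}^n\big(D_{-i}(f)D_i-D_i(f)D_{-i}\big).$$ Let $\mathbf K=\mathbf K(2n+1;\underline 1)$ be the derived algebra of the Lie algebra $\mathcal D_K(\mathcal O)$ of derivations of $\mathcal O$ (the contact algebra). Call $\alpha$ admissible if $0\le\alpha\le\tau$ and, in case $2n+4\equiv0\pmod p$, moreover $\alpha\ne\tau$; the elements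 $\mathcal D_K(x^{(\alpha)})$ with $\alpha$ admissible lie in $\mathbf K$. Let $\mathbf u(\mathbf K)$ be the quotient of the universal enveloping algebra $U(\mathbf K)$ by the relations $\mathcal D_K(x^{(\alpha)})^p=\mathcal D_K(x^{(\alpha)})$ for $\alpha=\epsilon_0$ and $\alpha=\epsilon_i+\epsilon_{-i}$ ($1\le i\le n$), and $\mathcal D_K(x^{(\alpha)})^p=0$ for all other admissible $\alpha$, and put $\mathbf u_{t,q}(\mathbf K)=\mathbf u(\mathbf K)\otimes_{\mathcal K}\mathcal K[t]_p^{(q)}$. Fix $1\le k\ne k'\le n$ and, for $s\in\{k,k'\}$, let $h(s)=\mathcal D_K(x^{(\epsilon_s+\epsilon_{-s})})$, $e(s)=\mathcal D_K(x^{(\epsilon_s+\epsilon_0)})$, and $d_s^{(m)}=\frac1{m!}(\operatorname{ad}e(s))^m$ for $0\le m\le p-1$. Since $e(s)^p=0$ in $\mathbf u(\mathbf K)$, the element $1-e(s)t$ is invertible. Write $y_a^{\langle m\rangle}=(y+a)(y+a+1)\cdots(y+a+m-1)$, $y^{\langle m\rangle}=y_0^{\langle m\rangle}$ and $y^{[m]}=y(y-1)\cdots(y-m+1)$.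 Then there is a noncommutative and noncocommutative Hopf algebra structure over $\mathcal K[t]_p^{(q)}$ on $\mathbf u_{t,q}(\mathbf K)$, with the product undeformed, such that for all admissible $\alpha$, with $D=\mathcal D_K(x^{(\alpha)})$, $$\Delta(D)=D\otimes(1-e(k)t)^{\alpha_k-\alpha_{-k}}(1-e(k')t)^{\alpha_{k'}-\alpha_{-k'}}+\sum_{m,\ell=0}^{p-1}(-1)^{\ell+m}h(k')^{\langle\ell\rangle}h(k)^{\langle m\rangle}\otimes(1-e(k')t)^{-\ell}(1-e(k)t)^{-m}\,d_k^{(m)}d_{k'}^{(\ell)}(D)\,t^{m+\ell},$$ $$S(D)=-(1-e(k')t)^{\alpha_{-k'}-\alpha_{k'}}(1-e(k)t)^{\alpha_{-k}-\alpha_k}\sum_{m,\ell=0}^{p-1}d_k^{(m)}d_{k'}^{(\ell)}(D)\,h(k)_1^{\langle m\rangle}h(k')_1^{\langle\ell\rangle}\,t^{m+\ell},\qquad \varepsilon(D)=0.$$ It is given by the product of the two twists: with $\mathcal F(s)=\sum_{r=0}^{p-1}\frac{(-1)^r}{r!}h(s)^{[r]}\otimes e(s)^rt^r$, the element $\mathcal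 F=\mathcal F(k)\mathcal F(k')$ is invertible and $\Delta(X)=\mathcal F\,(X\otimes1+1\otimes X)\,\mathcal F^{-1}$ for all $X\in\mathbf K$. Moreover, $\dim_{\mathcal K}\mathbf u_{t,q}(\mathbf K)=p^{p^{2n+1}+1}$ if $2n+4\not\equiv0\pmod p$, and $\dim_{\mathcal K}\mathbf u_{t,q}(\mathbf K)=p^{p^{2n+1}}$ if $2n+4\equiv0\pmod p$. -/

import Mathlib

set_option linter.unusedSimpArgs false

open scoped TensorProduct

namespace ContactHopf

/-! ### The truncated divided power algebra and the contact Lie algebra -/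

/-- The index set `{-n, …, -1, 0, 1, …, n}`. -/
abbrev Idx (n : ℕ) : Type := Option (Fin n ⊕ Fin n)

/-- The index `0`. -/
abbrev zi {n : ℕ} : Idx n := none

/-- The indices `1, …, n`. -/
abbrev pos {n : ℕ} (i : Fin n) : Idx n := some (Sum.inl i)

/-- The indices `-1, …, -n`. -/
abbrev neg {n : ℕ} (i : Fin n) : Idx n := some (Sum.inr i)

/-- The multi-index `ε_a`. -/
abbrev eps {n : ℕ} (a : Idx n) : Idx n → ℕ := Pi.single a 1

theorem derivation_sum_apply {K O ι : Type*} [CommRing K] [CommRing O] [Algebra K O]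
    (s : Finset ι) (D : ι → Derivation K O O) (u : O) : (∑ i ∈ s, D i) u = ∑ i ∈ s, D i u := by
  induction s using Finset.cons_induction with
  | empty => simp
  | cons a s ha ih => rw [Finset.sum_cons, Finset.sum_cons, Derivation.add_apply, ih]

/-- The contact vector field
`D_K(f) = (2 f - ∑_{i=1}^n (x_i ∂_i f + x_{-i} ∂_{-i} f)) ∂_0 + ∑_i ∂_0 f (x_i ∂_i + x_{-i} ∂_{-i})
  + ∑_i (∂_{-i} f ∂_i - ∂_i f ∂_{-i})`
built from coordinates `x a` and partial derivatives `d a`; it is linear in `f`. -/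
noncomputable def contactField {K O : Type*} [CommRing K] [CommRing O] [Algebra K O] {n : ℕ}
    (d : Idx n → Derivation K O O) (x : Idx n → O) : O →ₗ[K] Derivation K O O where
  toFun f := (2 * f - ∑ i, (x (pos i) * d (pos i) f + x (neg i) * d (neg i) f)) • d zi
    + ∑ i, (d zi f) • (x (pos i) • d (pos i) + x (neg i) • d (neg i))
    + ∑ i, (d (neg i) f • d (pos i) - d (pos i) f • d (neg i))
  map_add' f g := by
    ext u
    simp only [map_add, Derivation.add_apply, Derivation.smul_apply, Derivation.sub_apply,
      derivation_sum_apply, smul_eq_mul, mul_add, add_mul, Finset.sum_add_distrib,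
      Finset.sum_sub_distrib]
    ring
  map_smul' c f := by
    ext u
    simp only [Derivation.map_smul, Derivation.add_apply, Derivation.smul_apply,
      Derivation.sub_apply, derivation_sum_apply, smul_eq_mul, RingHom.id_apply,
      Algebra.mul_smul_comm, Algebra.smul_mul_assoc, smul_add, smul_sub, Finset.smul_sum, sub_mul,
      Finset.sum_mul, add_mul]

section
variable {K O : Type*} [CommRing K] [CommRing O] [Algebra K O] {n : ℕ}
  (d : Idx n → Derivation K O O) (x : Idx n → O)

/-- The Euler operator in the variables other than `x_0`. -/
def eulerOp (f : O) : O := ∑ i, (x (pos i) * d (pos i) f + x (neg i) * d (neg i) f)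

/-- The Poisson bracket in the variables other than `x_0`. -/
def poisson (f g : O) : O := ∑ i, (d (neg i) f * d (pos i) g - d (pos i) f * d (neg i) g)

theorem contactField_apply (f g : O) : contactField d x f g =
    (2 * f - eulerOp d x f) * d zi g + d zi f * eulerOp d x g + poisson d f g := by
  simp [contactField, eulerOp, poisson, derivation_sum_apply, Finset.mul_sum, mul_add]

/-- The function `{f, g}` with `[D_K(f), D_K(g)] = D_K({f, g})`. -/
noncomputable def contactBracket (f g : O) : O := contactField d x f g - 2 * (g * d zi f)

theorem contactField_lie (hx : ∀ a b, d a (x b) = if a = b then 1 else 0)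
    (hc : ∀ a b f, d a (d b f) = d b (d a f))
    (hext : ∀ D D' : Derivation K O O, (∀ a, D (x a) = D' (x a)) → D = D') (f g : O) :
    ⁅contactField d x f, contactField d x g⁆ = contactField d x (contactBracket d x f g) := by
  have e_add : ∀ u v, eulerOp d x (u + v) = eulerOp d x u + eulerOp d x v := by
    intro u v
    simp only [eulerOp, map_add, ← Finset.sum_add_distrib]
    exact Finset.sum_congr rfl fun i _ => by ring
  have e_sub : ∀ u v, eulerOp d x (u - v) = eulerOp d x u - eulerOp d x v := by
    intro u v
    simp only [eulerOp, map_sub, ← Finset.sum_sub_distrib]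
    exact Finset.sum_congr rfl fun i _ => by ring
  have e_mul : ∀ u v, eulerOp d x (u * v) = u * eulerOp d x v + v * eulerOp d x u := by
    intro u v
    simp only [eulerOp, Derivation.leibniz, smul_eq_mul, Finset.mul_sum,
      ← Finset.sum_add_distrib]
    exact Finset.sum_congr rfl fun i _ => by ring
  have p_sub : ∀ u v w, poisson d u (v - w) = poisson d u v - poisson d u w := by
    intro u v w
    simp only [poisson, map_sub, ← Finset.sum_sub_distrib]
    exact Finset.sum_congr rfl fun i _ => by ring
  have p_add : ∀ u v w, poisson d u (v + w) = poisson d u v + poisson d u w := by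
    intro u v w
    simp only [poisson, map_add, ← Finset.sum_add_distrib]
    exact Finset.sum_congr rfl fun i _ => by ring
  have p_mul : ∀ u v w, poisson d u (v * w) = v * poisson d u w + w * poisson d u v := by
    intro u v w
    simp only [poisson, Derivation.leibniz, smul_eq_mul, Finset.mul_sum,
      ← Finset.sum_add_distrib]
    exact Finset.sum_congr rfl fun i _ => by ring
  have p_comm : ∀ u v, poisson d u v = - poisson d v u := by
    intro u v
    simp only [poisson, ← Finset.sum_neg_distrib]
    exact Finset.sum_congr rfl fun i _ => by ring
  have d_p : ∀ a u v, d a (poisson d u v) = poisson d (d a u) v + poisson d u (d a v) := by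
    intro a u v
    simp only [poisson, map_sum, map_sub, Derivation.leibniz, smul_eq_mul,
      ← Finset.sum_add_distrib, hc a]
    exact Finset.sum_congr rfl fun i _ => by ring
  have d0_e : ∀ u, d zi (eulerOp d x u) = eulerOp d x (d zi u) := by
    intro u
    simp only [eulerOp, map_sum, map_add, Derivation.leibniz, smul_eq_mul, hx, hc zi]
    exact Finset.sum_congr rfl fun i _ => by simp
  have dp_e : ∀ j u, d (pos j) (eulerOp d x u) = eulerOp d x (d (pos j) u) + d (pos j) u := by
    intro j u
    simp [eulerOp, Derivation.leibniz, hx, hc (pos j), Finset.sum_add_distrib]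
    ring
  have dn_e : ∀ j u, d (neg j) (eulerOp d x u) = eulerOp d x (d (neg j) u) + d (neg j) u := by
    intro j u
    simp [eulerOp, Derivation.leibniz, hx, hc (neg j), Finset.sum_add_distrib]
    ring
  have e_p : ∀ u v, eulerOp d x (poisson d u v) =
      poisson d (eulerOp d x u) v + poisson d u (eulerOp d x v) - 2 * poisson d u v := by
    intro u v
    have h1 : eulerOp d x (poisson d u v) = ∑ i, (eulerOp d x (d (neg i) u) * d (pos i) v
        + d (neg i) u * eulerOp d x (d (pos i) v) - eulerOp d x (d (pos i) u) * d (neg i) v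
        - d (pos i) u * eulerOp d x (d (neg i) v)) := by
      have : ∀ s : Finset (Fin n), eulerOp d x
          (∑ i ∈ s, (d (neg i) u * d (pos i) v - d (pos i) u * d (neg i) v)) =
          ∑ i ∈ s, (eulerOp d x (d (neg i) u) * d (pos i) v
        + d (neg i) u * eulerOp d x (d (pos i) v) - eulerOp d x (d (pos i) u) * d (neg i) v
        - d (pos i) u * eulerOp d x (d (neg i) v)) := by
        intro s
        induction s using Finset.cons_induction with
        | empty => simp [eulerOp]
        | cons a s ha ih =>
          rw [Finset.sum_cons, Finset.sum_cons, e_add, ih, e_sub, e_mul, e_mul]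
          ring
      exact this _
    rw [h1]
    simp only [poisson, Finset.mul_sum, ← Finset.sum_add_distrib, ← Finset.sum_sub_distrib]
    exact Finset.sum_congr rfl fun i _ => by rw [dp_e, dn_e, dp_e, dn_e]; ring
  have two : ∀ a, d a 2 = 0 := by
    intro a
    exact_mod_cast (d a).map_natCast 2
  have etwo : eulerOp d x 2 = 0 := by simp [eulerOp, two]
  have ptwo : ∀ u, poisson d u 2 = 0 := by simp [poisson, two]
  have e0 : eulerOp d x (x zi) = 0 := by simp [eulerOp, hx]
  have ep : ∀ j, eulerOp d x (x (pos j)) = x (pos j) := by simp [eulerOp, hx]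
  have en : ∀ j, eulerOp d x (x (neg j)) = x (neg j) := by simp [eulerOp, hx]
  have p0 : ∀ u, poisson d u (x zi) = 0 := by simp [poisson, hx]
  have pp : ∀ u j, poisson d u (x (pos j)) = d (neg j) u := by simp [poisson, hx]
  have pn : ∀ u j, poisson d u (x (neg j)) = - d (pos j) u := by simp [poisson, hx]
  have h00 : d zi (x zi) = 1 := by simp [hx]
  have h0p : ∀ j, d zi (x (pos j)) = 0 := by simp [hx]
  have h0n : ∀ j, d zi (x (neg j)) = 0 := by simp [hx]
  have pneg : ∀ u v, poisson d u (-v) = - poisson d u v := by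
    intro u v
    rw [← zero_sub, p_sub, ← zero_sub (poisson d u v)]
    simp [poisson]
  have eneg : ∀ v, eulerOp d x (-v) = - eulerOp d x v := by
    intro v
    rw [← zero_sub, e_sub, ← zero_sub (eulerOp d x v)]
    simp [eulerOp]
  refine hext _ _ ?_
  rintro (_ | j | j)
  · rw [Derivation.commutator_apply, contactField_apply d x (contactBracket d x f g)]
    simp only [contactBracket, contactField_apply, h00, e0, p0, map_add, map_sub, two, etwo, ptwo,
      e_add, e_sub, e_mul, p_sub, p_add, p_mul, d0_e, e_p, Derivation.leibniz, smul_eq_mul,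
      mul_one, mul_zero, add_zero]
    rw [p_comm g f, p_comm g (eulerOp d x f)]
    ring
  · rw [Derivation.commutator_apply, contactField_apply d x (contactBracket d x f g)]
    simp only [contactBracket, contactField_apply, h0p, ep, pp, map_add, map_sub, two, etwo, ptwo,
      e_add, e_sub, e_mul, p_sub, p_add, p_mul, d0_e, e_p, dp_e, dn_e, d_p,
      Derivation.leibniz, smul_eq_mul, mul_one, mul_zero, add_zero, zero_add,
      hc (neg j) zi]
    rw [p_comm g (d zi f), p_comm g (d (neg j) f)]
    ring
  · rw [Derivation.commutator_apply, contactField_apply d x (contactBracket d x f g)]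
    simp only [contactBracket, contactField_apply, h0n, en, pn, map_add, map_sub, two, etwo, ptwo,
      e_add, e_sub, e_mul, p_sub, p_add, p_mul, d0_e, e_p, dp_e, dn_e, d_p, map_neg, pneg, eneg,
      Derivation.leibniz, smul_eq_mul, mul_one, mul_zero, add_zero, zero_add,
      hc (pos j) zi]
    rw [p_comm g (d zi f), p_comm g (d (pos j) f)]
    ring

end

/-- The ideal `(x_a ^ p : -n ≤ a ≤ n)`. -/
noncomputable abbrev truncIdeal (K : Type*) [Field K] (p n : ℕ) : Ideal (MvPolynomial (Idx n) K) :=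
  Ideal.span (Set.range fun a : Idx n => (MvPolynomial.X a : MvPolynomial (Idx n) K) ^ p)

/-- The restricted divided power algebra `O(2n+1; 1)` over a field `K` of characteristic `p`,
realized as the truncated polynomial ring `K[x_{-n}, …, x_n] / (x_a ^ p)`. -/
def DivPow (K : Type*) [Field K] (p n : ℕ) : Type _ :=
  MvPolynomial (Idx n) K ⧸ truncIdeal K p n

noncomputable instance (K : Type*) [Field K] (p n : ℕ) : CommRing (DivPow K p n) :=
  inferInstanceAs (CommRing (MvPolynomial (Idx n) K ⧸ truncIdeal K p n))

noncomputable instance (K : Type*) [Field K] (p n : ℕ) : Algebra K (DivPow K p n) :=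
  inferInstanceAs (Algebra K (MvPolynomial (Idx n) K ⧸ truncIdeal K p n))

/-- The quotient map `K[x_{-n}, …, x_n] → O(2n+1; 1)`. -/
noncomputable def DivPow.mk (K : Type*) [Field K] (p n : ℕ) :
    MvPolynomial (Idx n) K →ₐ[K] DivPow K p n :=
  Ideal.Quotient.mkₐ K (truncIdeal K p n)

theorem DivPow.mk_surjective (K : Type*) [Field K] (p n : ℕ) :
    Function.Surjective (DivPow.mk K p n) :=
  Ideal.Quotient.mkₐ_surjective K (truncIdeal K p n)

theorem DivPow.mk_eq_zero {K : Type*} [Field K] {p n : ℕ} (f : MvPolynomial (Idx n) K) :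
    DivPow.mk K p n f = 0 ↔ f ∈ truncIdeal K p n :=
  Ideal.Quotient.eq_zero_iff_mem

/-- The variable `x_a`. -/
noncomputable def xv (K : Type*) [Field K] (p n : ℕ) (a : Idx n) : DivPow K p n :=
  DivPow.mk K p n (MvPolynomial.X a)

/-- The divided power `x^{(α)} = ∏ x_a ^ α_a / α_a !`, for `0 ≤ α_a ≤ p - 1`. With these
elements, `x^{(α)} x^{(β)} = (α+β choose α) x^{(α+β)}` (read as `0` if some `α_a + β_a ≥ p`). -/
noncomputable def divMon (K : Type*) [Field K] (p n : ℕ) (α : Idx n → ℕ) : DivPow K p n :=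
  (∏ a, ((α a).factorial : K))⁻¹ • ∏ a, xv K p n a ^ α a

theorem derivation_ext_xv {K : Type*} [Field K] {p n : ℕ}
    (D D' : Derivation K (DivPow K p n) (DivPow K p n))
    (h : ∀ a, D (xv K p n a) = D' (xv K p n a)) : D = D' := by
  ext u
  obtain ⟨f, rfl⟩ := DivPow.mk_surjective K p n u
  induction f using MvPolynomial.induction_on with
  | C c =>
    have : DivPow.mk K p n (MvPolynomial.C c) = algebraMap K (DivPow K p n) c :=
      (DivPow.mk K p n).commutes c
    rw [this, Derivation.map_algebraMap, Derivation.map_algebraMap]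
  | add f g hf hg => rw [map_add, map_add, map_add, hf, hg]
  | mul_X f a hf =>
    have := h a
    rw [xv] at this
    rw [map_mul, Derivation.leibniz, Derivation.leibniz, hf, this]

theorem pderiv_mem_truncIdeal {K : Type*} [Field K] {p n : ℕ} [CharP K p] (a : Idx n)
    {f : MvPolynomial (Idx n) K} (hf : f ∈ truncIdeal K p n) :
    MvPolynomial.pderiv a f ∈ truncIdeal K p n := by
  refine Submodule.span_induction ?_ ?_ ?_ ?_ hf
  · rintro _ ⟨b, rfl⟩
    simp [Derivation.leibniz_pow]
  · simp
  · intro x y _ _ hx hy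
    rw [map_add]
    exact add_mem hx hy
  · intro r x hx hx'
    rw [smul_eq_mul, Derivation.leibniz]
    exact add_mem (Ideal.mul_mem_left _ _ hx') (Ideal.mul_mem_right _ _ hx)

theorem pd_aux {K : Type*} [Field K] {p n : ℕ} [CharP K p] (a : Idx n)
    (f : MvPolynomial (Idx n) K) (hf : DivPow.mk K p n f = 0) :
    DivPow.mk K p n (MvPolynomial.pderiv a f) = 0 := by
  rw [DivPow.mk_eq_zero] at hf ⊢
  exact pderiv_mem_truncIdeal a hf

/-- The partial derivative `D_a` of `O(2n+1; 1)`, induced by `∂ / ∂ x_a`. -/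
noncomputable def pd (K : Type*) [Field K] (p n : ℕ) [CharP K p] (a : Idx n) :
    Derivation K (DivPow K p n) (DivPow K p n) :=
  Derivation.liftOfSurjective (DivPow.mk_surjective K p n) (d := MvPolynomial.pderiv a) (pd_aux a)

/-- The map `D_K : O(2n+1; 1) → W(2n+1; 1) = Der O(2n+1; 1)`. -/
noncomputable def DK (K : Type*) [Field K] (p n : ℕ) [CharP K p] :
    DivPow K p n →ₗ[K] Derivation K (DivPow K p n) (DivPow K p n) :=
  contactField (pd K p n) (xv K p n)

section
variable {K : Type*} [Field K] {p n : ℕ} [CharP K p]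

theorem pd_mk (a : Idx n) (f : MvPolynomial (Idx n) K) :
    pd K p n a (DivPow.mk K p n f) = DivPow.mk K p n (MvPolynomial.pderiv a f) :=
  Derivation.liftOfSurjective_apply (DivPow.mk_surjective K p n) (pd_aux a) f

theorem pd_xv (a b : Idx n) : pd K p n a (xv K p n b) = if a = b then 1 else 0 := by
  rw [xv, pd_mk, MvPolynomial.pderiv_X, Pi.single_apply]
  by_cases h : a = b
  · simp [h]
  · simp [h, Ne.symm h]

theorem pd_comm (a b : Idx n) (f : DivPow K p n) :
    pd K p n a (pd K p n b f) = pd K p n b (pd K p n a f) := by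
  have : ⁅pd K p n a, pd K p n b⁆ = 0 := by
    refine derivation_ext_xv _ _ fun c => ?_
    rw [Derivation.commutator_apply, pd_xv, pd_xv]
    split_ifs <;> simp
  have := congrArg (fun D => D f) this
  simpa [Derivation.commutator_apply, sub_eq_zero] using this

theorem DK_lie (f g : DivPow K p n) : ⁅DK K p n f, DK K p n g⁆ =
    DK K p n (contactBracket (pd K p n) (xv K p n) f g) :=
  contactField_lie _ _ pd_xv pd_comm derivation_ext_xv f g

end

/-- The Lie algebra `K'(2n+1; 1) = D_K(O(2n+1; 1))`. -/
noncomputable def contactFull (K : Type*) [Field K] (p n : ℕ) [CharP K p] :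
    LieSubalgebra K (Derivation K (DivPow K p n) (DivPow K p n)) where
  __ := LinearMap.range (DK K p n)
  lie_mem' := by
    rintro _ _ ⟨f, rfl⟩ ⟨g, rfl⟩
    exact ⟨_, (DK_lie f g).symm⟩

/-- The contact algebra `K(2n+1; 1)`, the derived algebra of `K'(2n+1; 1)`. -/
noncomputable def contactAlg (K : Type*) [Field K] (p n : ℕ) [CharP K p] :
    LieIdeal K (contactFull K p n) :=
  ⁅(⊤ : LieIdeal K (contactFull K p n)), (⊤ : LieIdeal K (contactFull K p n))⁆

/-- `D_K` as a map onto `K'(2n+1; 1)`. -/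
noncomputable def DKfull (K : Type*) [Field K] (p n : ℕ) [CharP K p] :
    DivPow K p n →ₗ[K] contactFull K p n where
  toFun f := ⟨DK K p n f, ⟨f, rfl⟩⟩
  map_add' f g := Subtype.ext (map_add _ f g)
  map_smul' c f := Subtype.ext (map_smul _ c f)

/-- The multi-indices `α` with `D_K(x^{(α)}) ∈ K(2n+1; 1)`: those with `0 ≤ α ≤ τ`, where
`τ = (p - 1, …, p - 1)`, and moreover `α ≠ τ` in case `p ∣ 2n + 4`. -/
def Admissible (p n : ℕ) (α : Idx n → ℕ) : Prop :=
  (∀ a, α a < p) ∧ (p ∣ 2 * n + 4 → α ≠ fun _ => p - 1)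

section
variable {K : Type*} [Field K] {p n : ℕ} [CharP K p]

theorem bracket_mem (f g : DivPow K p n) :
    DKfull K p n (contactBracket (pd K p n) (xv K p n) f g) ∈ contactAlg K p n := by
  have : DKfull K p n (contactBracket (pd K p n) (xv K p n) f g) =
      ⁅DKfull K p n f, DKfull K p n g⁆ := Subtype.ext (DK_lie f g).symm
  rw [this]
  exact LieSubmodule.lie_mem_lie (LieSubmodule.mem_top _) (LieSubmodule.mem_top _)

theorem two_ne_zero_of_lt [hp : Fact (2 < p)] : (2 : K) ≠ 0 := by
  intro h
  have h' : ((2 : ℕ) : K) = 0 := by exact_mod_cast h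
  rw [CharP.cast_eq_zero_iff K p] at h'
  exact absurd (Nat.le_of_dvd (by norm_num) h') (not_le.mpr hp.out)

theorem pd_mem [Fact (2 < p)] (a : Idx n) (g : DivPow K p n) :
    DKfull K p n (pd K p n a g) ∈ contactAlg K p n := by
  have e1 : ∀ b, pd K p n b (1 : DivPow K p n) = 0 := fun b => Derivation.map_one_eq_zero _
  have h0 : ∀ g, DKfull K p n (pd K p n zi g) ∈ contactAlg K p n := by
    intro g
    have h := bracket_mem (1 : DivPow K p n) g
    have h2 : contactBracket (pd K p n) (xv K p n) 1 g = (2 : K) • pd K p n zi g := by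
      simp [contactBracket, contactField_apply, eulerOp, poisson, e1, two_smul, two_mul]
    rw [h2, map_smul] at h
    have h3 := (contactAlg K p n).smul_mem (2 : K)⁻¹ h
    rwa [smul_smul, inv_mul_cancel₀ two_ne_zero_of_lt, one_smul] at h3
  rcases a with _ | i | i
  · exact h0 g
  · have h := bracket_mem (xv K p n (neg i)) g
    have h2 : contactBracket (pd K p n) (xv K p n) (xv K p n (neg i)) g =
        pd K p n zi (xv K p n (neg i) * g) + pd K p n (pos i) g := by
      simp [contactBracket, contactField_apply, eulerOp, poisson, pd_xv, Derivation.leibniz]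
      ring
    rw [h2, map_add] at h
    have h3 := (contactAlg K p n).sub_mem h (h0 (xv K p n (neg i) * g))
    rwa [add_sub_cancel_left] at h3
  · have h := bracket_mem (xv K p n (pos i)) g
    have h2 : contactBracket (pd K p n) (xv K p n) (xv K p n (pos i)) g =
        pd K p n zi (xv K p n (pos i) * g) - pd K p n (neg i) g := by
      simp [contactBracket, contactField_apply, eulerOp, poisson, pd_xv, Derivation.leibniz]
      ring
    rw [h2, map_sub] at h
    have h3 := (contactAlg K p n).sub_mem (h0 (xv K p n (pos i) * g)) h
    rwa [sub_sub_cancel] at h3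

theorem pd_prod (a : Idx n) (α : Idx n → ℕ) : pd K p n a (∏ b, xv K p n b ^ α b) =
    (α a : DivPow K p n) * xv K p n a ^ (α a - 1) *
      ∏ b ∈ Finset.univ.erase a, xv K p n b ^ α b := by
  have h : ∀ s : Finset (Idx n), a ∉ s → pd K p n a (∏ b ∈ s, xv K p n b ^ α b) = 0 := by
    intro s
    induction s using Finset.cons_induction with
    | empty => simp
    | cons c s hc ih =>
      intro ha
      rw [Finset.mem_cons, not_or] at ha
      rw [Finset.prod_cons, Derivation.leibniz, ih ha.2, Derivation.leibniz_pow, pd_xv,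
        if_neg ha.1]
      simp
  rw [← Finset.mul_prod_erase Finset.univ _ (Finset.mem_univ a), Derivation.leibniz,
    h _ (Finset.notMem_erase a _), Derivation.leibniz_pow, pd_xv, if_pos rfl]
  simp [nsmul_eq_mul]
  ring

theorem xv_mul_pd_divMon (a : Idx n) (α : Idx n → ℕ) :
    xv K p n a * pd K p n a (divMon K p n α) = (α a : K) • divMon K p n α := by
  rw [divMon, Derivation.map_smul, pd_prod, smul_comm (α a : K), mul_smul_comm]
  congr 1
  rw [← Finset.mul_prod_erase Finset.univ _ (Finset.mem_univ a), Nat.cast_smul_eq_nsmul,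
    nsmul_eq_mul]
  rcases Nat.eq_zero_or_pos (α a) with h | h
  · simp [h]
  · obtain ⟨m, hm⟩ := Nat.exists_eq_add_of_lt h
    rw [hm]
    simp [pow_succ]
    ring

theorem pd_divMon [Fact p.Prime] (a : Idx n) (α : Idx n → ℕ) (h : α a + 1 < p) :
    pd K p n a (divMon K p n (α + eps a)) = divMon K p n α := by
  have hne : ((α a + 1 : ℕ) : K) ≠ 0 := by
    rw [Ne, CharP.cast_eq_zero_iff K p]
    exact Nat.not_dvd_of_pos_of_lt (Nat.succ_pos _) h
  have hb : ∀ b ∈ Finset.univ.erase a, (α + eps a) b = α b := by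
    intro b hb
    simp [eps, Finset.ne_of_mem_erase hb]
  rw [divMon, divMon, Derivation.map_smul, pd_prod,
    ← Finset.mul_prod_erase Finset.univ (fun b => xv K p n b ^ α b) (Finset.mem_univ a),
    ← Finset.mul_prod_erase Finset.univ (fun b => ((α b).factorial : K)) (Finset.mem_univ a),
    ← Finset.mul_prod_erase Finset.univ (fun b => (((α + eps a) b).factorial : K))
      (Finset.mem_univ a),
    Finset.prod_congr (s₁ := Finset.univ.erase a) rfl (f := fun b => xv K p n b ^ (α + eps a) b)
      (g := fun b => xv K p n b ^ α b) (fun b hb' => by rw [hb b hb']),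
    Finset.prod_congr (s₁ := Finset.univ.erase a) rfl
      (f := fun b => (((α + eps a) b).factorial : K))
      (g := fun b => ((α b).factorial : K)) (fun b hb' => by rw [hb b hb'])]
  have h1 : (α + eps a) a = α a + 1 := by simp [eps]
  rw [h1, Nat.add_sub_cancel, mul_assoc, ← map_natCast (algebraMap K (DivPow K p n)),
    ← Algebra.smul_def, smul_smul]
  congr 1
  rw [Nat.factorial_succ, Nat.cast_mul, mul_assoc, mul_inv]
  field_simp

theorem divMon_mem [hp : Fact p.Prime] [h2 : Fact (2 < p)] {α : Idx n → ℕ}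
    (hα : Admissible p n α) : DKfull K p n (divMon K p n α) ∈ contactAlg K p n := by
  by_cases hτ : α = fun _ => p - 1
  · have hn : ¬ p ∣ 2 * n + 4 := fun h => hα.2 h hτ
    have h := bracket_mem (xv K p n zi) (divMon K p n α)
    have hp1 : ((p - 1 : ℕ) : K) = -1 := by
      rw [Nat.cast_sub hp.out.one_le]
      simp
    have hm : ∀ a, xv K p n a * pd K p n a (divMon K p n α) = - divMon K p n α := by
      intro a
      rw [xv_mul_pd_divMon, hτ]
      simp only [hp1, neg_smul, one_smul]
    have hE : contactBracket (pd K p n) (xv K p n) (xv K p n zi) (divMon K p n α) =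
        (-((2 * n + 4 : ℕ) : K)) • divMon K p n α := by
      have e : eulerOp (pd K p n) (xv K p n) (divMon K p n α) =
          -(2 * n : DivPow K p n) * divMon K p n α := by
        simp only [eulerOp, hm]
        simp
        ring
      rw [contactBracket, contactField_apply, e]
      simp only [poisson, eulerOp, pd_xv]
      rw [neg_smul, Nat.cast_smul_eq_nsmul, nsmul_eq_mul]
      simp [mul_assoc, hm]
      ring
    rw [hE, map_smul] at h
    have hne : (-((2 * n + 4 : ℕ) : K)) ≠ 0 := by
      rw [neg_ne_zero, Ne, CharP.cast_eq_zero_iff K p]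
      exact hn
    have h3 := (contactAlg K p n).smul_mem (-((2 * n + 4 : ℕ) : K))⁻¹ h
    rwa [smul_smul, inv_mul_cancel₀ hne, one_smul] at h3
  · obtain ⟨a, ha⟩ : ∃ a, α a ≠ p - 1 := by
      by_contra! hc
      exact hτ (funext hc)
    have := hα.1 a
    rw [← pd_divMon a α (by omega)]
    exact pd_mem a _

end

theorem admissible_of_le_one {p n : ℕ} [h2 : Fact (2 < p)] {α : Idx n → ℕ} (h : ∀ a, α a ≤ 1) :
    Admissible p n α := by
  have := h2.out
  refine ⟨fun a => lt_of_le_of_lt (h a) (by omega), fun _ hc => ?_⟩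
  have h1 := h zi
  rw [hc] at h1
  simp only at h1
  omega

theorem admissible_eps_add {p n : ℕ} [Fact (2 < p)] {a b : Idx n} (hab : a ≠ b) :
    Admissible p n (eps a + eps b) := by
  refine admissible_of_le_one fun c => ?_
  by_cases h : c = a
  · subst h
    simp [eps, hab]
  · simp only [eps, Pi.add_apply, Pi.single_apply, if_neg h]
    split_ifs <;> simp

/-- The element `D_K(x^{(α)})` of `K(2n+1; 1)`. -/
noncomputable def DKelt (K : Type*) [Field K] (p n : ℕ) [CharP K p] [Fact p.Prime] [Fact (2 < p)]
    (α : Idx n → ℕ) (hα : Admissible p n α) : contactAlg K p n :=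
  ⟨DKfull K p n (divMon K p n α), divMon_mem hα⟩

/-! ### The restricted enveloping algebra and its base change -/

/-- The toral multi-indices `ε_0` and `ε_i + ε_{-i}`, `1 ≤ i ≤ n`. -/
def IsToral {n : ℕ} (α : Idx n → ℕ) : Prop :=
  α = eps zi ∨ ∃ i, α = eps (pos i) + eps (neg i)

/-- The relations `D_K(x^{(α)}) ^ p = D_K(x^{(α)})` for `α = ε_0` and `α = ε_i + ε_{-i}`, and
`D_K(x^{(α)}) ^ p = 0` for all other `α`, in the enveloping algebra of `K(2n+1; 1)`. -/
inductive RestrictedRel (K : Type*) [Field K] (p n : ℕ) [CharP K p] [Fact p.Prime]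
    [Fact (2 < p)] : UniversalEnvelopingAlgebra K (contactAlg K p n) →
      UniversalEnvelopingAlgebra K (contactAlg K p n) → Prop
  | toral (α : Idx n → ℕ) (hα : Admissible p n α) (h : IsToral α) :
      RestrictedRel K p n (UniversalEnvelopingAlgebra.ι K (DKelt K p n α hα) ^ p)
        (UniversalEnvelopingAlgebra.ι K (DKelt K p n α hα))
  | nil (α : Idx n → ℕ) (hα : Admissible p n α) (h : ¬ IsToral α) :
      RestrictedRel K p n (UniversalEnvelopingAlgebra.ι K (DKelt K p n α hα) ^ p) 0

/-- The restricted universal enveloping algebra `u(K(2n+1; 1))`. -/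
def RestrictedEnv (K : Type*) [Field K] (p n : ℕ) [CharP K p] [Fact p.Prime] [Fact (2 < p)] :
    Type _ :=
  RingQuot (RestrictedRel K p n)

section
variable (K : Type*) [Field K] (p n : ℕ) [CharP K p] [Fact p.Prime] [Fact (2 < p)]

noncomputable instance : Ring (RestrictedEnv K p n) :=
  inferInstanceAs (Ring (RingQuot (RestrictedRel K p n)))

noncomputable instance : Algebra K (RestrictedEnv K p n) :=
  inferInstanceAs (Algebra K (RingQuot (RestrictedRel K p n)))

/-- The quotient map `U(K(2n+1; 1)) → u(K(2n+1; 1))`. -/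
noncomputable def RestrictedEnv.mk :
    UniversalEnvelopingAlgebra K (contactAlg K p n) →ₐ[K] RestrictedEnv K p n :=
  RingQuot.mkAlgHom K (RestrictedRel K p n)

/-- The base ring `K[t]_p^{(q)} = K[t] / (t ^ p - q t)`. -/
abbrev TruncBase (q : K) : Type _ :=
  AdjoinRoot (Polynomial.X ^ p - Polynomial.C q * Polynomial.X : Polynomial K)

/-- The element `t` of `K[t]_p^{(q)}`. -/
noncomputable def tt (q : K) : TruncBase K p q := AdjoinRoot.root _

/-- The algebra `u_{t,q}(K(2n+1; 1)) = u(K(2n+1; 1)) ⊗_K K[t]_p^{(q)}` over `K[t]_p^{(q)}`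
(the scalars are written on the left). -/
abbrev UTQ (q : K) : Type _ := TruncBase K p q ⊗[K] RestrictedEnv K p n

/-- The image in `u_{t,q}(K(2n+1; 1))` of an element of `K(2n+1; 1)`. -/
noncomputable def incl (q : K) (X : contactAlg K p n) : UTQ K p n q :=
  1 ⊗ₜ[K] RestrictedEnv.mk K p n (UniversalEnvelopingAlgebra.ι K X)

/-- The element `h(k) = D_K(x^{(ε_k + ε_{-k})})`. -/
noncomputable def hElt (q : K) (k : Fin n) : UTQ K p n q :=
  incl K p n q (DKelt K p n (eps (pos k) + eps (neg k)) (admissible_eps_add (by simp)))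

/-- The element `e(k) = D_K(x^{(ε_k + ε_0)})`. -/
noncomputable def eElt (q : K) (k : Fin n) : UTQ K p n q :=
  incl K p n q (DKelt K p n (eps (pos k) + eps zi) (admissible_eps_add (by simp)))

theorem eElt_pow (q : K) (k : Fin n) : eElt K p n q k ^ p = 0 := by
  have hnt : ¬ IsToral (eps (pos k) + eps zi : Idx n → ℕ) := by
    rintro (h | ⟨i, h⟩)
    · have := congrFun h (pos k)
      simp [eps] at this
    · have := congrFun h zi
      simp [eps] at this
  have h : RestrictedEnv.mk K p n (UniversalEnvelopingAlgebra.ι K (DKelt K p n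
      (eps (pos k) + eps zi) (admissible_eps_add (by simp)))) ^ p = 0 := by
    rw [← map_pow]
    exact (RingQuot.mkAlgHom_rel K (RestrictedRel.nil _ _ hnt)).trans (map_zero _)
  rw [eElt, incl, Algebra.TensorProduct.tmul_pow, h, TensorProduct.tmul_zero]

/-- The element `1 - e(k) t`, a unit since `e(k) ^ p = 0`. -/
noncomputable def oneSubET (q : K) (k : Fin n) : (UTQ K p n q)ˣ :=
  (IsNilpotent.isUnit_one_sub (r := tt K p q • eElt K p n q k)
    ⟨p, by rw [smul_pow, eElt_pow, smul_zero]⟩).unit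

/-- The operator `d_k^{(m)} = (1 / m!) (ad e(k)) ^ m`, where `ad e(k) (y) = e(k) y - y e(k)`, for `0 ≤ m ≤ p - 1`. -/
noncomputable def dOp (q : K) (k : Fin n) (m : ℕ) : UTQ K p n q →ₗ[K] UTQ K p n q :=
  ((m.factorial : K)⁻¹) •
    (LinearMap.mulLeft K (eElt K p n q k) - LinearMap.mulRight K (eElt K p n q k)) ^ m

/-- The twist `∑_r ((-1)^r / r!) h(k)^{[r]} ⊗ e(k)^r t^r` attached to `h(k)` and `e(k)`, where
`h^{[r]} = h (h - 1) ⋯ (h - r + 1)`; the sum stops at `r = p - 1`, as `e(k)^r = 0` from then on. -/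
noncomputable def twist (q : K) (k : Fin n) : UTQ K p n q ⊗[TruncBase K p q] UTQ K p n q :=
  ∑ r ∈ Finset.range p,
    (((-1) ^ r * (r.factorial : K)⁻¹) •
      Polynomial.aeval (hElt K p n q k) (descPochhammer ℤ r)) ⊗ₜ[TruncBase K p q]
        (tt K p q ^ r • eElt K p n q k ^ r)

end

/-- The rising factorial `y (y + 1) ⋯ (y + m - 1)`. -/
noncomputable def rising {A : Type*} [Ring A] (y : A) (m : ℕ) : A :=
  Polynomial.aeval y (ascPochhammer ℤ m)

/-! ### Hopf algebra structures on a given algebra -/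

/-- A Hopf algebra structure over `R` on an `R`-algebra `A`, with the given product and unit. -/
structure HopfStructure (R A : Type*) [CommRing R] [Ring A] [Algebra R A] where
  /-- The coproduct `Δ`. -/
  comul : A →ₐ[R] A ⊗[R] A
  /-- The counit `ε`. -/
  counit : A →ₐ[R] R
  /-- The antipode `S`. -/
  antipode : A →ₗ[R] A
  coassoc : ∀ a, TensorProduct.assoc R A A A (comul.toLinearMap.rTensor A (comul a)) =
    comul.toLinearMap.lTensor A (comul a)
  rTensor_counit : ∀ a, counit.toLinearMap.rTensor A (comul a) = 1 ⊗ₜ a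
  lTensor_counit : ∀ a, counit.toLinearMap.lTensor A (comul a) = a ⊗ₜ 1
  antipode_left : ∀ a, LinearMap.mul' R A (antipode.rTensor A (comul a)) =
    algebraMap R A (counit a)
  antipode_right : ∀ a, LinearMap.mul' R A (antipode.lTensor A (comul a)) =
    algebraMap R A (counit a)

/-- The Hopf algebra in the sense of Mathlib given by a `HopfStructure`. -/
@[reducible]
noncomputable def HopfStructure.toHopfAlgebra {R A : Type*} [CommRing R] [Ring A] [Algebra R A]
    (H : HopfStructure R A) : HopfAlgebra R A :=
  { Bialgebra.mk' R A
      (C :=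
        { comul := H.comul.toLinearMap
          counit := H.counit.toLinearMap
          coassoc := LinearMap.ext H.coassoc
          rTensor_counit_comp_comul := LinearMap.ext H.rTensor_counit
          lTensor_counit_comp_comul := LinearMap.ext H.lTensor_counit })
      (map_one H.counit) (fun {a b} => map_mul H.counit a b)
      (map_one H.comul) (fun {a b} => map_mul H.comul a b) with
    antipode := H.antipode
    mul_antipode_rTensor_comul := LinearMap.ext H.antipode_left
    mul_antipode_lTensor_comul := LinearMap.ext H.antipode_right }

end ContactHopf

open ContactHopf

set_option linter.unusedSimpArgs false
set_option linter.unusedSectionVars false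
open scoped TensorProduct

/-! The undeformed algebra is a Hopf algebra in which every element of the contact algebra is
primitive, and everything else comes from conjugating its coproduct by a Drinfeld twist. For `s = k,
k'` put `h = h(s)` and `y = e(s) t`. Then `h ^ p = h`, `y ^ p = 0` and `h y = y (h + 1)`. Since `X ^
p - X` annihilates `h`, there are spectral idempotents `δ_a(h)` with `a` in the prime field. Since
`(1 - y) ^ p = 1`, the powers `(1 - y) ^ a` make sense for the same `a`. The binomial theorem
rewrites the given series as `F(s) = ∑ a, δ_a(h) ⊗ (1 - y) ^ a` (`sum_eq_twistElt`).

As `h` is primitive, `Δ(δ_a) = ∑ b, δ_b ⊗ δ_{a-b}`, and `1 - y` becomes grouplike after conjugation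
by `F(s)` (`twistElt_mul_comul_oneSub`). These two facts amount to the cocycle condition. The pairs
for `k` and `k'` commute with each other, so `F(k) F(k')` has the form `∑ g, δ_g ⊗ u_g` with `g` in
`ZMod p × ZMod p`. Such data are abstracted in `TwistDatum`, where coassociativity and the antipode
`v S(·) w` are proved, with `w = ∑ g, δ_g u_g` and `v w = 1`.

The explicit formulas rest on `D = D_K(x^{(α)})` being a weight vector of weight `c = α_s - α_{-s}`
for `h`. Moving `D ⊗ 1` across `F(s)` shifts the idempotents and leaves `(1 - y) ^ c` in the second
factor. Moving `1 ⊗ D` across it produces the divided powers of `ad y`, because right multiplication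
by `1 - y` is left multiplication by `1 - y` plus `ad y`. The antipode needs `D w = w (...)`, which
is `IsToralNilPair.mul_w`.

The dimension requires a PBW theorem. The contact bracket of `f` and `g` is `(2n+4) f D_0 g` up to a
sum of partial derivatives, and those have no `x^{(τ)}` term; hence the admissible `D_K(x^{(α)})`
form a basis of the contact algebra. They satisfy the defining `p`-th power relations as operators
on the divided power algebra, so the contact algebra embeds into its restricted enveloping algebra.
Straightening shows that truncated ordered monomials span. They are independent because `(φ ⊗ id)
Δ`, for `φ` dual to a generator, acts on leading terms as a partial derivative, and exponents below
`p` are nonzero in the field. -/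

namespace ContactHopf

/-! ### Twisting a Hopf algebra by a grading and grouplike elements -/

/-! The maps `a ⊗ b ↦ S(a) c b` and `a ⊗ b ↦ a c S(b)` -/

section Sandwich

variable {R A : Type*} [CommRing R] [Ring A] [Algebra R A]

/-- The map `a ⊗ b ↦ S(a) c b`. -/
noncomputable def leftSandwich (S : A →ₗ[R] A) (c : A) : A ⊗[R] A →ₗ[R] A :=
  LinearMap.mul' R A ∘ₗ TensorProduct.map (LinearMap.mulRight R c ∘ₗ S) LinearMap.id

/-- The map `a ⊗ b ↦ a c S(b)`. -/
noncomputable def rightSandwich (S : A →ₗ[R] A) (c : A) : A ⊗[R] A →ₗ[R] A :=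
  LinearMap.mul' R A ∘ₗ TensorProduct.map (LinearMap.mulRight R c) S

@[simp] theorem leftSandwich_tmul (S : A →ₗ[R] A) (c a b : A) :
    leftSandwich S c (a ⊗ₜ[R] b) = S a * c * b := rfl

@[simp] theorem rightSandwich_tmul (S : A →ₗ[R] A) (c a b : A) :
    rightSandwich S c (a ⊗ₜ[R] b) = a * c * S b := rfl

/-- As `S` reverses products, the outer factors coming from `y` surround `S(a) c b`, so `x` is
entirely absorbed into the middle element. This carries the antipode axioms from factors to
products. -/
theorem leftSandwich_mul {S : A →ₗ[R] A} (hS : ∀ a b, S (a * b) = S b * S a) (c : A)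
    (x y : A ⊗[R] A) (d : A) (h : leftSandwich S c x = d) :
    leftSandwich S c (x * y) = leftSandwich S d y := by
  subst h
  induction y with
  | zero => simp
  | add y z hy hz => rw [mul_add, map_add, map_add, hy, hz]
  | tmul y z =>
    induction x with
    | zero => simp
    | add x x' hx hx' =>
      rw [add_mul, map_add, hx, hx', map_add]
      simp [add_mul, mul_add]
    | tmul a b => simp [hS, mul_assoc]

theorem rightSandwich_mul {S : A →ₗ[R] A} (hS : ∀ a b, S (a * b) = S b * S a) (c : A)
    (x y : A ⊗[R] A) (d : A) (h : rightSandwich S c y = d) :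
    rightSandwich S c (x * y) = rightSandwich S d x := by
  subst h
  induction x with
  | zero => simp
  | add x z hy hz => rw [add_mul, map_add, map_add, hy, hz]
  | tmul x z =>
    induction y with
    | zero => simp
    | add y y' hx hx' =>
      rw [mul_add, map_add, hx, hx', map_add]
      simp [add_mul, mul_add]
    | tmul a b => simp [hS, mul_assoc]

theorem leftSandwich_algebraMap (S : A →ₗ[R] A) (r : R) (z : A ⊗[R] A) :
    leftSandwich S (algebraMap R A r) z = r • leftSandwich S 1 z := by
  induction z with
  | zero => simp
  | add x y hx hy => rw [map_add, map_add, hx, hy, smul_add]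
  | tmul x y => simp [Algebra.algebraMap_eq_smul_one]

theorem rightSandwich_algebraMap (S : A →ₗ[R] A) (r : R) (z : A ⊗[R] A) :
    rightSandwich S (algebraMap R A r) z = r • rightSandwich S 1 z := by
  induction z with
  | zero => simp
  | add x y hx hy => rw [map_add, map_add, hx, hy, smul_add]
  | tmul x y => simp [Algebra.algebraMap_eq_smul_one]

theorem mul'_rTensor_eq (S : A →ₗ[R] A) (z : A ⊗[R] A) :
    LinearMap.mul' R A (S.rTensor A z) = leftSandwich S 1 z := by
  simp [leftSandwich, LinearMap.rTensor]

theorem mul'_lTensor_eq (S : A →ₗ[R] A) (z : A ⊗[R] A) :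
    LinearMap.mul' R A (S.lTensor A z) = rightSandwich S 1 z := by
  simp [rightSandwich, LinearMap.lTensor, Module.End.one_eq_id]

end Sandwich

/-- Orthogonal idempotents `δ g` and elements `u g`, indexed by a finite abelian group `G`, such
that `∑ g, δ g ⊗ u g` is a Drinfeld twist of the Hopf algebra `H` and the `u g` are grouplike for
the twisted coproduct. -/
structure TwistDatum {R A : Type*} [CommRing R] [Ring A] [Algebra R A] (H : HopfStructure R A)
    (G : Type*) [AddCommGroup G] [Fintype G] [DecidableEq G] where
  /-- The idempotents. -/
  δ : G → A
  /-- The grouplike elements. -/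
  u : G → A
  δ_mul : ∀ a b, δ a * δ b = if a = b then δ a else 0
  δ_sum : ∑ a, δ a = 1
  comul_δ : ∀ g, H.comul (δ g) = ∑ a, δ a ⊗ₜ[R] δ (g - a)
  counit_δ : ∀ g, H.counit (δ g) = if g = 0 then 1 else 0
  antipode_δ : ∀ g, H.antipode (δ g) = δ (-g)
  u_zero : u 0 = 1
  u_add : ∀ a b, u (a + b) = u a * u b
  counit_u : ∀ a, H.counit (u a) = 1
  twist_comul_u : ∀ g, (∑ a, δ a ⊗ₜ[R] u a) * H.comul (u g) =
    (u g ⊗ₜ[R] u g) * ∑ a, δ a ⊗ₜ[R] u a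
  antipode_mul : ∀ a b, H.antipode (a * b) = H.antipode b * H.antipode a
  antipode_one : H.antipode 1 = 1

namespace TwistDatum

variable {R A : Type*} [CommRing R] [Ring A] [Algebra R A] {H : HopfStructure R A}
  {G : Type*} [AddCommGroup G] [Fintype G] [DecidableEq G] (T : TwistDatum H G)

/-- The twist `∑ g, δ g ⊗ u g`. -/
noncomputable def F : A ⊗[R] A := ∑ a, T.δ a ⊗ₜ[R] T.u a

/-- The inverse of the twist. -/
noncomputable def Finv : A ⊗[R] A := ∑ a, T.δ a ⊗ₜ[R] T.u (-a)

theorem u_neg_mul (a : G) : T.u (-a) * T.u a = 1 := by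
  rw [← T.u_add, neg_add_cancel, T.u_zero]

theorem u_mul_neg (a : G) : T.u a * T.u (-a) = 1 := by
  rw [← T.u_add, add_neg_cancel, T.u_zero]

theorem F_mul_Finv : T.F * T.Finv = 1 := by
  simp only [F, Finv, Finset.sum_mul, Finset.mul_sum, Algebra.TensorProduct.tmul_mul_tmul,
    T.δ_mul, TensorProduct.ite_tmul, Finset.sum_ite_eq', Finset.sum_ite_eq, Finset.mem_univ,
    if_true, u_mul_neg, ← TensorProduct.sum_tmul, T.δ_sum]
  rfl

theorem Finv_mul_F : T.Finv * T.F = 1 := by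
  simp only [F, Finv, Finset.sum_mul, Finset.mul_sum, Algebra.TensorProduct.tmul_mul_tmul,
    T.δ_mul, TensorProduct.ite_tmul, Finset.sum_ite_eq', Finset.sum_ite_eq, Finset.mem_univ,
    if_true, u_neg_mul, ← TensorProduct.sum_tmul, T.δ_sum]
  rfl

/-- The twist as a unit. -/
noncomputable def Funit : (A ⊗[R] A)ˣ := ⟨T.F, T.Finv, T.F_mul_Finv, T.Finv_mul_F⟩

/-- The twisted coproduct `a ↦ F Δ(a) F⁻¹`. -/
noncomputable def comul : A →ₐ[R] A ⊗[R] A :=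
  AlgHom.ofLinearMap
    ((LinearMap.mulLeft R T.F ∘ₗ LinearMap.mulRight R T.Finv) ∘ₗ H.comul.toLinearMap)
    (by simp [F_mul_Finv])
    (fun a b => by
      have h := T.Finv_mul_F
      simp only [LinearMap.comp_apply, LinearMap.mulLeft_apply, LinearMap.mulRight_apply,
        AlgHom.toLinearMap_apply, map_mul]
      calc T.F * (H.comul a * H.comul b * T.Finv)
          = T.F * H.comul a * 1 * H.comul b * T.Finv := by noncomm_ring
        _ = _ := by rw [← h]; noncomm_ring)

theorem comul_apply (a : A) : T.comul a = T.F * (H.comul a * T.Finv) := rfl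

theorem comul_mul_F (a : A) : T.comul a * T.F = T.F * H.comul a := by
  rw [comul_apply, mul_assoc, mul_assoc, Finv_mul_F, mul_one]

/-- Orthogonality of the `δ a` reduces both sides to a comparison of the coefficients of `δ a ⊗ _`.
On the left the coefficient is `(u a ⊗ u a) F` by additivity of `u`, on the right it is `F Δ(u a)`;
they agree because `u a` is grouplike for the twisted coproduct. -/
theorem twist_cocycle :
    Algebra.TensorProduct.assoc R R R A A A (T.F ⊗ₜ[R] 1) * Algebra.TensorProduct.assoc R R R A A A
        (Algebra.TensorProduct.map H.comul (AlgHom.id R A) T.F) =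
      (1 ⊗ₜ[R] T.F) * Algebra.TensorProduct.map (AlgHom.id R A) H.comul T.F := by
  have h1 : Algebra.TensorProduct.assoc R R R A A A (T.F ⊗ₜ[R] 1) =
      ∑ a, T.δ a ⊗ₜ[R] (T.u a ⊗ₜ[R] (1 : A)) := by
    simp [F, TensorProduct.sum_tmul]
  have h2 : Algebra.TensorProduct.assoc R R R A A A
      (Algebra.TensorProduct.map H.comul (AlgHom.id R A) T.F) =
      ∑ b, T.δ b ⊗ₜ[R] (∑ c, T.δ c ⊗ₜ[R] T.u (b + c)) := by
    simp only [F, map_sum, Algebra.TensorProduct.map_tmul, T.comul_δ, TensorProduct.sum_tmul,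
      AlgHom.coe_id, id_eq, Algebra.TensorProduct.assoc_tmul, TensorProduct.tmul_sum]
    rw [Finset.sum_comm]
    refine Finset.sum_congr rfl fun b _ => ?_
    rw [← Equiv.sum_comp (Equiv.addLeft b)]
    simp
  have h3 : ∀ a, (T.u a ⊗ₜ[R] (1 : A)) * (∑ c, T.δ c ⊗ₜ[R] T.u (a + c)) =
      T.F * H.comul (T.u a) := by
    intro a
    rw [F, T.twist_comul_u, Finset.mul_sum, Finset.mul_sum]
    simp [T.u_add]
  have h4 : Algebra.TensorProduct.map (AlgHom.id R A) H.comul T.F =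
      ∑ a, T.δ a ⊗ₜ[R] H.comul (T.u a) := by
    simp [F]
  rw [h1, h2, h4, Finset.sum_mul, Finset.mul_sum]
  refine Finset.sum_congr rfl fun a _ => ?_
  rw [Finset.mul_sum]
  simp only [Algebra.TensorProduct.tmul_mul_tmul, T.δ_mul, TensorProduct.ite_tmul,
    Finset.sum_ite_eq, Finset.mem_univ, if_true, one_mul, h3]

theorem map_comul_id (z : A ⊗[R] A) :
    Algebra.TensorProduct.map T.comul (AlgHom.id R A) z =
      (T.F ⊗ₜ[R] 1) * (Algebra.TensorProduct.map H.comul (AlgHom.id R A) z * (T.Finv ⊗ₜ[R] 1)) := by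
  induction z with
  | zero => simp
  | add x y hx hy => rw [map_add, map_add, hx, hy, add_mul, mul_add]
  | tmul x y => simp [comul_apply]

theorem map_id_comul (z : A ⊗[R] A) :
    Algebra.TensorProduct.map (AlgHom.id R A) T.comul z =
      (1 ⊗ₜ[R] T.F) * (Algebra.TensorProduct.map (AlgHom.id R A) H.comul z * (1 ⊗ₜ[R] T.Finv)) := by
  induction z with
  | zero => simp
  | add x y hx hy => rw [map_add, map_add, hx, hy, add_mul, mul_add]
  | tmul x y => simp [comul_apply]

theorem base_coassoc (a : A) : Algebra.TensorProduct.assoc R R R A A A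
    (Algebra.TensorProduct.map H.comul (AlgHom.id R A) (H.comul a)) =
      Algebra.TensorProduct.map (AlgHom.id R A) H.comul (H.comul a) := H.coassoc a

theorem comul_coassoc (a : A) : Algebra.TensorProduct.assoc R R R A A A
    (Algebra.TensorProduct.map T.comul (AlgHom.id R A) (T.comul a)) =
      Algebra.TensorProduct.map (AlgHom.id R A) T.comul (T.comul a) := by
  rw [map_comul_id, map_id_comul, comul_apply]
  simp only [map_mul]
  rw [← base_coassoc]
  have hJ := T.twist_cocycle
  set α := Algebra.TensorProduct.assoc R R R A A A
  set Φ := fun z => α (Algebra.TensorProduct.map H.comul (AlgHom.id R A) z)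
  set Ψ := fun z => Algebra.TensorProduct.map (AlgHom.id R A) H.comul z
  have e1 : (α (T.F ⊗ₜ[R] 1) * Φ T.F) * (Φ T.Finv * α (T.Finv ⊗ₜ[R] 1)) = 1 := by
    calc _ = α ((T.F ⊗ₜ[R] 1) * Algebra.TensorProduct.map H.comul (AlgHom.id R A) (T.F * T.Finv)
          * (T.Finv ⊗ₜ[R] 1)) := by simp only [Φ, map_mul, mul_assoc]
      _ = 1 := by
        rw [F_mul_Finv, map_one, mul_one, Algebra.TensorProduct.tmul_mul_tmul, F_mul_Finv, mul_one,
          ← Algebra.TensorProduct.one_def, map_one]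
  have e2 : (Ψ T.Finv * (1 ⊗ₜ[R] T.Finv)) * ((1 ⊗ₜ[R] T.F) * Ψ T.F) = 1 := by
    calc _ = Ψ T.Finv * ((1 ⊗ₜ[R] T.Finv) * (1 ⊗ₜ[R] T.F)) * Ψ T.F := by
          simp only [mul_assoc]
      _ = 1 := by
        rw [Algebra.TensorProduct.tmul_mul_tmul, Finv_mul_F, mul_one,
          ← Algebra.TensorProduct.one_def, mul_one]
        simp only [Ψ]
        rw [← map_mul, Finv_mul_F, map_one]
  rw [← hJ] at e2
  -- After the cocycle identity is inserted in `e2`, that relation and `e1` give a left and a right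
  -- inverse of one and the same element. So the inverses also agree, which is the cocycle identity
  -- for `F⁻¹`.
  have e3 := left_inv_eq_right_inv e2 e1
  calc α (T.F ⊗ₜ[R] 1) * (Φ T.F * (Φ (H.comul a) * Φ T.Finv) * α (T.Finv ⊗ₜ[R] 1))
      = (α (T.F ⊗ₜ[R] 1) * Φ T.F) * Φ (H.comul a) * (Φ T.Finv * α (T.Finv ⊗ₜ[R] 1)) := by
        simp only [mul_assoc]
    _ = ((1 ⊗ₜ[R] T.F) * Ψ T.F) * Φ (H.comul a) * (Ψ T.Finv * (1 ⊗ₜ[R] T.Finv)) := by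
        rw [e3]; simp only [Φ, Ψ, hJ]
    _ = _ := by simp only [mul_assoc]; rfl

theorem counit_id_F : Algebra.TensorProduct.map H.counit (AlgHom.id R A) T.F = 1 := by
  simp [F, T.counit_δ, TensorProduct.ite_tmul, T.u_zero, Algebra.TensorProduct.one_def]

theorem id_counit_F : Algebra.TensorProduct.map (AlgHom.id R A) H.counit T.F = 1 := by
  simp [F, T.counit_u, ← TensorProduct.sum_tmul, T.δ_sum, Algebra.TensorProduct.one_def]

theorem counit_id_Finv : Algebra.TensorProduct.map H.counit (AlgHom.id R A) T.Finv = 1 := by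
  have h := congrArg (Algebra.TensorProduct.map H.counit (AlgHom.id R A)) T.Finv_mul_F
  rwa [map_mul, counit_id_F, mul_one, map_one] at h

theorem id_counit_Finv : Algebra.TensorProduct.map (AlgHom.id R A) H.counit T.Finv = 1 := by
  have h := congrArg (Algebra.TensorProduct.map (AlgHom.id R A) H.counit) T.Finv_mul_F
  rwa [map_mul, id_counit_F, mul_one, map_one] at h

theorem comul_counit_id (a : A) :
    Algebra.TensorProduct.map H.counit (AlgHom.id R A) (T.comul a) = 1 ⊗ₜ[R] a := by
  rw [comul_apply, map_mul, map_mul, counit_id_F, counit_id_Finv, one_mul, mul_one]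
  exact H.rTensor_counit a

theorem comul_id_counit (a : A) :
    Algebra.TensorProduct.map (AlgHom.id R A) H.counit (T.comul a) = a ⊗ₜ[R] 1 := by
  rw [comul_apply, map_mul, map_mul, id_counit_F, id_counit_Finv, one_mul, mul_one]
  exact H.lTensor_counit a

/-- The element `∑ g, δ g S(u g)`. -/
noncomputable def v : A := ∑ a, T.δ a * H.antipode (T.u a)

/-- The element `∑ g, δ g u g`, inverse to `v`. -/
noncomputable def w : A := ∑ a, T.δ a * T.u a

theorem leftSandwich_one_comul (a : A) :
    leftSandwich H.antipode 1 (H.comul a) = algebraMap R A (H.counit a) := by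
  rw [← H.antipode_left a, mul'_rTensor_eq]

theorem rightSandwich_one_comul (a : A) :
    rightSandwich H.antipode 1 (H.comul a) = algebraMap R A (H.counit a) := by
  rw [← H.antipode_right a, mul'_lTensor_eq]

theorem δ_mul_sum (f : G → A) (g : G) : T.δ g * ∑ a, T.δ a * f a = T.δ g * f g := by
  simp [Finset.mul_sum, ← mul_assoc, T.δ_mul]

theorem eq_of_δ_mul {x y : A} (h : ∀ g, T.δ g * x = T.δ g * y) : x = y := by
  rw [← one_mul x, ← one_mul y, ← T.δ_sum, Finset.sum_mul, Finset.sum_mul]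
  exact Finset.sum_congr rfl fun g _ => h g

theorem δ_mul_w (g : G) : T.δ g * T.w = T.δ g * T.u g := T.δ_mul_sum _ g

theorem δ_mul_v (g : G) : T.δ g * T.v = T.δ g * H.antipode (T.u g) := T.δ_mul_sum _ g

theorem antipode_u_mul (a b : G) :
    H.antipode (T.u a) * H.antipode (T.u b) = H.antipode (T.u (a + b)) := by
  rw [← T.antipode_mul, ← T.u_add, add_comm]

theorem leftSandwich_w_F : leftSandwich H.antipode T.w T.F = 1 := by
  simp only [F, map_sum, leftSandwich_tmul, T.antipode_δ, δ_mul_w, mul_assoc, u_neg_mul, mul_one]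
  exact (Equiv.sum_comp (Equiv.neg G) T.δ).trans T.δ_sum

theorem rightSandwich_v_Finv : rightSandwich H.antipode T.v T.Finv = 1 := by
  simp only [Finv, map_sum, rightSandwich_tmul, δ_mul_v, mul_assoc, antipode_u_mul,
    add_neg_cancel, T.u_zero, T.antipode_one, mul_one, T.δ_sum]

/-- Sandwiching `w` in `F Δ(u g) = (u g ⊗ u g) F` gives `1 = ∑ a, δ a S(u g) w u g u (-a)`.
Multiplication by `δ g` keeps only `a = g`, where the units cancel and `δ g S(u g) = δ g v` remains.
-/
theorem v_mul_w : T.v * T.w = 1 := by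
  refine T.eq_of_δ_mul fun g => ?_
  have h := congrArg (leftSandwich H.antipode T.w) (T.twist_comul_u g)
  change leftSandwich H.antipode T.w (T.F * _) = _ at h
  rw [leftSandwich_mul T.antipode_mul _ _ _ _ T.leftSandwich_w_F, leftSandwich_one_comul, T.counit_u,
    map_one, Finset.mul_sum, map_sum] at h
  simp only [Algebra.TensorProduct.tmul_mul_tmul, leftSandwich_tmul, T.antipode_mul,
    T.antipode_δ] at h
  rw [← Equiv.sum_comp (Equiv.neg G)] at h
  simp only [Equiv.neg_apply, neg_neg, mul_assoc] at h
  rw [h, δ_mul_sum, ← mul_assoc, δ_mul_v, u_mul_neg, mul_one, mul_assoc]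

/-- The twisted antipode `a ↦ v S(a) v⁻¹`. -/
noncomputable def antipode : A →ₗ[R] A :=
  (LinearMap.mulLeft R T.v ∘ₗ LinearMap.mulRight R T.w) ∘ₗ H.antipode

theorem antipode_apply (a : A) : T.antipode a = T.v * (H.antipode a * T.w) := rfl

theorem mul_antipode_rTensor (z : A ⊗[R] A) :
    LinearMap.mul' R A (T.antipode.rTensor A z) = T.v * leftSandwich H.antipode T.w z := by
  induction z with
  | zero => simp
  | add x y hx hy => rw [map_add, map_add, hx, hy, map_add, mul_add]
  | tmul x y => simp [antipode_apply, mul_assoc]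

theorem mul_antipode_lTensor (z : A ⊗[R] A) :
    LinearMap.mul' R A (T.antipode.lTensor A z) = rightSandwich H.antipode T.v z * T.w := by
  induction z with
  | zero => simp
  | add x y hx hy => rw [map_add, map_add, hx, hy, map_add, add_mul]
  | tmul x y => simp [antipode_apply, mul_assoc]

theorem leftSandwich_one_Finv : leftSandwich H.antipode 1 T.Finv = T.w := by
  simp only [Finv, map_sum, leftSandwich_tmul, T.antipode_δ, mul_one, w]
  exact Equiv.sum_comp (Equiv.neg G) fun a => T.δ a * T.u a

theorem rightSandwich_one_F : rightSandwich H.antipode 1 T.F = T.v := by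
  simp [F, v]

/-- The Hopf algebra twisted by `F = ∑ g, δ g ⊗ u g`. -/
noncomputable def hopfStructure : HopfStructure R A where
  comul := T.comul
  counit := H.counit
  antipode := T.antipode
  coassoc := T.comul_coassoc
  rTensor_counit := T.comul_counit_id
  lTensor_counit := T.comul_id_counit
  antipode_left a := by
    -- The middle element evolves as `w`, then `1` after `F`, then `ε(a)` after `Δ(a)`, and `F⁻¹`
    -- finally turns `1` into `w`. The result is `ε(a) v w`, so the one-sided relation `v w = 1` is
    -- enough.
    rw [mul_antipode_rTensor, comul_apply, leftSandwich_mul T.antipode_mul _ _ _ _ T.leftSandwich_w_F,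
      leftSandwich_mul T.antipode_mul _ _ _ _ (leftSandwich_one_comul a), leftSandwich_algebraMap,
      leftSandwich_one_Finv, mul_smul_comm, v_mul_w, Algebra.algebraMap_eq_smul_one]
  antipode_right a := by
    rw [mul_antipode_lTensor, comul_apply, ← mul_assoc,
      rightSandwich_mul T.antipode_mul _ _ _ _ T.rightSandwich_v_Finv,
      rightSandwich_mul T.antipode_mul _ _ _ _ (rightSandwich_one_comul a), rightSandwich_algebraMap,
      rightSandwich_one_F, smul_mul_assoc, v_mul_w, Algebra.algebraMap_eq_smul_one]

end TwistDatum
end ContactHopf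

namespace ContactHopf

/-! ### Toral elements -/

section Toral

open Polynomial

variable (K : Type*) [Field K] {p : ℕ} [Fact p.Prime] [CharP K p] {A : Type*} [Ring A] [Algebra K A]

/-- The embedding of the prime field. -/
noncomputable def cst (a : ZMod p) : K := ZMod.castHom (dvd_refl p) K a

theorem cst_injective : Function.Injective (cst K : ZMod p → K) := RingHom.injective _

@[simp] theorem cst_intCast (c : ℤ) : cst K (c : ZMod p) = (c : K) := map_intCast _ c

@[simp] theorem cst_natCast (c : ℕ) : cst K (c : ZMod p) = (c : K) := map_natCast _ c

@[simp] theorem cst_zero : cst K (0 : ZMod p) = 0 := map_zero _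

@[simp] theorem cst_one : cst K (1 : ZMod p) = 1 := map_one _

theorem cst_add (a b : ZMod p) : cst K (a + b) = cst K a + cst K b := map_add _ a b

theorem cst_neg (a : ZMod p) : cst K (-a) = -cst K a := map_neg _ a

theorem cst_sub (a b : ZMod p) : cst K (a - b) = cst K a - cst K b := map_sub _ a b

/-- The polynomial `1 - (X - a) ^ (p - 1)`, the indicator function of `a` on the prime field. -/
noncomputable def idemPoly (a : ZMod p) : K[X] := 1 - (X - C (cst K a)) ^ (p - 1)

theorem eval_idemPoly (a c : ZMod p) :
    (idemPoly K a).eval (cst K c) = if c = a then 1 else 0 := by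
  have hp := (Fact.out : p.Prime).two_le
  simp only [idemPoly, eval_sub, eval_one, eval_pow, eval_X, eval_C]
  split_ifs with h
  · rw [h, sub_self, zero_pow (by omega), sub_zero]
  · rw [← cst_sub, cst, ← map_pow, ZMod.pow_card_sub_one_eq_one (sub_ne_zero.mpr h), map_one,
      sub_self]

/-- The spectral idempotent of a toral element `h`, for the eigenvalue `a`. -/
noncomputable def idem (h : A) (a : ZMod p) : A := aeval h (idemPoly K a)

theorem idem_eq (h : A) (a : ZMod p) :
    idem K h a = 1 - (h - algebraMap K A (cst K a)) ^ (p - 1) := by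
  simp [idem, idemPoly]

variable {K}

/-- Modulo `X ^ p - X`, which kills `h`, the difference of the polynomials has degree below `p` and
vanishes at all `p` points of the prime field. Every identity between polynomials in a toral element
is thus checked on values. -/
theorem aeval_eq_of_eval_eq {h : A} (hh : h ^ p = h) {P Q : K[X]}
    (hPQ : ∀ c : ZMod p, P.eval (cst K c) = Q.eval (cst K c)) : aeval h P = aeval h Q := by
  have hp := (Fact.out : p.Prime).one_lt
  have hm : (X ^ p - X : K[X]).Monic := monic_X_pow_sub (by simpa using hp)
  have hd : (X ^ p - X : K[X]).natDegree = p := by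
    rw [natDegree_sub_eq_left_of_natDegree_lt] <;> simp [hp]
  have hr : (P - Q) %ₘ (X ^ p - X) = 0 := by
    refine eq_zero_of_natDegree_lt_card_of_eval_eq_zero _ (cst_injective K (p := p)) ?_ ?_
    · intro c
      have h1 : (X ^ p - X : K[X]).eval (cst K c) = 0 := by
        rw [eval_sub, eval_pow, eval_X, cst, ← map_pow, ZMod.pow_card, sub_self]
      have := congrArg (eval (cst K c)) (modByMonic_add_div (P - Q) (X ^ p - X))
      simpa [h1, hPQ] using this
    · rw [ZMod.card]
      have := natDegree_modByMonic_lt (P - Q) hm (by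
        intro h1
        rw [h1, natDegree_one] at hd
        omega)
      rwa [hd] at this
  have := congrArg (aeval h) (modByMonic_add_div (P - Q) (X ^ p - X))
  rw [hr, zero_add, map_mul] at this
  simp only [map_sub, map_pow, aeval_X, hh, sub_self, zero_mul] at this
  exact sub_eq_zero.mp this.symm

theorem aeval_mul_idem {h : A} (hh : h ^ p = h) (P : K[X]) (a : ZMod p) :
    aeval h P * idem K h a = P.eval (cst K a) • idem K h a := by
  rw [idem, ← map_mul, ← map_smul]
  refine aeval_eq_of_eval_eq hh fun c => ?_
  rw [eval_mul, eval_smul, eval_idemPoly, smul_eq_mul]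
  split_ifs with hc
  · rw [hc]
  · simp

theorem idem_mul_aeval {h : A} (hh : h ^ p = h) (P : K[X]) (a : ZMod p) :
    idem K h a * aeval h P = P.eval (cst K a) • idem K h a := by
  rw [← aeval_mul_idem hh, idem, ← map_mul, ← map_mul, mul_comm]

theorem idem_mul_idem {h : A} (hh : h ^ p = h) (a b : ZMod p) :
    idem K h a * idem K h b = if a = b then idem K h a else 0 := by
  rw [idem, aeval_mul_idem hh, eval_idemPoly]
  by_cases hab : a = b
  · simp [hab, idem]
  · simp [hab, Ne.symm hab]

theorem sum_idem {h : A} (hh : h ^ p = h) : ∑ a : ZMod p, idem K h a = 1 := by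
  simp only [idem]
  rw [← map_sum, ← map_one (aeval h : K[X] →ₐ[K] A)]
  refine aeval_eq_of_eval_eq hh fun c => ?_
  simp [eval_finsetSum, eval_idemPoly]

theorem aeval_eq_sum_idem {h : A} (hh : h ^ p = h) (P : K[X]) :
    aeval h P = ∑ a : ZMod p, P.eval (cst K a) • idem K h a := by
  rw [← mul_one (aeval h P), ← sum_idem (K := K) hh, Finset.mul_sum]
  exact Finset.sum_congr rfl fun a _ => aeval_mul_idem hh P a

theorem aeval_mul_of_mul_eq {h D : A} (c : K) (hD : h * D = D * (h + algebraMap K A c)) (P : K[X]) :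
    aeval h P * D = D * aeval (h + algebraMap K A c) P := by
  induction P using Polynomial.induction_on' with
  | add P Q hP hQ => rw [map_add, map_add, add_mul, mul_add, hP, hQ]
  | monomial n a =>
    have : ∀ n : ℕ, h ^ n * D = D * (h + algebraMap K A c) ^ n := by
      intro n
      induction n with
      | zero => simp
      | succ n ih => rw [pow_succ, mul_assoc, hD, ← mul_assoc, ih, mul_assoc, ← pow_succ]
    rw [aeval_monomial, aeval_monomial, mul_assoc, this, ← mul_assoc, Algebra.commutes, mul_assoc]

theorem idem_add_cst (h : A) (a b : ZMod p) :
    idem K (h + algebraMap K A (cst K b)) a = idem K h (a - b) := by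
  rw [idem_eq, idem_eq, cst_sub, map_sub]
  congr 2
  abel

/-- This shift of the spectral index by the weight is what turns conjugation by the twist into
multiplication by `(1 - y) ^ c`. -/
theorem idem_mul_of_mul_eq {h D : A} (c : ZMod p) (hD : h * D = D * (h + algebraMap K A (cst K c)))
    (a : ZMod p) : idem K h a * D = D * idem K h (a - c) := by
  rw [idem, aeval_mul_of_mul_eq _ hD, ← idem_add_cst, idem]

theorem map_idem {B : Type*} [Ring B] [Algebra K B] (f : A →ₐ[K] B) (h : A) (a : ZMod p) :
    f (idem K h a) = idem K (f h) a := by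
  rw [idem, idem, aeval_algHom_apply]

theorem idem_neg (h : A) [hp2 : Fact (2 < p)] (a : ZMod p) : idem K (-h) a = idem K h (-a) := by
  have he : Even (p - 1) := ((Fact.out : p.Prime).even_sub_one hp2.out.ne')
  rw [idem_eq, idem_eq, cst_neg, map_neg, sub_neg_eq_add, ← he.neg_pow (h + _)]
  congr 2
  abel

theorem idem_zero (a : ZMod p) : idem K (0 : A) a = if a = 0 then 1 else 0 := by
  have h := eval_idemPoly K a 0
  have h0 : (0 : A) = algebraMap K A (cst K (0 : ZMod p)) := by simp
  rw [idem, h0, aeval_algebraMap_apply_eq_algebraMap_eval, h]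
  by_cases ha : a = 0
  · simp [ha]
  · simp [ha, Ne.symm ha]

theorem aeval_mul_eigen {z e : A} (c : K) (hz : z * e = c • e) (P : K[X]) :
    aeval z P * e = P.eval c • e := by
  induction P using Polynomial.induction_on' with
  | add P Q hP hQ => rw [map_add, eval_add, add_mul, add_smul, hP, hQ]
  | monomial n a =>
    have : ∀ n : ℕ, z ^ n * e = c ^ n • e := by
      intro n
      induction n with
      | zero => simp
      | succ n ih => rw [pow_succ, mul_assoc, hz, mul_smul_comm, ih, smul_smul, pow_succ, mul_comm]
    rw [aeval_monomial, eval_monomial, mul_assoc, this, mul_smul_comm, ← Algebra.smul_def,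
      smul_smul, mul_comm]

/-- The products `idem x a * idem y b` sum to `1`, and `x + y` acts on each of them by the scalar `a
+ b`; a polynomial in `x + y` is therefore evaluated term by term. With `x = h ⊗ 1` and `y = 1 ⊗ h`
this yields the coproduct of an idempotent of `h`. -/
theorem idem_add_of_commute {x y : A} (hx : x ^ p = x) (hy : y ^ p = y) (hxy : Commute x y)
    (g : ZMod p) : idem K (x + y) g = ∑ a : ZMod p, idem K x a * idem K y (g - a) := by
  have hc : ∀ a b : ZMod p, (x + y) * (idem K x a * idem K y b) =
      cst K (a + b) • (idem K x a * idem K y b) := by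
    intro a b
    have h1 : x * idem K x a = cst K a • idem K x a := by
      simpa using aeval_mul_idem (K := K) hx X a
    have h2 : y * idem K y b = cst K b • idem K y b := by
      simpa using aeval_mul_idem (K := K) hy X b
    have h3 : y * idem K x a = idem K x a * y := by
      have := idem_mul_of_mul_eq (K := K) (h := x) (D := y) 0 (by simpa using hxy.eq) a
      simpa using this.symm
    rw [add_mul, ← mul_assoc, h1, ← mul_assoc y, h3, mul_assoc _ y, h2, cst_add, add_smul,
      smul_mul_assoc, mul_smul_comm]
  calc idem K (x + y) g = idem K (x + y) g * ((∑ a : ZMod p, idem K x a) *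
        ∑ b : ZMod p, idem K y b) := by rw [sum_idem hx, sum_idem hy, mul_one, mul_one]
    _ = ∑ a : ZMod p, ∑ b : ZMod p, if b = g - a then idem K x a * idem K y b else 0 := by
      simp only [Finset.sum_mul, Finset.mul_sum]
      rw [Finset.sum_comm]
      refine Finset.sum_congr rfl fun a _ => Finset.sum_congr rfl fun b _ => ?_
      rw [idem, aeval_mul_eigen _ (hc a b), eval_idemPoly]
      by_cases h : b = g - a
      · simp [h]
      · rw [if_neg, if_neg h, zero_smul]
        exact fun h' => h (eq_sub_of_add_eq' h')
    _ = _ := by simp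

/-- The power of a unit of order dividing `p`, with exponent an integer modulo `p`. -/
def zpowMod (u : Aˣ) (a : ZMod p) : Aˣ := u ^ a.val

theorem zpowMod_intCast {u : Aˣ} (hu : u ^ p = 1) (c : ℤ) : zpowMod u (c : ZMod p) = u ^ c := by
  rw [zpow_eq_zpow_emod' c hu, ← ZMod.val_intCast, zpowMod, zpow_natCast]

theorem zpowMod_natCast {u : Aˣ} (hu : u ^ p = 1) (c : ℕ) : zpowMod u (c : ZMod p) = u ^ c := by
  exact_mod_cast zpowMod_intCast hu c

theorem zpowMod_zero (u : Aˣ) : zpowMod u (0 : ZMod p) = 1 := by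
  simp [zpowMod]

theorem zpowMod_add {u : Aˣ} (hu : u ^ p = 1) (a b : ZMod p) :
    zpowMod u (a + b) = zpowMod u a * zpowMod u b := by
  obtain ⟨a, rfl⟩ := ZMod.intCast_surjective a
  obtain ⟨b, rfl⟩ := ZMod.intCast_surjective b
  rw [← Int.cast_add, zpowMod_intCast hu, zpowMod_intCast hu, zpowMod_intCast hu, zpow_add]

theorem aeval_descPochhammer_int (h : A) (r : ℕ) :
    aeval h (descPochhammer ℤ r) = aeval h (descPochhammer K r) := by
  rw [← descPochhammer_map (algebraMap ℤ K), aeval_map_algebraMap]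

theorem rising_eq_aeval (h : A) (r : ℕ) : rising h r = aeval h (ascPochhammer K r) := by
  rw [rising, ← ascPochhammer_map (algebraMap ℤ K), aeval_map_algebraMap]

/-- A falling factorial at a residue class becomes an honest binomial coefficient of its
representative in `[0, p)`; in particular it vanishes for `m` above this representative, which makes
sums up to `p - 1` agree with binomial expansions. -/
theorem descPochhammer_eval_div_factorial (K : Type*) [Field K] [CharP K p] (a : ZMod p) {m : ℕ}
    (hm : m < p) :
    (descPochhammer K m).eval (cst K a) * (m.factorial : K)⁻¹ = (a.val.choose m : K) := by
  have hne : (m.factorial : K) ≠ 0 := by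
    rw [Ne, CharP.cast_eq_zero_iff K p, (Fact.out : p.Prime).dvd_factorial]
    omega
  have ha : cst K a = (a.val : K) := by
    rw [← cst_natCast K (p := p), ZMod.natCast_zmod_val]
  rw [ha, descPochhammer_eval_eq_descFactorial, Nat.descFactorial_eq_factorial_mul_choose]
  push_cast
  field_simp

end Toral

end ContactHopf

namespace ContactHopf

/-! ### Binomial identities for a pair `h y = y (h + 1)` -/

section Pair

open Polynomial

/-- A toral element `h` and an element `y` with `y ^ p = 0` and `[h, y] = y`. -/
structure IsToralNilPair (p : ℕ) {A : Type*} [Ring A] (h y : A) : Prop where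
  toral : h ^ p = h
  nil : y ^ p = 0
  comm : h * y = y * (h + 1)

/-- The operator `(1 / m!) (ad y) ^ m`. -/
noncomputable def divAd (K : Type*) [Field K] {A : Type*} [Ring A] [Algebra K A] (y : A) (m : ℕ) :
    A →ₗ[K] A :=
  ((m.factorial : K)⁻¹) • (LinearMap.mulLeft K y - LinearMap.mulRight K y) ^ m

variable {K : Type*} [Field K] {p : ℕ} [Fact p.Prime] [CharP K p] {A : Type*} [Ring A] [Algebra K A]

theorem natCast_factorial_ne_zero (K : Type*) [Field K] [CharP K p] {m : ℕ} (hm : m < p) :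
    (m.factorial : K) ≠ 0 := by
  rw [Ne, CharP.cast_eq_zero_iff K p, (Fact.out : p.Prime).dvd_factorial]
  omega

theorem divAd_zero (y D : A) : divAd K y 0 D = D := by simp [divAd]

theorem commute_mulLeft_mulRight (y z : A) :
    Commute (LinearMap.mulLeft K y) (LinearMap.mulRight K z) := by
  ext D
  simp [mul_assoc]

theorem divAd_succ (y D : A) {m : ℕ} (hm : m + 1 < p) :
    ((m : K) + 1) • divAd K y (m + 1) D = y * divAd K y m D - divAd K y m D * y := by
  have h1 := natCast_factorial_ne_zero K (p := p) hm
  have h2 := natCast_factorial_ne_zero K (p := p) (m := m) (by omega)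
  have h3 : ((m : K) + 1) ≠ 0 := by
    rw [Nat.factorial_succ] at h1
    push_cast at h1
    exact left_ne_zero_of_mul h1
  simp only [divAd, LinearMap.smul_apply, pow_succ', Module.End.mul_apply, LinearMap.sub_apply,
    LinearMap.mulLeft_apply, LinearMap.mulRight_apply, Nat.factorial_succ, smul_smul,
    mul_smul_comm, smul_mul_assoc, ← smul_sub]
  congr 1
  push_cast
  field_simp

/-- Left and right multiplication by `y` commute, so in characteristic `p` one has `(ad y) ^ p = L_y
^ p - R_y ^ p = 0`. This closes the recursion of `divAd_succ`, whose factor `m + 1` is zero in the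
field at `m = p - 1`. -/
theorem divAd_last [Nontrivial A] {y : A} (hy : y ^ p = 0) (D : A) :
    y * divAd K y (p - 1) D - divAd K y (p - 1) D * y = 0 := by
  have : CharP (Module.End K A) p :=
    charP_of_injective_algebraMap (algebraMap K (Module.End K A)).injective p
  have hp := (Fact.out : p.Prime).one_lt
  have h1 : (LinearMap.mulLeft K y - LinearMap.mulRight K y) ^ p = 0 := by
    rw [sub_pow_char_of_commute _ (commute_mulLeft_mulRight y y), LinearMap.pow_mulLeft,
      LinearMap.pow_mulRight, hy]
    simp
  have h2 := congrArg (fun f : Module.End K A => f D) h1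
  obtain ⟨m, rfl⟩ : ∃ m, p = m + 1 := ⟨p - 1, by omega⟩
  rw [pow_succ'] at h2
  simp only [Module.End.mul_apply, LinearMap.sub_apply, LinearMap.mulLeft_apply,
    LinearMap.mulRight_apply, LinearMap.zero_apply] at h2
  simp only [divAd, Nat.add_sub_cancel, LinearMap.smul_apply, mul_smul_comm, smul_mul_assoc,
    ← smul_sub, h2, smul_zero]

/-- The unit `1 - y` for `y ^ p = 0`. -/
noncomputable def oneSubUnit {y : A} (hy : y ^ p = 0) : Aˣ :=
  (IsNilpotent.isUnit_one_sub (r := y) ⟨p, hy⟩).unit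

@[simp] theorem val_oneSubUnit {y : A} (hy : y ^ p = 0) : (oneSubUnit hy : A) = 1 - y := rfl

theorem oneSubUnit_pow [CharP A p] {y : A} (hy : y ^ p = 0) : oneSubUnit hy ^ p = 1 := by
  ext
  rw [Units.val_pow_eq_pow_val, val_oneSubUnit, sub_pow_char_of_commute _ (Commute.one_left y), hy]
  simp

/-- Right multiplication by `1 - y` is the sum of the commuting operators `ad y` and left
multiplication by `1 - y`; the binomial theorem applies. -/
theorem mul_oneSub_pow (K : Type*) [Field K] [Algebra K A] (y D : A) (c : ℕ) :
    D * (1 - y) ^ c = ∑ m ∈ Finset.range (c + 1), (c.choose m : K) •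
      ((1 - y) ^ (c - m) * ((LinearMap.mulLeft K y - LinearMap.mulRight K y) ^ m) D) := by
  have h1 : LinearMap.mulRight K (1 - y) =
      (LinearMap.mulLeft K y - LinearMap.mulRight K y) + LinearMap.mulLeft K (1 - y) := by
    ext D
    simp [mul_sub, sub_mul]
  have h2 : Commute (LinearMap.mulLeft K y - LinearMap.mulRight K y)
      (LinearMap.mulLeft K (1 - y)) := by
    refine Commute.sub_left ?_ ((commute_mulLeft_mulRight _ _).symm)
    ext D
    simp [mul_sub, sub_mul, mul_assoc]
  have h3 := congrArg (fun f : Module.End K A => f D) (h2.add_pow c)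
  rw [← h1, LinearMap.pow_mulRight] at h3
  simp only [LinearMap.mulRight_apply] at h3
  rw [h3, LinearMap.sum_apply]
  refine Finset.sum_congr rfl fun m _ => ?_
  rw [(h2.pow_pow _ _).eq, ← nsmul_eq_mul', LinearMap.pow_mulLeft, LinearMap.smul_apply,
    Nat.cast_smul_eq_nsmul]
  rfl

variable [CharP A p]

/-- The power of `1 - y` with exponent an integer modulo `p`. -/
noncomputable def oneSubPow {y : A} (hy : y ^ p = 0) (c : ZMod p) : A :=
  (zpowMod (oneSubUnit hy) c : Aˣ)

theorem oneSubPow_zero {y : A} (hy : y ^ p = 0) : oneSubPow hy 0 = 1 := by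
  rw [oneSubPow, zpowMod_zero, Units.val_one]

theorem oneSubPow_add {y : A} (hy : y ^ p = 0) (a b : ZMod p) :
    oneSubPow hy (a + b) = oneSubPow hy a * oneSubPow hy b := by
  rw [oneSubPow, zpowMod_add (oneSubUnit_pow hy), Units.val_mul, oneSubPow, oneSubPow]

theorem oneSubPow_natCast {y : A} (hy : y ^ p = 0) (n : ℕ) :
    oneSubPow hy (n : ZMod p) = (1 - y) ^ n := by
  rw [oneSubPow, zpowMod_natCast (oneSubUnit_pow hy), Units.val_pow_eq_pow_val, val_oneSubUnit]

theorem oneSubPow_intCast {y : A} (hy : y ^ p = 0) (n : ℤ) :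
    oneSubPow hy (n : ZMod p) = (oneSubUnit hy ^ n : Aˣ) := by
  rw [oneSubPow, zpowMod_intCast (oneSubUnit_pow hy)]

theorem oneSubPow_one {y : A} (hy : y ^ p = 0) : oneSubPow hy (1 : ZMod p) = 1 - y := by
  simpa using oneSubPow_natCast hy 1

theorem oneSubPow_mul_neg {y : A} (hy : y ^ p = 0) (a : ZMod p) :
    oneSubPow hy a * oneSubPow hy (-a) = 1 := by
  rw [← oneSubPow_add, add_neg_cancel, oneSubPow_zero]

theorem oneSubPow_neg_mul {y : A} (hy : y ^ p = 0) (a : ZMod p) :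
    oneSubPow hy (-a) * oneSubPow hy a = 1 := by
  rw [← oneSubPow_add, neg_add_cancel, oneSubPow_zero]

theorem oneSubPow_eq {y : A} (hy : y ^ p = 0) (c : ZMod p) :
    oneSubPow hy c = (1 - y) ^ c.val := by
  rw [← oneSubPow_natCast hy, ZMod.natCast_zmod_val]

theorem commute_oneSubPow {y z : A} (hy : y ^ p = 0) (hz : Commute z y) (c : ZMod p) :
    Commute z (oneSubPow hy c) := by
  rw [oneSubPow_eq]
  exact ((Commute.one_right z).sub_right hz).pow_right _

/-- The range of summation no longer depends on `c`, and the coefficients are polynomial in `c`.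
Next to an idempotent of eigenvalue `c`, they can therefore be traded for the same polynomial in
`h`. -/
theorem mul_oneSubPow {y : A} (hy : y ^ p = 0) (D : A) (c : ZMod p) :
    D * oneSubPow hy c = ∑ m ∈ Finset.range p,
      (descPochhammer K m).eval (cst K c) •
        (oneSubPow hy (c - (m : ZMod p)) * divAd K y m D) := by
  have hc : c.val + 1 ≤ p := ZMod.val_lt c
  rw [oneSubPow_eq, mul_oneSub_pow K, ← Finset.sum_subset (Finset.range_subset_range.mpr hc)]
  · refine Finset.sum_congr rfl fun m hm => ?_
    rw [Finset.mem_range] at hm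
    have h1 : oneSubPow hy (c - (m : ZMod p)) = (1 - y) ^ (c.val - m) := by
      rw [← oneSubPow_natCast hy, Nat.cast_sub (by omega), ZMod.natCast_zmod_val]
    rw [h1, divAd, LinearMap.smul_apply, mul_smul_comm, smul_smul,
      descPochhammer_eval_div_factorial K c (by omega)]
  · intro m hm hm'
    rw [Finset.mem_range] at hm hm'
    have h4 := descPochhammer_eval_div_factorial K c hm
    rw [Nat.choose_eq_zero_of_lt (by omega), Nat.cast_zero] at h4
    have := (mul_eq_zero.mp h4).resolve_right (inv_ne_zero (natCast_factorial_ne_zero K hm))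
    rw [this, zero_smul]

theorem divAd_weight {h y : A} (hc : h * y = y * (h + 1)) {D : A} {c : K}
    (hD : h * D = D * (h + algebraMap K A c)) (m : ℕ) :
    h * divAd K y m D = divAd K y m D * (h + algebraMap K A (c + m)) := by
  have : ∀ m : ℕ, h * ((LinearMap.mulLeft K y - LinearMap.mulRight K y) ^ m) D =
      ((LinearMap.mulLeft K y - LinearMap.mulRight K y) ^ m) D *
        (h + algebraMap K A (c + m)) := by
    intro m
    induction m with
    | zero => simpa using hD
    | succ m ih =>
      rw [pow_succ', Module.End.mul_apply]
      set E := ((LinearMap.mulLeft K y - LinearMap.mulRight K y) ^ m) D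
      have hk : algebraMap K A (c + (m + 1 : ℕ)) = algebraMap K A (c + m) + 1 := by
        simp [add_assoc]
      have hy : Commute y (algebraMap K A (c + m)) := (Algebra.commutes _ _).symm
      simp only [LinearMap.sub_apply, LinearMap.mulLeft_apply, LinearMap.mulRight_apply, hk]
      generalize algebraMap K A (c + m) = k at *
      calc h * (y * E - E * y) = (h * y) * E - (h * E) * y := by noncomm_ring
        _ = (y * (h + 1)) * E - (E * (h + k)) * y := by rw [hc, ih]
        _ = y * (h * E) + y * E - (E * (h * y) + E * (k * y)) := by noncomm_ring
        _ = _ := by rw [ih, hc, ← hy.eq]; noncomm_ring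
  rw [divAd, LinearMap.smul_apply, mul_smul_comm, this, smul_mul_assoc]

theorem rising_succ_left (z : A) (m : ℕ) : rising z (m + 1) = z * rising (z + 1) m := by
  simp [rising, ascPochhammer_succ_left, aeval_comp]

theorem rising_succ_right (z : A) (m : ℕ) : rising z (m + 1) = rising z m * (z + m) := by
  simp [rising, ascPochhammer_succ_right]

theorem rising_zero (z : A) : rising z 0 = 1 := by
  simp [rising]

theorem commute_rising {x z : A} (h : Commute x z) (m : ℕ) : Commute x (rising z m) := by
  induction m with
  | zero => simp [rising_zero]
  | succ m ih =>
    rw [rising_succ_right]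
    exact ih.mul_right (h.add_right (Nat.cast_commute m x).symm)

theorem rising_add_one_succ (z : A) (m : ℕ) :
    rising (z + 1) (m + 1) = rising z (m + 1) + ((m : A) + 1) * rising (z + 1) m := by
  rw [rising_succ_left z, rising_succ_right (z + 1), ← add_mul,
    (commute_rising (x := z + ((m : A) + 1)) (z := z + 1) (m := m) ?_).eq]
  · congr 1
    abel
  · refine Commute.add_left ((Commute.refl z).add_right (Commute.one_right z)) ?_
    exact_mod_cast Nat.cast_commute (m + 1) (z + 1)

theorem rising_mul {z y : A} (hz : z * y = y * (z + 1)) (m : ℕ) :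
    rising z m * y = y * rising (z + 1) m := by
  induction m with
  | zero => simp [rising_zero]
  | succ m ih =>
    have h1 : (z + (m : A)) * y = y * (z + 1 + m) := by
      rw [add_mul, hz, Nat.cast_comm]
      noncomm_ring
    rw [rising_succ_right, rising_succ_right, mul_assoc, h1, ← mul_assoc, ih, mul_assoc]

/-- The sum `∑ m, (1 / m!) (ad y) ^ m (D) z (z + 1) ⋯ (z + m - 1)`. -/
noncomputable def risingSum (K : Type*) [Field K] [Algebra K A] (p : ℕ) (y D z : A) : A :=
  ∑ m ∈ Finset.range p, divAd K y m D * rising z m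

/-- Moving `y` leftwards through the `m`-th term costs `(m + 1) d^{(m+1)}(D)` times a rising
factorial. The change of the rising factorials from `z` to `z + 1` produces the same sum, and the
two cancel. The term `m = p - 1` costs nothing by `divAd_last`. -/
theorem oneSub_mul_risingSum [Nontrivial A] {y z : A} (hy : y ^ p = 0)
    (hz : z * y = y * (z + 1)) (D : A) :
    (1 - y) * risingSum K p y D (z + 1) = risingSum K p y D z * (1 - y) := by
  obtain ⟨N, hN⟩ : ∃ N, p = N + 1 := ⟨p - 1, by have := (Fact.out : p.Prime).one_lt; omega⟩
  have h1 : risingSum K p y D z * y = y * risingSum K p y D (z + 1) -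
      ∑ m ∈ Finset.range N, (((m : K) + 1) • divAd K y (m + 1) D) * rising (z + 1) m := by
    have hs : ∀ m ∈ Finset.range N, divAd K y m D * rising z m * y =
        y * (divAd K y m D * rising (z + 1) m) -
          (((m : K) + 1) • divAd K y (m + 1) D) * rising (z + 1) m := by
      intro m hm
      rw [Finset.mem_range] at hm
      rw [divAd_succ (p := p) y D (by omega), mul_assoc, rising_mul hz]
      noncomm_ring
    have hl : divAd K y N D * rising z N * y = y * (divAd K y N D * rising (z + 1) N) := by
      have := divAd_last (K := K) hy D
      rw [hN, Nat.add_sub_cancel, sub_eq_zero] at this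
      rw [mul_assoc, rising_mul hz, ← mul_assoc, ← this, mul_assoc]
    rw [risingSum, risingSum, hN, Finset.sum_range_succ, Finset.sum_range_succ, add_mul, mul_add,
      Finset.sum_mul, Finset.mul_sum, Finset.sum_congr rfl hs, Finset.sum_sub_distrib, hl]
    abel
  have h2 : risingSum K p y D (z + 1) = risingSum K p y D z +
      ∑ m ∈ Finset.range N, (((m : K) + 1) • divAd K y (m + 1) D) * rising (z + 1) m := by
    rw [risingSum, risingSum, hN, Finset.sum_range_succ', Finset.sum_range_succ', rising_zero,
      rising_zero, add_right_comm, ← Finset.sum_add_distrib]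
    congr 1
    refine Finset.sum_congr rfl fun m _ => ?_
    rw [rising_add_one_succ, mul_add, smul_mul_assoc, ← mul_smul_comm, Algebra.smul_def]
    simp
  rw [sub_mul, mul_sub, one_mul, mul_one, h1]
  nth_rewrite 1 [h2]
  abel

theorem oneSub_pow_mul_risingSum [Nontrivial A] {y z : A} (hy : y ^ p = 0)
    (hz : z * y = y * (z + 1)) (D : A) (n : ℕ) :
    (1 - y) ^ n * risingSum K p y D (z + n) = risingSum K p y D z * (1 - y) ^ n := by
  induction n with
  | zero => simp
  | succ n ih =>
    have h1 : (z + (n : A)) * y = y * ((z + n) + 1) := by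
      rw [add_mul, hz, Nat.cast_comm]
      noncomm_ring
    have := oneSub_mul_risingSum (K := K) hy h1 D
    rw [pow_succ, mul_assoc, Nat.cast_succ, ← add_assoc, this, ← mul_assoc, ih, mul_assoc,
      ← pow_succ]

/-- Falling from `z + m` and rising from `z + 1` list the same `m` factors. Hence the weight shift
by `m` under `(ad y) ^ m` converts falling factorials of `h` into rising factorials of `h + 1`. -/
theorem aeval_add_descPochhammer (z : A) (m : ℕ) :
    aeval (z + m) (descPochhammer K m) = rising (z + 1) m := by
  rw [rising_eq_aeval (K := K), ← eval_map_algebraMap, ← eval_map_algebraMap, descPochhammer_map,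
    ascPochhammer_map, descPochhammer_eval_eq_ascPochhammer, add_sub_cancel_right]

variable {h y : A}

namespace IsToralNilPair

theorem oneSubPow_mul (P : IsToralNilPair p h y) (n : ℕ) :
    oneSubPow P.nil (n : ZMod p) * h =
      (h - n) * oneSubPow P.nil (n : ZMod p) + n * oneSubPow P.nil ((n : ZMod p) - 1) := by
  induction n with
  | zero => simp [oneSubPow_zero]
  | succ n ih =>
    have h1 : oneSubPow P.nil ((n + 1 : ℕ) : ZMod p) = (1 - y) * oneSubPow P.nil (n : ZMod p) := by
      rw [← oneSubPow_one P.nil, ← oneSubPow_add, Nat.cast_succ, add_comm]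
    have h2 : (1 - y) * oneSubPow P.nil ((n : ZMod p) - 1) = oneSubPow P.nil (n : ZMod p) := by
      rw [← oneSubPow_one P.nil, ← oneSubPow_add]
      congr 1
      abel
    have h3 : (1 - y) * h = (h - 1) * (1 - y) + 1 := by
      have e : y * h = h * y - y := by
        rw [P.comm]
        noncomm_ring
      rw [sub_mul, e]
      noncomm_ring
    have h4 : (1 - y) * (n : A) = n * (1 - y) := (Nat.cast_comm n _).symm
    rw [h1, mul_assoc, ih, Nat.cast_succ, Nat.cast_succ, add_sub_cancel_right, mul_add,
      ← mul_assoc _ (n : A), h4, mul_assoc (n : A), h2, ← mul_assoc (1 - y), mul_sub (1 - y) h, h3,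
      h4]
    noncomm_ring

theorem idem_mul_oneSubPow_mul (P : IsToralNilPair p h y) (g : ZMod p) (m : ℕ) :
    idem K h g * oneSubPow P.nil g * aeval h (descPochhammer K m) =
      (descPochhammer K m).eval (cst K g) •
        (idem K h g * oneSubPow P.nil (g - (m : ZMod p))) := by
  induction m with
  | zero => simp
  | succ m ih =>
    -- In `oneSubPow_mul`, the element `h` standing next to the idempotent becomes the scalar `g`.
    -- At `c = g - m` the first coefficient is `m`, which the factor `h - m` of the next falling
    -- factorial cancels.
    have h1 : ∀ c : ZMod p, idem K h g * oneSubPow P.nil c * h = cst K (g - c) •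
        (idem K h g * oneSubPow P.nil c) + cst K c • (idem K h g * oneSubPow P.nil (c - 1)) := by
      intro c
      have h2 := P.oneSubPow_mul c.val
      have h3 : ((c.val : ℕ) : A) = algebraMap K A (cst K c) := by
        rw [← map_natCast (algebraMap K A), ← cst_natCast K (p := p), ZMod.natCast_zmod_val]
      have h4 : idem K h g * h = cst K g • idem K h g := by
        simpa using idem_mul_aeval (K := K) P.toral X g
      rw [ZMod.natCast_zmod_val, h3] at h2
      rw [mul_assoc, h2, mul_add, ← mul_assoc, mul_sub, h4, ← mul_assoc, ← Algebra.commutes,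
        ← Algebra.smul_def, ← sub_smul, smul_mul_assoc, smul_mul_assoc, cst_sub]
    rw [descPochhammer_succ_right, map_mul, ← mul_assoc, ih, smul_mul_assoc, map_sub, aeval_X,
      map_natCast, mul_sub, h1, sub_sub_cancel, eval_mul, mul_smul, ← Nat.cast_comm,
      ← nsmul_eq_mul, ← Nat.cast_smul_eq_nsmul K, cst_natCast]
    congr 1
    simp [sub_sub, cst_sub]

theorem eq_of_idem_mul (P : IsToralNilPair p h y) {a b : A}
    (H : ∀ g : ZMod p, idem K h g * a = idem K h g * b) : a = b := by
  rw [← one_mul a, ← one_mul b, ← sum_idem (K := K) P.toral, Finset.sum_mul, Finset.sum_mul]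
  exact Finset.sum_congr rfl fun g _ => H g

/-- The element `∑ g, δ_g(h) (1 - y) ^ g`. -/
noncomputable def w (K : Type*) [Field K] [CharP K p] [Algebra K A]
    (P : IsToralNilPair p h y) : A :=
  ∑ a : ZMod p, idem K h a * oneSubPow P.nil a

theorem idem_mul_w (P : IsToralNilPair p h y) (g : ZMod p) :
    idem K h g * P.w K = idem K h g * oneSubPow P.nil g := by
  simp [w, Finset.mul_sum, ← mul_assoc, idem_mul_idem P.toral]

/-- Equality is tested against each idempotent `δ_g`, where `w` becomes `(1 - y) ^ g` and
`mul_oneSubPow` expands the product with `D`. The scalars depending on `g` are reabsorbed as falling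
factorials of `h` to the right of `w`, so a single expression serves all `g`. -/
theorem mul_w [Nontrivial A] (P : IsToralNilPair p h y) {D : A} (c : ZMod p)
    (hD : h * D = D * (h + algebraMap K A (cst K c))) :
    D * P.w K = P.w K * (oneSubPow P.nil (-c) * risingSum K p y D (h + 1)) := by
  have h1 : D * P.w K = P.w K * ((∑ m ∈ Finset.range p,
      aeval h (descPochhammer K m) * divAd K y m D) * oneSubPow P.nil (-c)) := by
    refine P.eq_of_idem_mul (K := K) fun g => ?_
    rw [← mul_assoc, idem_mul_of_mul_eq c hD, mul_assoc, idem_mul_w, ← mul_assoc,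
      ← idem_mul_of_mul_eq c hD, ← mul_assoc, idem_mul_w, sub_eq_add_neg, oneSubPow_add,
      ← mul_assoc, ← mul_assoc]
    congr 1
    rw [mul_assoc, mul_oneSubPow (K := K) P.nil, Finset.mul_sum, Finset.mul_sum]
    refine Finset.sum_congr rfl fun m _ => ?_
    rw [← mul_assoc, idem_mul_oneSubPow_mul P, mul_smul_comm, smul_mul_assoc, mul_assoc]
  have hc : algebraMap K A (cst K c) = ((c.val : ℕ) : A) := by
    rw [← map_natCast (algebraMap K A), ← cst_natCast K (p := p), ZMod.natCast_zmod_val]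
  have h2 : (∑ m ∈ Finset.range p, aeval h (descPochhammer K m) * divAd K y m D) =
      risingSum K p y D (h + 1 + (c.val : ℕ)) := by
    refine Finset.sum_congr rfl fun m _ => ?_
    rw [aeval_mul_of_mul_eq _ (divAd_weight P.comm hD m), map_add, map_natCast, hc, ← add_assoc,
      aeval_add_descPochhammer, add_right_comm]
  have hz : (h + 1) * y = y * (h + 1 + 1) := by
    rw [add_mul, P.comm]
    noncomm_ring
  -- Pulling `(1 - y) ^ c` through the sum removes the shift by the weight `c` from its argument,
  -- and the surplus powers of `1 - y` cancel.
  have h3 := oneSub_pow_mul_risingSum (K := K) P.nil hz D c.val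
  rw [← oneSubPow_eq P.nil] at h3
  rw [h1, h2]
  congr 1
  calc _ = oneSubPow P.nil (-c) * (oneSubPow P.nil c * risingSum K p y D (h + 1 + (c.val : ℕ))) *
        oneSubPow P.nil (-c) := by rw [← mul_assoc, oneSubPow_neg_mul, one_mul]
    _ = _ := by rw [h3, mul_assoc, mul_assoc, oneSubPow_mul_neg, mul_one]

end IsToralNilPair

end Pair

end ContactHopf

namespace ContactHopf

/-! ### The twist attached to a pair `h y = y (h + 1)` -/

section Tensor

open Polynomial

variable {K : Type*} [Field K] {p : ℕ} [Fact p.Prime] [CharP K p] {R : Type*} [CommRing R]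
  [Algebra K R] {A : Type*} [Ring A] [Algebra K A] [Algebra R A] [IsScalarTower K R A] [CharP A p]
  {h y : A}

namespace IsToralNilPair

/-- The twist `∑ a, δ_a(h) ⊗ (1 - y) ^ a`. -/
noncomputable def twistElt (K R : Type*) [Field K] [CharP K p] [Algebra K A] [CommRing R]
    [Algebra R A] (P : IsToralNilPair p h y) : A ⊗[R] A :=
  ∑ a : ZMod p, idem K h a ⊗ₜ[R] oneSubPow P.nil a

theorem tmul_mul_twistElt (P : IsToralNilPair p h y) (f : K[X]) (z : A) :
    (aeval h f ⊗ₜ[R] z) * P.twistElt K R =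
      ∑ a : ZMod p, idem K h a ⊗ₜ[R] (f.eval (cst K a) • (z * oneSubPow P.nil a)) := by
  rw [twistElt, Finset.mul_sum]
  refine Finset.sum_congr rfl fun a _ => ?_
  rw [Algebra.TensorProduct.tmul_mul_tmul, aeval_mul_idem P.toral, TensorProduct.smul_tmul]

/-- On the eigenspace `a` the coefficient of `y ^ r` is `(-1) ^ r` times a binomial coefficient of
`a`, so the series sums to `(1 - y) ^ a`. -/
theorem sum_eq_twistElt (P : IsToralNilPair p h y) :
    ∑ r ∈ Finset.range p, (((-1) ^ r * (r.factorial : K)⁻¹) •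
      aeval h (descPochhammer ℤ r)) ⊗ₜ[R] (y ^ r) = P.twistElt K R := by
  simp only [aeval_descPochhammer_int (K := K), aeval_eq_sum_idem P.toral, Finset.smul_sum,
    TensorProduct.sum_tmul]
  rw [Finset.sum_comm, twistElt]
  refine Finset.sum_congr rfl fun a _ => ?_
  have h1 : (1 - y) ^ a.val = ∑ r ∈ Finset.range p, ((-1) ^ r * (a.val.choose r : K)) • y ^ r := by
    have hc : a.val + 1 ≤ p := ZMod.val_lt a
    rw [sub_eq_neg_add, (Commute.one_right (-y)).add_pow,
      ← Finset.sum_subset (Finset.range_subset_range.mpr hc)]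
    · refine Finset.sum_congr rfl fun m _ => ?_
      rw [one_pow, mul_one, neg_pow, ← Nat.cast_comm, Algebra.smul_def, ← mul_assoc]
      congr 1
      simp only [map_mul, map_pow, map_neg, map_one, map_natCast, Nat.cast_comm]
    · intro m _ hm'
      rw [Finset.mem_range] at hm'
      rw [Nat.choose_eq_zero_of_lt (by omega)]
      simp
  rw [oneSubPow_eq, h1, TensorProduct.tmul_sum]
  refine Finset.sum_congr rfl fun r hr => ?_
  rw [Finset.mem_range] at hr
  rw [← descPochhammer_eval_div_factorial K a hr, smul_smul, TensorProduct.smul_tmul]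
  congr 2
  ring

theorem twistElt_mul_tmul_one (P : IsToralNilPair p h y) {D : A} (c : ZMod p)
    (hD : h * D = D * (h + algebraMap K A (cst K c))) :
    P.twistElt K R * (D ⊗ₜ[R] 1) = (D ⊗ₜ[R] oneSubPow P.nil c) * P.twistElt K R := by
  rw [twistElt, Finset.mul_sum, Finset.sum_mul, ← Equiv.sum_comp (Equiv.addRight c)]
  refine Finset.sum_congr rfl fun a _ => ?_
  rw [Algebra.TensorProduct.tmul_mul_tmul, Algebra.TensorProduct.tmul_mul_tmul,
    idem_mul_of_mul_eq c hD, mul_one, ← oneSubPow_add, Equiv.coe_addRight, add_sub_cancel_right,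
    add_comm]

/-- This is `mul_oneSubPow` at the exponent `-b`, conjugated by `(1 - y) ^ b`; falling factorials at
`-b` are signed rising factorials at `b`, whence the rising factorials of the coproduct formula. -/
theorem oneSubPow_mul_eq (P : IsToralNilPair p h y) (D : A) (b : ZMod p) :
    oneSubPow P.nil b * D = ∑ m ∈ Finset.range p, ((-1) ^ m * (ascPochhammer K m).eval (cst K b)) •
      (oneSubPow P.nil (-(m : ZMod p)) * divAd K y m D * oneSubPow P.nil b) := by
  have h1 := mul_oneSubPow (K := K) P.nil D (-b)
  calc oneSubPow P.nil b * D = oneSubPow P.nil b * (D * oneSubPow P.nil (-b)) *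
        oneSubPow P.nil b := by rw [mul_assoc, mul_assoc, oneSubPow_neg_mul, mul_one]
    _ = _ := by
      rw [h1, Finset.mul_sum, Finset.sum_mul]
      refine Finset.sum_congr rfl fun m _ => ?_
      have h2 : (ascPochhammer K m).eval (cst K b) =
          (-1) ^ m * (descPochhammer K m).eval (cst K (-b)) := by
        rw [← ascPochhammer_eval_neg_eq_descPochhammer, cst_neg, neg_neg]
      rw [h2, ← mul_assoc, ← mul_pow, neg_one_mul, neg_neg, one_pow, one_mul, mul_smul_comm,
        smul_mul_assoc, ← mul_assoc (oneSubPow _ _), ← oneSubPow_add]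
      congr 4
      abel

/-- On the summand of eigenvalue `a`, the scalar in the expansion of `(1 - y) ^ a D` is the value at
`a` of the polynomial defining `rising h m`. The expansions for all `a` thus assemble into one
factor to the left of the twist. -/
theorem twistElt_mul_one_tmul (P : IsToralNilPair p h y) (D : A) :
    P.twistElt K R * (1 ⊗ₜ[R] D) = (∑ m ∈ Finset.range p, (-1 : ℤ) ^ m •
      (rising h m ⊗ₜ[R] (oneSubPow P.nil (-(m : ZMod p)) * divAd K y m D))) *
        P.twistElt K R := by
  rw [Finset.sum_mul]
  have h1 : ∀ m, ((-1 : ℤ) ^ m • (rising h m ⊗ₜ[R] (oneSubPow P.nil (-(m : ZMod p)) *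
      divAd K y m D))) * P.twistElt K R = ∑ a : ZMod p, idem K h a ⊗ₜ[R]
        (((-1) ^ m * (ascPochhammer K m).eval (cst K a)) •
          (oneSubPow P.nil (-(m : ZMod p)) * divAd K y m D * oneSubPow P.nil a)) := by
    intro m
    rw [rising_eq_aeval (K := K), smul_mul_assoc, tmul_mul_twistElt, Finset.smul_sum]
    refine Finset.sum_congr rfl fun a _ => ?_
    rw [← TensorProduct.tmul_smul, mul_smul, ← Int.cast_smul_eq_zsmul K]
    simp
  rw [Finset.sum_congr rfl fun m _ => h1 m, Finset.sum_comm, twistElt, Finset.sum_mul]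
  refine Finset.sum_congr rfl fun a _ => ?_
  rw [← TensorProduct.tmul_sum, Algebra.TensorProduct.tmul_mul_tmul, mul_one,
    ← P.oneSubPow_mul_eq]

/-- As `y` has weight `1`, the term `y ⊗ 1` passes the twist as `y ⊗ (1 - y)`, while `1 ⊗ y`
commutes with it; and `1 - y ⊗ (1 - y) - 1 ⊗ y = (1 - y) ⊗ (1 - y)`. -/
theorem twistElt_mul_comul_oneSub (P : IsToralNilPair p h y) :
    P.twistElt K R * (1 - (y ⊗ₜ[R] 1 + 1 ⊗ₜ[R] y)) =
      ((1 - y) ⊗ₜ[R] (1 - y)) * P.twistElt K R := by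
  have h1 := P.twistElt_mul_tmul_one (K := K) (R := R) 1 (by simpa using P.comm)
  have h2 : P.twistElt K R * (1 ⊗ₜ[R] y) = (1 ⊗ₜ[R] y) * P.twistElt K R := by
    rw [twistElt, Finset.mul_sum, Finset.sum_mul]
    refine Finset.sum_congr rfl fun a _ => ?_
    rw [Algebra.TensorProduct.tmul_mul_tmul, Algebra.TensorProduct.tmul_mul_tmul, one_mul, mul_one,
      (commute_oneSubPow P.nil (Commute.refl y) a).eq]
  rw [mul_sub, mul_add, mul_one, h1, h2, oneSubPow_one, TensorProduct.sub_tmul,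
    TensorProduct.tmul_sub (1 : A), sub_mul, sub_mul, ← Algebra.TensorProduct.one_def, one_mul]
  abel

theorem commute_idem {h z : A} (hz : Commute z h) (a : ZMod p) : Commute z (idem K h a) := by
  rw [idem_eq]
  exact (Commute.one_right z).sub_right ((hz.sub_right (Algebra.commutes _ _).symm).pow_right _)

theorem commute_twistElt (P : IsToralNilPair p h y) {z z' : A} (hz : Commute z h)
    (hz' : Commute z' y) : Commute (z ⊗ₜ[R] z') (P.twistElt K R) := by
  refine Commute.sum_right _ _ _ fun a _ => ?_
  rw [commute_iff_eq, Algebra.TensorProduct.tmul_mul_tmul, Algebra.TensorProduct.tmul_mul_tmul,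
    (commute_idem hz a).eq, (commute_oneSubPow P.nil hz' a).eq]

end IsToralNilPair

theorem antipode_aeval {H : HopfStructure R A}
    (hm : ∀ a b, H.antipode (a * b) = H.antipode b * H.antipode a) (h1 : H.antipode 1 = 1)
    (x : A) (f : K[X]) : H.antipode (aeval x f) = aeval (H.antipode x) f := by
  induction f using Polynomial.induction_on' with
  | add f g hf hg => rw [map_add, map_add, map_add, hf, hg]
  | monomial n a =>
    have : ∀ n : ℕ, H.antipode (x ^ n) = H.antipode x ^ n := by
      intro n
      induction n with
      | zero => simpa using h1
      | succ n ih => rw [pow_succ, hm, ih, ← pow_succ']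
    rw [aeval_monomial, aeval_monomial, ← Algebra.smul_def, ← Algebra.smul_def,
      LinearMap.map_smul_of_tower, this]

theorem comul_idem {H : HopfStructure R A} {h : A} (hh : h ^ p = h)
    (hc : H.comul h = h ⊗ₜ[R] 1 + 1 ⊗ₜ[R] h) (a : ZMod p) :
    H.comul (idem K h a) = ∑ b : ZMod p, idem K h b ⊗ₜ[R] idem K h (a - b) := by
  have h1 := map_idem (K := K) (H.comul.restrictScalars K) h a
  simp only [AlgHom.coe_restrictScalars', hc] at h1
  rw [h1, idem_add_of_commute (by rw [Algebra.TensorProduct.tmul_pow, hh, one_pow])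
    (by rw [Algebra.TensorProduct.tmul_pow, hh, one_pow])
    (by rw [commute_iff_eq]; simp)]
  refine Finset.sum_congr rfl fun b _ => ?_
  have h2 := map_idem (K := K) (Algebra.TensorProduct.includeLeft : A →ₐ[K] A ⊗[R] A) h b
  have h3 := map_idem (K := K)
    ((Algebra.TensorProduct.includeRight : A →ₐ[R] A ⊗[R] A).restrictScalars K) h (a - b)
  simp only [AlgHom.coe_restrictScalars', Algebra.TensorProduct.includeLeft_apply,
    Algebra.TensorProduct.includeRight_apply] at h2 h3
  rw [← h2, ← h3, Algebra.TensorProduct.tmul_mul_tmul, one_mul, mul_one]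

/-- The idempotents and units attached to two commuting pairs of primitive elements. -/
noncomputable def twistDatum (K : Type*) [Field K] [CharP K p] [Algebra K R] [Algebra K A]
    [IsScalarTower K R A] [Fact (2 < p)] (H : HopfStructure R A)
    {h y h' y' : A} (P : IsToralNilPair p h y) (P' : IsToralNilPair p h' y')
    (hh : Commute h h') (hy : Commute h y') (yh : Commute y h') (yy : Commute y y')
    (ch : H.comul h = h ⊗ₜ[R] 1 + 1 ⊗ₜ[R] h) (cy : H.comul y = y ⊗ₜ[R] 1 + 1 ⊗ₜ[R] y)
    (ch' : H.comul h' = h' ⊗ₜ[R] 1 + 1 ⊗ₜ[R] h') (cy' : H.comul y' = y' ⊗ₜ[R] 1 + 1 ⊗ₜ[R] y')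
    (eh : H.counit h = 0) (ey : H.counit y = 0) (eh' : H.counit h' = 0) (ey' : H.counit y' = 0)
    (sh : H.antipode h = -h) (sh' : H.antipode h' = -h')
    (hm : ∀ a b, H.antipode (a * b) = H.antipode b * H.antipode a) (h1 : H.antipode 1 = 1) :
    TwistDatum H (ZMod p × ZMod p) where
  δ g := idem K h g.1 * idem K h' g.2
  u g := oneSubPow P.nil g.1 * oneSubPow P'.nil g.2
  δ_mul a b := by
    have hc : Commute (idem K h' a.2) (idem K h b.1) :=
      IsToralNilPair.commute_idem (IsToralNilPair.commute_idem hh a.2).symm b.1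
    rw [hc.mul_mul_mul_comm, idem_mul_idem P.toral, idem_mul_idem P'.toral]
    by_cases h1 : a.1 = b.1 <;> by_cases h2 : a.2 = b.2 <;> simp [h1, h2, Prod.ext_iff]
  δ_sum := by
    rw [Fintype.sum_prod_type]
    simp only [← Finset.mul_sum, sum_idem P'.toral, mul_one, sum_idem P.toral]
  comul_δ g := by
    rw [map_mul, comul_idem P.toral ch, comul_idem P'.toral ch', Fintype.sum_prod_type,
      Finset.sum_mul_sum]
    simp
  counit_δ g := by
    have h2 := map_idem (K := K) (H.counit.restrictScalars K) h g.1
    have h3 := map_idem (K := K) (H.counit.restrictScalars K) h' g.2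
    simp only [AlgHom.coe_restrictScalars', eh, eh', idem_zero] at h2 h3
    rw [map_mul, h2, h3]
    by_cases h1 : g.1 = 0 <;> by_cases h2 : g.2 = 0 <;> simp [h1, h2, Prod.ext_iff]
  antipode_δ g := by
    have hc : Commute (idem K h' (-g.2)) (idem K h (-g.1)) :=
      IsToralNilPair.commute_idem (IsToralNilPair.commute_idem hh _).symm _
    rw [hm, idem, idem, antipode_aeval hm h1, antipode_aeval hm h1, sh, sh', ← idem, ← idem,
      idem_neg, idem_neg, hc.eq]
    rfl
  u_zero := by simp [oneSubPow_zero]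
  u_add a b := by
    have hc : Commute (oneSubPow P.nil b.1) (oneSubPow P'.nil a.2) :=
      commute_oneSubPow P'.nil (commute_oneSubPow P.nil yy.symm b.1).symm _
    rw [Prod.fst_add, Prod.snd_add, oneSubPow_add, oneSubPow_add, hc.mul_mul_mul_comm]
  counit_u g := by
    simp [oneSubPow_eq, ey, ey']
  twist_comul_u g := by
    have hF : ∑ a : ZMod p × ZMod p, (idem K h a.1 * idem K h' a.2) ⊗ₜ[R]
        (oneSubPow P.nil a.1 * oneSubPow P'.nil a.2) = P.twistElt K R * P'.twistElt K R := by
      rw [Fintype.sum_prod_type, IsToralNilPair.twistElt, IsToralNilPair.twistElt,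
        Finset.sum_mul_sum]
      simp
    set F := P.twistElt K R with hFdef
    set F' := P'.twistElt K R with hFdef'
    have e1 : ∀ n : ℕ, F * F' * H.comul ((1 - y) ^ n) =
        (((1 - y) ^ n) ⊗ₜ[R] ((1 - y) ^ n)) * (F * F') := by
      -- The second twist involves only `h'` and `y'`, which commute with `y`, so the relation for
      -- `1 - y` reduces to the one for the first twist.
      have hc1 : Commute F' (H.comul (1 - y)) := by
        rw [map_sub, map_one, cy]
        refine (Commute.one_right _).sub_right (Commute.add_right ?_ ?_)
        · exact (P'.commute_twistElt yh (Commute.one_left _)).symm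
        · exact (P'.commute_twistElt (Commute.one_left _) yy).symm
      have hc2 : F * F' * H.comul (1 - y) = ((1 - y) ⊗ₜ[R] (1 - y)) * (F * F') := by
        rw [mul_assoc, hc1.eq, ← mul_assoc, map_sub, map_one, cy, P.twistElt_mul_comul_oneSub,
          mul_assoc]
      intro n
      induction n with
      | zero => simp [← Algebra.TensorProduct.one_def]
      | succ n ih =>
        rw [pow_succ, map_mul, ← mul_assoc, ih, mul_assoc, hc2, ← mul_assoc,
          Algebra.TensorProduct.tmul_mul_tmul]
    have e2 : ∀ n : ℕ, F * F' * H.comul ((1 - y') ^ n) =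
        (((1 - y') ^ n) ⊗ₜ[R] ((1 - y') ^ n)) * (F * F') := by
      -- Here the outer twist `F` has to be crossed after `F'` has acted; it commutes with the
      -- resulting grouplike tensor.
      have hc1 : Commute ((1 - y') ⊗ₜ[R] (1 - y')) F :=
        P.commute_twistElt ((Commute.one_left _).sub_left hy.symm)
          ((Commute.one_left _).sub_left yy.symm)
      have hc2 : F * F' * H.comul (1 - y') = ((1 - y') ⊗ₜ[R] (1 - y')) * (F * F') := by
        rw [mul_assoc, map_sub, map_one, cy', P'.twistElt_mul_comul_oneSub, ← mul_assoc, ← hc1.eq,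
          mul_assoc]
      intro n
      induction n with
      | zero => simp [← Algebra.TensorProduct.one_def]
      | succ n ih =>
        rw [pow_succ, map_mul, ← mul_assoc, ih, mul_assoc, hc2, ← mul_assoc,
          Algebra.TensorProduct.tmul_mul_tmul]
    rw [hF, oneSubPow_eq, oneSubPow_eq, map_mul, ← mul_assoc, e1, mul_assoc, e2, ← mul_assoc,
      Algebra.TensorProduct.tmul_mul_tmul]
  antipode_mul := hm
  antipode_one := h1

end Tensor

end ContactHopf

namespace ContactHopf

/-! ### Hopf algebras generated by primitive elements -/

section Primitive

variable {R A : Type*} [CommRing R] [Ring A] [Algebra R A]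

/-- The Hopf algebra structure on an algebra generated by primitive elements. -/
noncomputable def primitiveHopf (s : Set A) (hs : Algebra.adjoin R s = ⊤)
    (Δ : A →ₐ[R] A ⊗[R] A) (ε : A →ₐ[R] R) (S : A →ₐ[R] Aᵐᵒᵖ)
    (hΔ : ∀ x ∈ s, Δ x = x ⊗ₜ[R] 1 + 1 ⊗ₜ[R] x) (hε : ∀ x ∈ s, ε x = 0)
    (hS : ∀ x ∈ s, S x = MulOpposite.op (-x)) : HopfStructure R A where
  comul := Δ
  counit := ε
  antipode := (MulOpposite.opLinearEquiv R).symm.toLinearMap ∘ₗ S.toLinearMap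
  coassoc := by
    have : ((Algebra.TensorProduct.assoc R R R A A A).toAlgHom.comp
        (Algebra.TensorProduct.map Δ (AlgHom.id R A))).comp Δ =
        (Algebra.TensorProduct.map (AlgHom.id R A) Δ).comp Δ := by
      refine AlgHom.ext_of_adjoin_eq_top hs fun x hx => ?_
      simp [hΔ x hx, TensorProduct.add_tmul, TensorProduct.tmul_add,
        Algebra.TensorProduct.one_def, add_assoc]
    exact fun a => DFunLike.congr_fun this a
  rTensor_counit := by
    have : (Algebra.TensorProduct.map ε (AlgHom.id R A)).comp Δ =
        Algebra.TensorProduct.includeRight := by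
      refine AlgHom.ext_of_adjoin_eq_top hs fun x hx => ?_
      simp [hΔ x hx, hε x hx]
    exact fun a => DFunLike.congr_fun this a
  lTensor_counit := by
    have : (Algebra.TensorProduct.map (AlgHom.id R A) ε).comp Δ =
        Algebra.TensorProduct.includeLeft := by
      refine AlgHom.ext_of_adjoin_eq_top hs fun x hx => ?_
      simp [hΔ x hx, hε x hx]
    exact fun a => DFunLike.congr_fun this a
  antipode_left a := by
    -- The composite of `Δ`, `S ⊗ id` and multiplication is not an algebra homomorphism, so
    -- agreement on generators is not enough by itself; stability under products comes from
    -- `leftSandwich_mul`.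
    rw [mul'_rTensor_eq]
    have ha : a ∈ Algebra.adjoin R s := hs ▸ Algebra.mem_top
    induction ha using Algebra.adjoin_induction with
    | mem x hx => simp [hΔ x hx, hε x hx, hS x hx]
    | algebraMap r => simp [Algebra.TensorProduct.algebraMap_apply]
    | add x y _ _ hx hy => rw [map_add, map_add, hx, hy, map_add, map_add]
    | mul x y _ _ hx hy =>
      rw [map_mul, leftSandwich_mul (by simp) _ _ _ _ hx, leftSandwich_algebraMap, hy, map_mul,
        map_mul, Algebra.smul_def]
  antipode_right a := by
    rw [mul'_lTensor_eq]
    have ha : a ∈ Algebra.adjoin R s := hs ▸ Algebra.mem_top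
    induction ha using Algebra.adjoin_induction with
    | mem x hx => simp [hΔ x hx, hε x hx, hS x hx]
    | algebraMap r => simp [Algebra.TensorProduct.algebraMap_apply]
    | add x y _ _ hx hy => rw [map_add, map_add, hx, hy, map_add, map_add]
    | mul x y _ _ hx hy =>
      rw [map_mul, rightSandwich_mul (by simp) _ _ _ _ hy, rightSandwich_algebraMap, hx, map_mul,
        map_mul, ← Algebra.commutes, Algebra.smul_def]

end Primitive

/-! ### Explicit formulas for the twisted coproduct and antipode -/

section Formulas

variable {K : Type*} [Field K] {p : ℕ} [Fact p.Prime] [CharP K p] {R : Type*} [CommRing R]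
  [Algebra K R] {A : Type*} [Ring A] [Algebra K A] [Algebra R A] [IsScalarTower K R A] [CharP A p]
  {H : HopfStructure R A} {h y h' y' D : A} (P : IsToralNilPair p h y) (P' : IsToralNilPair p h' y')

theorem divAd_weight_of_commute {h y : A} (hc : Commute h y) {D : A} {c : K}
    (hD : h * D = D * (h + algebraMap K A c)) (m : ℕ) :
    h * divAd K y m D = divAd K y m D * (h + algebraMap K A c) := by
  have : ∀ m : ℕ, h * ((LinearMap.mulLeft K y - LinearMap.mulRight K y) ^ m) D =
      ((LinearMap.mulLeft K y - LinearMap.mulRight K y) ^ m) D *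
        (h + algebraMap K A c) := by
    intro m
    induction m with
    | zero => simpa using hD
    | succ m ih =>
      rw [pow_succ', Module.End.mul_apply]
      set E := ((LinearMap.mulLeft K y - LinearMap.mulRight K y) ^ m) D
      have hy : y * (h + algebraMap K A c) = (h + algebraMap K A c) * y := by
        rw [mul_add, add_mul, hc.eq, Algebra.commutes]
      simp only [LinearMap.sub_apply, LinearMap.mulLeft_apply, LinearMap.mulRight_apply]
      rw [mul_sub, ← mul_assoc, hc.eq, mul_assoc, ih, ← mul_assoc, ← mul_assoc, ih, sub_mul,
        mul_assoc E y, hy, mul_assoc E]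
  rw [divAd, LinearMap.smul_apply, mul_smul_comm, this, smul_mul_assoc]

theorem twistDatum_F (T : TwistDatum H (ZMod p × ZMod p))
    (hδ : ∀ g, T.δ g = idem K h g.1 * idem K h' g.2)
    (hu : ∀ g, T.u g = oneSubPow P.nil g.1 * oneSubPow P'.nil g.2) :
    T.F = P.twistElt K R * P'.twistElt K R := by
  rw [TwistDatum.F, Fintype.sum_prod_type, IsToralNilPair.twistElt, IsToralNilPair.twistElt,
    Finset.sum_mul_sum]
  simp [hδ, hu]

theorem twistDatum_w (yh : Commute y h') (T : TwistDatum H (ZMod p × ZMod p))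
    (hδ : ∀ g, T.δ g = idem K h g.1 * idem K h' g.2)
    (hu : ∀ g, T.u g = oneSubPow P.nil g.1 * oneSubPow P'.nil g.2) :
    T.w = P.w K * P'.w K := by
  rw [TwistDatum.w, Fintype.sum_prod_type, IsToralNilPair.w, IsToralNilPair.w, Finset.sum_mul_sum]
  refine Finset.sum_congr rfl fun a _ => Finset.sum_congr rfl fun b _ => ?_
  have hc : Commute (idem K h' b) (oneSubPow P.nil a) :=
    commute_oneSubPow P.nil (IsToralNilPair.commute_idem yh b).symm a
  rw [hδ, hu, hc.mul_mul_mul_comm]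

/-- The twist is a unit, so it suffices to compare products with it on the right, where the left
side is `F Δ(D)`. There `D ⊗ 1` and `1 ⊗ D` are carried across the two factors of `F` one after the
other. -/
theorem comul_formula (T : TwistDatum H (ZMod p × ZMod p))
    (hF : T.F = P.twistElt K R * P'.twistElt K R)
    (hh : Commute h h') (yy : Commute y y') {c c' : ZMod p}
    (hD : h * D = D * (h + algebraMap K A (cst K c)))
    (hD' : h' * D = D * (h' + algebraMap K A (cst K c')))
    (cD : H.comul D = D ⊗ₜ[R] 1 + 1 ⊗ₜ[R] D) :
    T.comul D = D ⊗ₜ[R] (oneSubPow P.nil c * oneSubPow P'.nil c') +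
      ∑ m ∈ Finset.range p, ∑ l ∈ Finset.range p, (-1 : ℤ) ^ (l + m) •
        ((rising h' l * rising h m) ⊗ₜ[R] (oneSubPow P'.nil (-(l : ZMod p)) *
          oneSubPow P.nil (-(m : ZMod p)) * divAd K y m (divAd K y' l D))) := by
  refine T.Funit.isUnit.mul_right_cancel ?_
  change T.comul D * T.F = _ * T.F
  rw [T.comul_mul_F, cD, hF, mul_add, add_mul]
  congr 1
  · have h1 : Commute ((1 : A) ⊗ₜ[R] oneSubPow P'.nil c') (P.twistElt K R) :=
      P.commute_twistElt (Commute.one_left _) (commute_oneSubPow P'.nil yy c').symm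
    have h2 : D ⊗ₜ[R] (oneSubPow P.nil c * oneSubPow P'.nil c') =
        (D ⊗ₜ[R] oneSubPow P.nil c) * ((1 : A) ⊗ₜ[R] oneSubPow P'.nil c') := by simp
    have h3 : D ⊗ₜ[R] oneSubPow P'.nil c' =
        (D ⊗ₜ[R] 1) * ((1 : A) ⊗ₜ[R] oneSubPow P'.nil c') := by simp
    rw [mul_assoc, P'.twistElt_mul_tmul_one c' hD', h3, h2, ← mul_assoc, ← mul_assoc, ← mul_assoc,
      P.twistElt_mul_tmul_one c hD, mul_assoc (D ⊗ₜ[R] oneSubPow P.nil c), ← h1.eq]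
    simp only [mul_assoc]
  · rw [mul_assoc, P'.twistElt_mul_one_tmul (K := K), ← mul_assoc, ← mul_assoc]
    congr 1
    rw [Finset.mul_sum, Finset.sum_comm, Finset.sum_mul]
    refine Finset.sum_congr rfl fun l _ => ?_
    -- What the second pair has produced so far commutes with the first pair, so the first twist
    -- meets `divAd K y' l D` alone.
    have hr : Commute (rising h' l) h := (commute_rising hh l).symm
    have h1 : Commute (rising h' l ⊗ₜ[R] oneSubPow P'.nil (-(l : ZMod p))) (P.twistElt K R) :=
      P.commute_twistElt hr (commute_oneSubPow P'.nil yy _).symm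
    have h2 : rising h' l ⊗ₜ[R] (oneSubPow P'.nil (-(l : ZMod p)) * divAd K y' l D) =
        (rising h' l ⊗ₜ[R] oneSubPow P'.nil (-(l : ZMod p))) * (1 ⊗ₜ[R] divAd K y' l D) := by simp
    rw [mul_smul_comm, h2, ← mul_assoc, ← h1.eq, mul_assoc, P.twistElt_mul_one_tmul (K := K),
      ← mul_assoc, Finset.mul_sum, ← smul_mul_assoc, Finset.smul_sum]
    congr 1
    refine Finset.sum_congr rfl fun m _ => ?_
    rw [mul_smul_comm, smul_smul, ← pow_add, Algebra.TensorProduct.tmul_mul_tmul, mul_assoc]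

/-- As `S(D) = -D`, the twisted antipode is `-v D w`. Carrying `D` across the two factors of `w`
with `mul_w` gives `D w = w (...)`, and `v w = 1` removes the outer factors. -/
theorem antipode_formula [Nontrivial A] (T : TwistDatum H (ZMod p × ZMod p))
    (hw : T.w = P.w K * P'.w K)
    (hh : Commute h h') (hy : Commute h y') (yh : Commute y h') (yy : Commute y y') {c c' : ZMod p}
    (hD : h * D = D * (h + algebraMap K A (cst K c)))
    (hD' : h' * D = D * (h' + algebraMap K A (cst K c')))
    (sD : H.antipode D = -D) :
    T.antipode D = -(oneSubPow P'.nil (-c') * oneSubPow P.nil (-c) *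
      ∑ m ∈ Finset.range p, ∑ l ∈ Finset.range p,
        divAd K y m (divAd K y' l D) * rising (h + 1) m * rising (h' + 1) l) := by
  have hx : ∀ x : A, Commute x h → Commute x y → Commute x (P.w K) := by
    intro x hx hx'
    refine Commute.sum_right _ _ _ fun a _ => ?_
    exact (IsToralNilPair.commute_idem hx a).mul_right (commute_oneSubPow P.nil hx' a)
  have hcw : Commute (P'.w K) (P.w K) := by
    refine Commute.sum_left _ _ _ fun a _ => ?_
    refine Commute.mul_left (hx _ ?_ ?_) (hx _ ?_ ?_)
    · exact (IsToralNilPair.commute_idem hh a).symm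
    · exact (IsToralNilPair.commute_idem yh a).symm
    · exact (commute_oneSubPow P'.nil hy a).symm
    · exact (commute_oneSubPow P'.nil yy a).symm
  have key : D * T.w = T.w * (oneSubPow P'.nil (-c') * oneSubPow P.nil (-c) *
      ∑ m ∈ Finset.range p, ∑ l ∈ Finset.range p,
        divAd K y m (divAd K y' l D) * rising (h + 1) m * rising (h' + 1) l) := by
    have hU : Commute (oneSubPow P'.nil (-c')) (P.w K) :=
      hx _ (commute_oneSubPow P'.nil hy _).symm (commute_oneSubPow P'.nil yy _).symm
    have hr : ∀ l, Commute (rising (h' + 1) l) (P.w K) := fun l => hx _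
      (commute_rising (hh.add_right (Commute.one_right h)) l).symm
      (commute_rising (yh.add_right (Commute.one_right y)) l).symm
    have h1 : risingSum K p y' D (h' + 1) * P.w K = P.w K * (oneSubPow P.nil (-c) *
        ∑ m ∈ Finset.range p, ∑ l ∈ Finset.range p,
          divAd K y m (divAd K y' l D) * rising (h + 1) m * rising (h' + 1) l) := by
      rw [risingSum, Finset.sum_mul, Finset.sum_comm, Finset.mul_sum, Finset.mul_sum]
      refine Finset.sum_congr rfl fun l _ => ?_
      rw [mul_assoc, (hr l).eq, ← mul_assoc, P.mul_w c (divAd_weight_of_commute hy hD l),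
        ← Finset.sum_mul, risingSum]
      simp only [mul_assoc]
    rw [hw, ← hcw.eq, ← mul_assoc, P'.mul_w c' hD', mul_assoc, mul_assoc, h1, mul_assoc (P'.w K),
      mul_assoc (oneSubPow P'.nil (-c')), ← mul_assoc _ (P.w K), hU.eq, mul_assoc]
  rw [T.antipode_apply, sD, neg_mul, key, mul_neg, ← mul_assoc, T.v_mul_w, one_mul]

end Formulas

end ContactHopf

namespace ContactHopf

/-! ### Truncated ordered monomials in primitive elements -/

section Monomials

variable {K : Type*} [Field K] {B : Type*} [Ring B] [Algebra K B] {I : Type*} (x : I → B)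

/-- The span of the words of length less than `d`. -/
def wordSpan (K : Type*) [Field K] [Algebra K B] (d : ℕ) : Submodule K B :=
  Submodule.span K {b | ∃ l : List I, l.length < d ∧ (l.map x).prod = b}

variable {x}

theorem word_mem {l : List I} {d : ℕ} (h : l.length < d) : (l.map x).prod ∈ wordSpan x K d :=
  Submodule.subset_span ⟨l, h, rfl⟩

theorem wordSpan_mono {d e : ℕ} (h : d ≤ e) : wordSpan x K d ≤ wordSpan x K e :=
  Submodule.span_mono fun _ ⟨l, hl, hb⟩ => ⟨l, hl.trans_le h, hb⟩

theorem wordSpan_zero : wordSpan x K 0 = ⊥ := by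
  simp [wordSpan]

theorem mul_mem_wordSpan (i : I) {d : ℕ} {b : B} (hb : b ∈ wordSpan x K d) :
    x i * b ∈ wordSpan x K (d + 1) := by
  induction hb using Submodule.span_induction with
  | mem b hb =>
    obtain ⟨l, hl, rfl⟩ := hb
    exact word_mem (l := i :: l) (by simpa using hl)
  | zero => simp
  | add a b _ _ ha hb => rw [mul_add]; exact add_mem ha hb
  | smul c b _ hb => rw [mul_smul_comm]; exact Submodule.smul_mem _ _ hb

theorem span_mul_word_mem {b : B} (hb : b ∈ Submodule.span K (Set.range x)) (l : List I) :
    b * (l.map x).prod ∈ wordSpan x K (l.length + 2) := by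
  induction hb using Submodule.span_induction with
  | mem b hb =>
    obtain ⟨i, rfl⟩ := hb
    exact word_mem (l := i :: l) (by simp)
  | zero => simp
  | add a b _ _ ha hb => rw [add_mul]; exact add_mem ha hb
  | smul c b _ hb => rw [smul_mul_assoc]; exact Submodule.smul_mem _ _ hb

/-- Exchanging two neighbouring letters costs a commutator, which is a combination of single
letters, so the error consists of strictly shorter words. -/
theorem perm_sub_mem
    (hcomm : ∀ i j, x i * x j - x j * x i ∈ Submodule.span K (Set.range x)) {l l' : List I}
    (h : l.Perm l') : (l.map x).prod - (l'.map x).prod ∈ wordSpan x K l.length := by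
  induction h with
  | nil => simp
  | cons i _ ih =>
    rw [List.map_cons, List.map_cons, List.prod_cons, List.prod_cons, ← mul_sub]
    exact mul_mem_wordSpan i ih
  | swap i j l =>
    simp only [List.map_cons, List.prod_cons, ← mul_assoc, ← sub_mul]
    exact span_mul_word_mem (hcomm j i) l
  | trans h _ ih ih' =>
    rw [← h.length_eq] at ih'
    simpa using add_mem ih ih'

variable [Fintype I] [DecidableEq I]

/-- The ordered word in which the letter `i` occurs `β i` times. -/
noncomputable def orderedWord (β : I → ℕ) : List I :=
  (Finset.univ : Finset I).toList.flatMap fun i => List.replicate (β i) i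

/-- The ordered monomial with exponents `β`. -/
noncomputable def orderedMon (x : I → B) (β : I → ℕ) : B := ((orderedWord β).map x).prod

theorem count_flatMap_replicate (L : List I) (hL : L.Nodup) (β : I → ℕ) (j : I) :
    (L.flatMap fun i => List.replicate (β i) i).count j = if j ∈ L then β j else 0 := by
  induction L with
  | nil => simp
  | cons a L ih =>
    rw [List.nodup_cons] at hL
    rw [List.flatMap_cons, List.count_append, ih hL.2, List.count_replicate]
    by_cases haj : a = j
    · subst haj
      simp [hL.1]
    · simp [haj, Ne.symm haj]

theorem count_orderedWord (β : I → ℕ) (j : I) : (orderedWord β).count j = β j := by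
  rw [orderedWord, count_flatMap_replicate _ (Finset.nodup_toList _)]
  simp

theorem length_orderedWord (β : I → ℕ) : (orderedWord β).length = ∑ i, β i := by
  rw [orderedWord, List.length_flatMap]
  simp

theorem perm_orderedWord (l : List I) : l.Perm (orderedWord fun i => l.count i) := by
  rw [List.perm_iff_count]
  intro i
  rw [count_orderedWord]

/-- Induction on the length: modulo shorter words a word can be permuted at will. Either no letter
occurs `p` times and the word is sorted, or `p` equal letters are brought together and their product
is replaced by a combination of single letters, which shortens the word since `p ≥ 2`. -/
theorem word_mem_span_orderedMon {p : ℕ} (hp : 2 ≤ p)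
    (hcomm : ∀ i j, x i * x j - x j * x i ∈ Submodule.span K (Set.range x))
    (hpow : ∀ i, x i ^ p ∈ Submodule.span K (Set.range x)) (n : ℕ) (l : List I)
    (hl : l.length ≤ n) : (l.map x).prod ∈
      Submodule.span K (Set.range fun β : I → Fin p => orderedMon x fun i => (β i : ℕ)) := by
  induction n generalizing l with
  | zero =>
    rw [Nat.le_zero, List.length_eq_zero_iff] at hl
    subst hl
    refine Submodule.subset_span ⟨fun _ => ⟨0, by omega⟩, ?_⟩
    have h0 : orderedWord (fun _ : I => 0) = [] := by
      rw [← List.length_eq_zero_iff, length_orderedWord]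
      simp
    simp [orderedMon, h0]
  | succ n ih =>
    have hsub : wordSpan x K (n + 1) ≤
        Submodule.span K (Set.range fun β : I → Fin p => orderedMon x fun i => (β i : ℕ)) := by
      refine Submodule.span_le.mpr ?_
      rintro _ ⟨l', hl', rfl⟩
      exact ih l' (by omega)
    by_cases hc : ∀ i, l.count i < p
    · have h1 := hsub (wordSpan_mono hl (perm_sub_mem hcomm (perm_orderedWord l)))
      have h2 : ((orderedWord fun i => l.count i).map x).prod ∈
          Submodule.span K (Set.range fun β : I → Fin p => orderedMon x fun i => (β i : ℕ)) :=
        Submodule.subset_span ⟨fun i => ⟨l.count i, hc i⟩, rfl⟩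
      simpa using add_mem h1 h2
    · push Not at hc
      obtain ⟨i, hi⟩ := hc
      have hperm : l.Perm (List.replicate p i ++
          orderedWord fun j => if j = i then l.count i - p else l.count j) := by
        rw [List.perm_iff_count]
        intro j
        rw [List.count_append, count_orderedWord, List.count_replicate]
        by_cases hj : i = j
        · subst hj
          simp
          omega
        · simp [hj, Ne.symm hj]
      set r := orderedWord fun j => if j = i then l.count i - p else l.count j
      have hlen : l.length = p + r.length := by
        rw [hperm.length_eq, List.length_append, List.length_replicate]
      have h1 := hsub (wordSpan_mono hl (perm_sub_mem hcomm hperm))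
      have h2 : ((List.replicate p i ++ r).map x).prod ∈ wordSpan x K (n + 1) := by
        rw [List.map_append, List.prod_append, List.map_replicate, List.prod_replicate]
        exact wordSpan_mono (by omega) (span_mul_word_mem (hpow i) r)
      simpa using add_mem h1 (hsub h2)

theorem span_orderedMon_eq_top {p : ℕ} (hp : 2 ≤ p)
    (hcomm : ∀ i j, x i * x j - x j * x i ∈ Submodule.span K (Set.range x))
    (hpow : ∀ i, x i ^ p ∈ Submodule.span K (Set.range x))
    (hgen : Algebra.adjoin K (Set.range x) = ⊤) :
    Submodule.span K (Set.range fun β : I → Fin p => orderedMon x fun i => (β i : ℕ)) = ⊤ := by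
  rw [eq_top_iff, ← Algebra.top_toSubmodule, ← hgen, Algebra.adjoin_eq_span, Submodule.span_le]
  intro b hb
  obtain ⟨l, hl, rfl⟩ := Submonoid.exists_list_of_mem_closure hb
  obtain ⟨l', rfl⟩ : ∃ l' : List I, l'.map x = l := by
    have : l ∈ Set.range (List.map x) := by
      rw [Set.range_list_map]
      exact hl
    exact this
  exact word_mem_span_orderedMon hp hcomm hpow _ l' le_rfl

/-- The contraction `(φ ⊗ id) Δ`. -/
noncomputable def contract (H : HopfStructure K B) (φ : B →ₗ[K] K) : B →ₗ[K] B :=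
  (TensorProduct.lid K B).toLinearMap ∘ₗ φ.rTensor B ∘ₗ H.comul.toLinearMap

variable (H : HopfStructure K B)

theorem contract_one (φ : B →ₗ[K] K) : contract H φ 1 = φ 1 • 1 := by
  simp [contract, Algebra.TensorProduct.one_def]

theorem contract_counit (b : B) : contract H H.counit.toLinearMap b = b := by
  simp [contract, H.rTensor_counit]

theorem contract_mul {a : B} (ha : H.comul a = a ⊗ₜ[K] 1 + 1 ⊗ₜ[K] a) (φ : B →ₗ[K] K) (b : B) :
    contract H φ (a * b) = a * contract H φ b + contract H (φ ∘ₗ LinearMap.mulLeft K a) b := by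
  simp only [contract, LinearMap.comp_apply, AlgHom.toLinearMap_apply, map_mul, ha]
  induction H.comul b with
  | zero => simp
  | add y z hy hz =>
    simp only [mul_add, map_add] at hy hz ⊢
    rw [hy, hz]
    abel
  | tmul y z => simp [add_mul, add_comm]

/-- Subtracting `φ a • ε` makes the new functional vanish at `1` again, so that inductions over
functionals killing `1` can proceed. -/
theorem contract_mul' {a : B} (ha : H.comul a = a ⊗ₜ[K] 1 + 1 ⊗ₜ[K] a) (φ : B →ₗ[K] K) (b : B) :
    contract H φ (a * b) = a * contract H φ b + φ a • b +
      contract H (φ ∘ₗ LinearMap.mulLeft K a - φ a • H.counit.toLinearMap) b := by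
  have h : contract H (φ ∘ₗ LinearMap.mulLeft K a - φ a • H.counit.toLinearMap) b =
      contract H (φ ∘ₗ LinearMap.mulLeft K a) b - φ a • contract H H.counit.toLinearMap b := by
    simp [contract, LinearMap.rTensor_sub, LinearMap.rTensor_smul]
  rw [contract_mul H ha, h, contract_counit]
  abel

/-- Contraction with a functional killing `1` lowers the degree by one, as a derivative does: the
part `1 ⊗ word` of the coproduct, the only one of full length on the right, is discarded. -/
theorem contract_word_mem (hx : ∀ i, H.comul (x i) = x i ⊗ₜ[K] 1 + 1 ⊗ₜ[K] x i)
    (φ : B →ₗ[K] K) (hφ : φ 1 = 0) (l : List I) :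
    contract H φ (l.map x).prod ∈ wordSpan x K l.length := by
  induction l generalizing φ with
  | nil => simp [contract_one, hφ]
  | cons i l ih =>
    rw [List.map_cons, List.prod_cons, contract_mul' H (hx i)]
    refine add_mem (add_mem (mul_mem_wordSpan i (ih φ hφ)) ?_) ?_
    · exact Submodule.smul_mem _ _ (word_mem (by simp))
    · exact wordSpan_mono (by simp) (ih _ (by simp))

theorem contract_wordSpan (hx : ∀ i, H.comul (x i) = x i ⊗ₜ[K] 1 + 1 ⊗ₜ[K] x i)
    (φ : B →ₗ[K] K) (hφ : φ 1 = 0) {d : ℕ} {b : B}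
    (hb : b ∈ wordSpan x K (d + 1)) : contract H φ b ∈ wordSpan x K d := by
  have : wordSpan x K (d + 1) ≤ (wordSpan x K d).comap (contract H φ) := by
    refine Submodule.span_le.mpr ?_
    rintro _ ⟨l, hl, rfl⟩
    exact wordSpan_mono (by omega) (contract_word_mem H hx φ hφ l)
  exact this hb

/-- The sum over the letters `i` of a word of `φ (x i)` times the word with this letter deleted. -/
def deleteSum {I : Type*} (x : I → B) (φ : B →ₗ[K] K) : List I → B
  | [] => 0
  | i :: l => x i * deleteSum x φ l + φ (x i) • (l.map x).prod

theorem contract_word_sub_mem (hx : ∀ i, H.comul (x i) = x i ⊗ₜ[K] 1 + 1 ⊗ₜ[K] x i)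
    (φ : B →ₗ[K] K) (hφ : φ 1 = 0) (l : List I) :
    contract H φ (l.map x).prod - deleteSum x φ l ∈ wordSpan x K (l.length - 1) := by
  induction l with
  | nil => simp [contract_one, hφ, deleteSum]
  | cons i l ih =>
    rw [List.map_cons, List.prod_cons, contract_mul' H (hx i), deleteSum]
    have h1 := contract_word_mem H hx (φ ∘ₗ LinearMap.mulLeft K (x i) -
      φ (x i) • H.counit.toLinearMap) (by simp) l
    have h2 : x i * (contract H φ (l.map x).prod - deleteSum x φ l) ∈ wordSpan x K l.length := by
      -- The empty word is separate because of the truncated subtraction: there `ih` only places the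
      -- product in the span of words of length below `1`, while the bound needed is `0`. The
      -- difference is in fact zero.
      rcases l with _ | ⟨j, l⟩
      · simp [contract_one, hφ, deleteSum]
      · exact mul_mem_wordSpan i ih
    have h3 := add_mem h2 h1
    rw [List.length_cons, Nat.add_sub_cancel]
    convert h3 using 1
    rw [mul_sub]
    abel

end Monomials

end ContactHopf

namespace ContactHopf

/-! ### Linear independence of the truncated ordered monomials -/

section MonomialBasis

variable {K : Type*} [Field K] {B : Type*} [Ring B] [Algebra K B] {I : Type*} {x : I → B}

theorem deleteSum_append (φ : B →ₗ[K] K) (l l' : List I) :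
    deleteSum x φ (l ++ l') =
      deleteSum x φ l * (l'.map x).prod + (l.map x).prod * deleteSum x φ l' := by
  induction l with
  | nil => simp [deleteSum]
  | cons i l ih =>
    rw [List.cons_append, deleteSum, ih, deleteSum, List.map_append, List.prod_append,
      List.map_cons, List.prod_cons, add_mul, mul_add, smul_mul_assoc]
    simp only [mul_assoc]
    abel

variable [DecidableEq I]

theorem deleteSum_replicate_self {φ : B →ₗ[K] K} {i : I} (h : φ (x i) = 1) (b : ℕ) :
    deleteSum x φ (List.replicate b i) = (b : K) • x i ^ (b - 1) := by
  induction b with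
  | zero => simp [deleteSum]
  | succ b ih =>
    rw [List.replicate_succ, deleteSum, ih, h, one_smul, List.map_replicate, List.prod_replicate,
      Nat.add_sub_cancel, mul_smul_comm]
    rcases b with _ | b
    · simp
    · rw [Nat.add_sub_cancel, ← pow_succ', Nat.cast_succ (b + 1), add_smul, one_smul]

theorem deleteSum_replicate_of_eq_zero {φ : B →ₗ[K] K} {i : I} (h : φ (x i) = 0) (b : ℕ) :
    deleteSum x φ (List.replicate b i) = 0 := by
  induction b with
  | zero => simp [deleteSum]
  | succ b ih => rw [List.replicate_succ, deleteSum, ih, h, zero_smul, mul_zero, add_zero]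

/-- All copies of `i` are adjacent in an ordered word, so deleting any one of them gives the same
ordered word. On ordered monomials `deleteSum` is therefore exactly the derivative with respect to
`x i`, without reordering. -/
theorem deleteSum_flatMap {φ : B →ₗ[K] K} {i : I}
    (h : ∀ j, φ (x j) = if j = i then 1 else 0) (L : List I) (hL : L.Nodup) (β : I → ℕ) :
    deleteSum x φ (L.flatMap fun j => List.replicate (β j) j) =
      if i ∈ L then (β i : K) • ((L.flatMap fun j =>
        List.replicate (if j = i then β i - 1 else β j) j).map x).prod else 0 := by
  induction L with
  | nil => simp [deleteSum]
  | cons a L ih =>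
    rw [List.nodup_cons] at hL
    rw [List.flatMap_cons, List.flatMap_cons, deleteSum_append, ih hL.2, List.map_append,
      List.prod_append, List.map_replicate, List.map_replicate, List.prod_replicate,
      List.prod_replicate]
    by_cases ha : a = i
    · subst ha
      have hc : ∀ j ∈ L, List.replicate (β j) j =
          List.replicate (if j = a then β a - 1 else β j) j := by
        intro j hj
        rw [if_neg]
        rintro rfl
        exact hL.1 hj
      rw [deleteSum_replicate_self (by simp [h])]
      simp [hL.1, List.flatMap_congr hc]
    · rw [deleteSum_replicate_of_eq_zero (by simp [h, ha])]
      by_cases hi : i ∈ L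
      · simp [hi, ha]
      · simp [hi, Ne.symm ha]

variable [Fintype I] (H : HopfStructure K B)

theorem contract_orderedMon_sub_mem (hx : ∀ i, H.comul (x i) = x i ⊗ₜ[K] 1 + 1 ⊗ₜ[K] x i)
    {φ : B →ₗ[K] K} (hφ : φ 1 = 0) {i : I} (h : ∀ j, φ (x j) = if j = i then 1 else 0)
    (β : I → ℕ) : contract H φ (orderedMon x β) -
      (β i : K) • orderedMon x (fun j => if j = i then β i - 1 else β j) ∈
        wordSpan x K (∑ i, β i - 1) := by
  have h1 := contract_word_sub_mem H hx φ hφ (orderedWord β)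
  rw [orderedWord, deleteSum_flatMap h _ (Finset.nodup_toList _), if_pos (by simp),
    ← orderedWord, length_orderedWord] at h1
  exact h1

theorem orderedMon_mem (x : I → B) (K : Type*) [Field K] [Algebra K B] {β : I → ℕ} {d : ℕ}
    (h : ∑ i, β i < d) :
    orderedMon x β ∈ wordSpan x K d :=
  word_mem (by rwa [length_orderedWord])

variable {p : ℕ} [Fact p.Prime] [CharP K p]

/-- Contracting a relation of degree `d + 1` with the functional dual to a letter `i` of `β` gives a
relation of degree `d` in which the coefficient of `β` is multiplied by `β i`. This factor is
nonzero because `0 < β i < p`, and induction applies. -/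
theorem top_degree_eq_zero [Nontrivial B]
    (hx : ∀ i, H.comul (x i) = x i ⊗ₜ[K] 1 + 1 ⊗ₜ[K] x i)
    (φ : I → B →ₗ[K] K) (hφ : ∀ i, φ i 1 = 0)
    (h : ∀ i j, φ i (x j) = if j = i then 1 else 0) (d : ℕ) (s : Finset (I → ℕ))
    (hs : ∀ β ∈ s, ∑ i, β i = d) (hsp : ∀ β ∈ s, ∀ i, β i < p) (c : (I → ℕ) → K)
    (hc : ∑ β ∈ s, c β • orderedMon x β ∈ wordSpan x K d) (β : I → ℕ) (hβ : β ∈ s) : c β = 0 := by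
  induction d generalizing s c β with
  | zero =>
    have h0 : ∀ γ ∈ s, γ = β := by
      intro γ hγ
      have h1 := hs γ hγ
      have h2 := hs β hβ
      rw [Finset.sum_eq_zero_iff] at h1 h2
      funext i
      rw [h1 i (Finset.mem_univ _), h2 i (Finset.mem_univ _)]
    have hsβ : s = {β} := Finset.eq_singleton_iff_unique_mem.mpr ⟨hβ, h0⟩
    have hw : orderedWord β = [] := by
      rw [← List.length_eq_zero_iff, length_orderedWord, hs β hβ]
    rw [hsβ, Finset.sum_singleton, wordSpan_zero, Submodule.mem_bot, orderedMon, hw] at hc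
    simpa using hc
  | succ d ih =>
    obtain ⟨i, hi⟩ : ∃ i, β i ≠ 0 := by
      by_contra! h0
      have := hs β hβ
      simp [h0] at this
    -- `low` is the effect of the derivative on exponents. It is injective with inverse `up` only
    -- where the exponent of `i` is positive, hence the restriction to `t`; the discarded terms
    -- carry the factor `γ i = 0`.
    let low : (I → ℕ) → (I → ℕ) := fun γ j => if j = i then γ i - 1 else γ j
    let up : (I → ℕ) → (I → ℕ) := fun γ j => if j = i then γ i + 1 else γ j
    set t := s.filter fun γ => γ i ≠ 0 with ht
    have hul : ∀ γ ∈ t, up (low γ) = γ := by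
      intro γ hγ
      have := (Finset.mem_filter.mp hγ).2
      funext j
      by_cases hj : j = i
      · subst hj
        simp [up, low]
        omega
      · simp [up, low, hj]
    have hinj : Set.InjOn low t := fun γ hγ γ' hγ' he => by
      rw [← hul γ hγ, he, hul γ' hγ']
    have hdeg : ∀ γ ∈ t, ∑ j, low γ j = d := by
      intro γ hγ
      have h1 := hs γ (Finset.mem_filter.mp hγ).1
      have h2 := (Finset.mem_filter.mp hγ).2
      rw [← Finset.add_sum_erase _ _ (Finset.mem_univ i)] at h1 ⊢
      have h3 : ∑ j ∈ Finset.univ.erase i, low γ j = ∑ j ∈ Finset.univ.erase i, γ j :=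
        Finset.sum_congr rfl fun j hj => by simp [low, Finset.ne_of_mem_erase hj]
      rw [h3]
      simp only [low, if_true]
      omega
    have h1 := contract_wordSpan H hx (φ i) (hφ i) hc
    have h2 : ∑ γ ∈ s, c γ • (contract H (φ i) (orderedMon x γ) -
        (γ i : K) • orderedMon x (low γ)) ∈ wordSpan x K d := by
      refine Submodule.sum_mem _ fun γ hγ => Submodule.smul_mem _ _ ?_
      have := contract_orderedMon_sub_mem H hx (hφ i) (h i) γ
      rwa [hs γ hγ, Nat.add_sub_cancel] at this
    have h3 : ∑ γ ∈ s, c γ • (γ i : K) • orderedMon x (low γ) ∈ wordSpan x K d := by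
      have := sub_mem h1 h2
      rw [map_sum, ← Finset.sum_sub_distrib] at this
      simpa [smul_sub] using this
    have h4 : ∑ γ ∈ s, c γ • (γ i : K) • orderedMon x (low γ) =
        ∑ δ ∈ t.image low, (c (up δ) * ((up δ i : ℕ) : K)) • orderedMon x δ := by
      rw [Finset.sum_image hinj, ht, Finset.sum_filter]
      refine Finset.sum_congr rfl fun γ hγ => ?_
      by_cases h0 : γ i = 0
      · simp [h0]
      · rw [if_pos h0, hul γ (Finset.mem_filter.mpr ⟨hγ, h0⟩), smul_smul]
    rw [h4] at h3
    have hβt : β ∈ t := Finset.mem_filter.mpr ⟨hβ, hi⟩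
    have h5 := ih (t.image low) (by
        intro δ hδ
        obtain ⟨γ, hγ, rfl⟩ := Finset.mem_image.mp hδ
        exact hdeg γ hγ) (by
        intro δ hδ j
        obtain ⟨γ, hγ, rfl⟩ := Finset.mem_image.mp hδ
        have := hsp γ (Finset.mem_filter.mp hγ).1
        by_cases hj : j = i
        · subst hj
          simp only [low, if_true]
          have := this j
          omega
        · simp [low, hj, this j]) (fun δ => c (up δ) * ((up δ i : ℕ) : K)) h3 (low β)
      (Finset.mem_image_of_mem _ hβt)
    simp only [hul β hβt] at h5
    refine (mul_eq_zero.mp h5).resolve_right ?_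
    rw [CharP.cast_eq_zero_iff K p]
    exact Nat.not_dvd_of_pos_of_lt (Nat.pos_of_ne_zero hi) (hsp β hβ i)

/-- Descent on a bound for the degrees with nonzero coefficient: the top-degree part equals minus
the rest, hence lies in the span of shorter words, and `top_degree_eq_zero` kills it. -/
theorem sum_orderedMon_eq_zero [Nontrivial B]
    (hx : ∀ i, H.comul (x i) = x i ⊗ₜ[K] 1 + 1 ⊗ₜ[K] x i)
    (φ : I → B →ₗ[K] K) (hφ : ∀ i, φ i 1 = 0)
    (h : ∀ i j, φ i (x j) = if j = i then 1 else 0) (s : Finset (I → ℕ))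
    (hsp : ∀ β ∈ s, ∀ i, β i < p) (c : (I → ℕ) → K)
    (hc : ∑ β ∈ s, c β • orderedMon x β = 0) (β : I → ℕ) (hβ : β ∈ s) : c β = 0 := by
  have key : ∀ d : ℕ, (∀ β ∈ s, c β ≠ 0 → ∑ i, β i < d) → ∀ β ∈ s, c β = 0 := by
    intro d
    induction d with
    | zero =>
      intro hd β hβ
      by_contra h0
      exact absurd (hd β hβ h0) (Nat.not_lt_zero _)
    | succ d ih =>
      intro hd
      refine ih fun β hβ h0 => lt_of_le_of_ne (Nat.lt_succ_iff.mp (hd β hβ h0)) fun he => h0 ?_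
      refine top_degree_eq_zero H hx φ hφ h d (s.filter fun γ => ∑ i, γ i = d)
        (fun γ hγ => (Finset.mem_filter.mp hγ).2) (fun γ hγ => hsp γ (Finset.mem_filter.mp hγ).1) c
        ?_ β (Finset.mem_filter.mpr ⟨hβ, he⟩)
      rw [← Finset.sum_filter_add_sum_filter_not s (fun γ => ∑ i, γ i = d)] at hc
      rw [eq_neg_of_add_eq_zero_left hc]
      refine Submodule.neg_mem _ (Submodule.sum_mem _ fun γ hγ => ?_)
      rw [Finset.mem_filter] at hγ
      by_cases h1 : c γ = 0
      · simp [h1]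
      · have := hd γ hγ.1 h1
        exact Submodule.smul_mem _ _ (orderedMon_mem x K (by have := hγ.2; omega))
  refine key ((s.sup fun β => ∑ i, β i) + 1) (fun β hβ _ => ?_) β hβ
  exact Nat.lt_succ_of_le (Finset.le_sup (f := fun β : I → ℕ => ∑ i, β i) hβ)

/-- The truncated ordered monomials form a basis of an algebra generated by linearly independent
primitive elements whose span is closed under commutators and `p`-th powers. -/
noncomputable def monomialBasis [Nontrivial B]
    (hx : ∀ i, H.comul (x i) = x i ⊗ₜ[K] 1 + 1 ⊗ₜ[K] x i)
    (φ : I → B →ₗ[K] K) (hφ : ∀ i, φ i 1 = 0)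
    (h : ∀ i j, φ i (x j) = if j = i then 1 else 0)
    (hcomm : ∀ i j, x i * x j - x j * x i ∈ Submodule.span K (Set.range x))
    (hpow : ∀ i, x i ^ p ∈ Submodule.span K (Set.range x))
    (hgen : Algebra.adjoin K (Set.range x) = ⊤) : Module.Basis (I → Fin p) K B :=
  Module.Basis.mk (v := fun β : I → Fin p => orderedMon x fun i => (β i : ℕ))
    (by
      rw [linearIndependent_iff']
      intro s g hg β hβ
      let f : (I → Fin p) → (I → ℕ) := fun β i => (β i : ℕ)
      have hf : Function.Injective f := fun β γ he =>
        funext fun i => Fin.ext (congrFun he i)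
      have := sum_orderedMon_eq_zero H hx φ hφ h (p := p) (s.image f) (by
        intro γ hγ i
        obtain ⟨δ, _, rfl⟩ := Finset.mem_image.mp hγ
        exact (δ i).isLt) (fun γ => g (Function.invFun f γ)) (by
        rw [Finset.sum_image hf.injOn]
        simpa only [Function.leftInverse_invFun hf _] using hg) (f β)
        (Finset.mem_image_of_mem f hβ)
      simpa only [Function.leftInverse_invFun hf _] using this)
    (span_orderedMon_eq_top (Fact.out : p.Prime).two_le hcomm hpow hgen).ge

end MonomialBasis

end ContactHopf

namespace ContactHopf

/-! ### The monomial basis of the truncated divided power algebra -/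

section DivPowBasis

variable {K : Type*} [Field K] {p n : ℕ}

theorem coeff_eq_zero_of_mem_truncIdeal {f : MvPolynomial (Idx n) K} (hf : f ∈ truncIdeal K p n)
    {m : Idx n →₀ ℕ} (hm : ∀ a, m a < p) : f.coeff m = 0 := by
  have h1 : (Set.range fun a : Idx n => (MvPolynomial.X a : MvPolynomial (Idx n) K) ^ p) =
      (fun s => MvPolynomial.monomial s (1 : K)) ''
        Set.range fun a : Idx n => Finsupp.single a p := by
    rw [← Set.range_comp]
    congr 1
    funext a
    simp [MvPolynomial.X_pow_eq_monomial]
  rw [truncIdeal, h1, MvPolynomial.mem_ideal_span_monomial_image] at hf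
  by_contra h0
  obtain ⟨_, ⟨a, rfl⟩, ha⟩ := hf m (MvPolynomial.mem_support_iff.mpr h0)
  have := ha a
  rw [Finsupp.single_eq_same] at this
  exact absurd (hm a) (not_lt.mpr this)

theorem coeff_eq_of_mk_eq {f g : MvPolynomial (Idx n) K}
    (h : DivPow.mk K p n f = DivPow.mk K p n g) {m : Idx n →₀ ℕ} (hm : ∀ a, m a < p) :
    f.coeff m = g.coeff m := by
  rw [← sub_eq_zero, ← map_sub, DivPow.mk_eq_zero] at h
  rw [← sub_eq_zero, ← MvPolynomial.coeff_sub]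
  exact coeff_eq_zero_of_mem_truncIdeal h hm

theorem xv_pow_eq_zero (a : Idx n) {m : ℕ} (hm : p ≤ m) : xv K p n a ^ m = 0 := by
  refine pow_eq_zero_of_le hm ?_
  rw [xv, ← map_pow, DivPow.mk_eq_zero]
  exact Ideal.subset_span ⟨a, rfl⟩

theorem prod_xv_eq_mk (α : Idx n → ℕ) : ∏ a, xv K p n a ^ α a =
    DivPow.mk K p n (MvPolynomial.monomial (Finsupp.equivFunOnFinite.symm α) 1) := by
  rw [MvPolynomial.monomial_eq, Finsupp.prod_fintype _ _ (fun _ => pow_zero _)]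
  simp [xv]

theorem divMon_eq_mk (α : Idx n → ℕ) : divMon K p n α =
    DivPow.mk K p n (MvPolynomial.monomial (Finsupp.equivFunOnFinite.symm α)
      (∏ a, ((α a).factorial : K))⁻¹) := by
  rw [divMon, prod_xv_eq_mk, ← map_smul, MvPolynomial.smul_monomial, smul_eq_mul, mul_one]

variable [Fact p.Prime] [CharP K p]

theorem prod_factorial_ne_zero {α : Idx n → ℕ} (hα : ∀ a, α a < p) :
    (∏ a, ((α a).factorial : K)) ≠ 0 :=
  Finset.prod_ne_zero_iff.mpr fun a _ => natCast_factorial_ne_zero K (hα a)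

theorem prod_xv_eq_smul {α : Idx n → ℕ} (hα : ∀ a, α a < p) :
    ∏ a, xv K p n a ^ α a = (∏ a, ((α a).factorial : K)) • divMon K p n α := by
  rw [divMon, smul_smul, mul_inv_cancel₀ (prod_factorial_ne_zero hα), one_smul]

/-- The basis of the truncated divided power algebra formed by the divided power monomials. -/
noncomputable def divBasis (K : Type*) [Field K] (p n : ℕ) [Fact p.Prime] [CharP K p] :
    Module.Basis (Idx n → Fin p) K (DivPow K p n) :=
  Module.Basis.mk (v := fun α : Idx n → Fin p => divMon K p n fun a => (α a : ℕ))
    (by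
      rw [linearIndependent_iff']
      intro s g hg β hβ
      have h1 : DivPow.mk K p n (∑ α ∈ s, g α • MvPolynomial.monomial
          (Finsupp.equivFunOnFinite.symm fun a => (α a : ℕ))
            (∏ a, ((α a : ℕ).factorial : K))⁻¹) = DivPow.mk K p n 0 := by
        rw [map_zero, map_sum, ← hg]
        exact Finset.sum_congr rfl fun α _ => by rw [map_smul, divMon_eq_mk]
      have h2 := coeff_eq_of_mk_eq h1
        (m := Finsupp.equivFunOnFinite.symm fun a => (β a : ℕ)) (fun a => (β a).isLt)
      rw [MvPolynomial.coeff_sum, Finset.sum_eq_single β] at h2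
      · have h3 := prod_factorial_ne_zero (K := K) (p := p) (n := n)
          (α := fun a => (β a : ℕ)) (fun a => (β a).isLt)
        rw [MvPolynomial.coeff_smul, MvPolynomial.coeff_monomial, if_pos rfl,
          MvPolynomial.coeff_zero, smul_eq_mul] at h2
        exact (mul_eq_zero.mp h2).resolve_right (inv_ne_zero h3)
      · intro α _ hα
        rw [MvPolynomial.coeff_smul, MvPolynomial.coeff_monomial, if_neg, smul_zero]
        intro h
        apply hα
        funext a
        exact Fin.ext (by simpa using DFunLike.congr_fun h a)
      · exact fun h => absurd hβ h)
    (by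
      rintro f -
      obtain ⟨f, rfl⟩ := DivPow.mk_surjective K p n f
      rw [MvPolynomial.as_sum f, map_sum]
      refine Submodule.sum_mem _ fun m _ => ?_
      have h1 : DivPow.mk K p n (MvPolynomial.monomial m (f.coeff m)) =
          f.coeff m • ∏ a, xv K p n a ^ m a := by
        rw [prod_xv_eq_mk, ← map_smul, MvPolynomial.smul_monomial, smul_eq_mul, mul_one]
        simp
      rw [h1]
      refine Submodule.smul_mem _ _ ?_
      by_cases hm : ∀ a, m a < p
      · rw [prod_xv_eq_smul hm]
        exact Submodule.smul_mem _ _ (Submodule.subset_span ⟨fun a => ⟨m a, hm a⟩, rfl⟩)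
      · push Not at hm
        obtain ⟨a, ha⟩ := hm
        rw [Finset.prod_eq_zero (Finset.mem_univ a) (xv_pow_eq_zero a ha)]
        exact Submodule.zero_mem _)

theorem divBasis_apply (α : Idx n → Fin p) :
    divBasis K p n α = divMon K p n fun a => (α a : ℕ) := by
  simp [divBasis]

/-- The multi-index `τ = (p - 1, …, p - 1)`. -/
def topIdx (p n : ℕ) [Fact p.Prime] : Idx n → Fin p := fun _ =>
  ⟨p - 1, Nat.sub_lt (Fact.out : p.Prime).pos one_pos⟩

/-- The coefficient of `x^{(τ)}`. -/
noncomputable def topCoeff (K : Type*) [Field K] (p n : ℕ) [Fact p.Prime] [CharP K p] :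
    DivPow K p n →ₗ[K] K :=
  (divBasis K p n).coord (topIdx p n)

/-- Reaching `x^{(τ)}` by `D_a` would require the exponent `p` at `a`, which is not available. -/
theorem topCoeff_pd (a : Idx n) (f : DivPow K p n) : topCoeff K p n (pd K p n a f) = 0 := by
  have : topCoeff K p n ∘ₗ (pd K p n a : DivPow K p n →ₗ[K] DivPow K p n) = 0 := by
    refine (divBasis K p n).ext fun α => ?_
    rw [LinearMap.comp_apply, divBasis_apply, Derivation.coeFn_coe, LinearMap.zero_apply]
    by_cases h0 : (α a : ℕ) = 0
    · rw [divMon, Derivation.map_smul, pd_prod, h0]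
      simp
    · have hp := (Fact.out : p.Prime).one_lt
      let β : Idx n → Fin p := fun b => if b = a then ⟨α a - 1, by omega⟩ else α b
      have h1 : (fun b => (α b : ℕ)) = (fun b => (β b : ℕ)) + eps a := by
        funext b
        by_cases hb : b = a
        · subst hb
          simp [β, eps]
          omega
        · simp [β, eps, hb]
      have hβ : (β a : ℕ) = α a - 1 := by simp [β]
      have hα := (α a).isLt
      rw [h1, pd_divMon a _ (by simp only [hβ]; omega), ← divBasis_apply, topCoeff,
        Module.Basis.coord_apply, Module.Basis.repr_self, Finsupp.single_apply, if_neg]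
      intro h
      have h2 := congrArg (fun γ => (γ a : ℕ)) h
      simp only [hβ, topIdx] at h2
      omega
  exact DFunLike.congr_fun this f

/-- Integration by parts, all derivatives being moved off `f`. The constant arises as `2` from `2 f
D_0 g`, another `2` from `-2 g D_0 f`, and `2n` from the Euler operator in `2n` variables. -/
theorem contactBracket_eq (f g : DivPow K p n) : contactBracket (pd K p n) (xv K p n) f g =
    ((2 * n + 4 : ℕ) : K) • (f * pd K p n zi g) - (2 : K) • pd K p n zi (f * g) +
      pd K p n zi (f * eulerOp (pd K p n) (xv K p n) g) +
      ∑ i, (pd K p n (neg i) (f * pd K p n (pos i) g) -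
        pd K p n (pos i) (f * pd K p n (neg i) g)) -
      ∑ i, (pd K p n (pos i) (xv K p n (pos i) * (f * pd K p n zi g)) +
        pd K p n (neg i) (xv K p n (neg i) * (f * pd K p n zi g))) := by
  have d0_e : ∀ u, pd K p n zi (eulerOp (pd K p n) (xv K p n) u) =
      eulerOp (pd K p n) (xv K p n) (pd K p n zi u) := by
    intro u
    simp only [eulerOp, map_sum, map_add, Derivation.leibniz, smul_eq_mul, pd_xv,
      pd_comm zi]
    exact Finset.sum_congr rfl fun i _ => by simp
  have h1 : ∑ i, (pd K p n (neg i) (f * pd K p n (pos i) g) -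
        pd K p n (pos i) (f * pd K p n (neg i) g)) = poisson (pd K p n) f g := by
    refine Finset.sum_congr rfl fun i _ => ?_
    simp only [Derivation.leibniz, smul_eq_mul, pd_comm (neg i) (pos i)]
    ring
  have h2 : ∑ i, (pd K p n (pos i) (xv K p n (pos i) * (f * pd K p n zi g)) +
        pd K p n (neg i) (xv K p n (neg i) * (f * pd K p n zi g))) =
      (2 * n : DivPow K p n) * (f * pd K p n zi g) +
        eulerOp (pd K p n) (xv K p n) f * pd K p n zi g +
        f * eulerOp (pd K p n) (xv K p n) (pd K p n zi g) := by
    have h3 : (2 * n : DivPow K p n) * (f * pd K p n zi g) =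
        ∑ _i : Fin n, 2 * (f * pd K p n zi g) := by
      simp
      ring
    rw [h3, eulerOp, eulerOp, Finset.sum_mul, Finset.mul_sum, ← Finset.sum_add_distrib,
      ← Finset.sum_add_distrib]
    refine Finset.sum_congr rfl fun i _ => ?_
    simp only [Derivation.leibniz, smul_eq_mul, pd_xv]
    simp
    ring
  rw [h1, h2, contactBracket, contactField_apply, Derivation.leibniz, Derivation.leibniz, d0_e,
    Nat.cast_smul_eq_nsmul, nsmul_eq_mul, two_smul]
  push_cast
  simp only [smul_eq_mul]
  ring

theorem topCoeff_contactBracket (h : p ∣ 2 * n + 4) (f g : DivPow K p n) :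
    topCoeff K p n (contactBracket (pd K p n) (xv K p n) f g) = 0 := by
  rw [contactBracket_eq, (CharP.cast_eq_zero_iff K p _).mpr h]
  simp only [map_add, map_sub, map_sum, map_smul, topCoeff_pd]
  simp

/-- The value at `x_0` gives `2 f = E f`, with `E` the Euler operator. The values at `x_i` and
`x_{-i}`, combined so that `D_0 f` cancels, give `E f = 0`. -/
theorem DK_injective [Fact (2 < p)] : Function.Injective (DK K p n) := by
  rw [injective_iff_map_eq_zero]
  intro f hf
  have h0 : ∀ u, DK K p n f u = 0 := fun u => by rw [hf]; rfl
  have e1 : 2 * f = eulerOp (pd K p n) (xv K p n) f := by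
    have := h0 (xv K p n zi)
    rw [DK, contactField_apply] at this
    simpa [eulerOp, poisson, pd_xv, sub_eq_zero] using this
  have ep : ∀ i, pd K p n zi f * xv K p n (pos i) + pd K p n (neg i) f = 0 := by
    intro i
    have := h0 (xv K p n (pos i))
    rw [DK, contactField_apply] at this
    simpa [eulerOp, poisson, pd_xv, sub_eq_zero] using this
  have en : ∀ i, pd K p n zi f * xv K p n (neg i) - pd K p n (pos i) f = 0 := by
    intro i
    have := h0 (xv K p n (neg i))
    rw [DK, contactField_apply] at this
    simpa [eulerOp, poisson, pd_xv, sub_eq_add_neg] using this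
  have e2 : eulerOp (pd K p n) (xv K p n) f = 0 := by
    refine Finset.sum_eq_zero fun i _ => ?_
    linear_combination xv K p n (neg i) * ep i - xv K p n (pos i) * en i
  have e3 : (2 : K) • f = 0 := by rw [two_smul, ← two_mul, e1, e2]
  exact (smul_eq_zero.mp e3).resolve_left (two_ne_zero_of_lt (p := p))

theorem DKfull_injective [Fact (2 < p)] : Function.Injective (DKfull K p n) := fun _ _ h =>
  DK_injective (congrArg Subtype.val h)

/-- The admissible multi-indices. -/
abbrev Adm (p n : ℕ) : Type := {α : Idx n → ℕ // Admissible p n α}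

/-- The inclusion of the admissible multi-indices. -/
def Adm.toFin {p n : ℕ} (α : Adm p n) : Idx n → Fin p := fun a => ⟨α.1 a, α.2.1 a⟩

theorem Adm.toFin_injective {p n : ℕ} : Function.Injective (Adm.toFin : Adm p n → _) :=
  fun _ _ h => Subtype.ext (funext fun a => congrArg Fin.val (congrFun h a))

noncomputable instance : Fintype (Adm p n) := Fintype.ofInjective _ Adm.toFin_injective

theorem card_idx_fin : Fintype.card (Idx n → Fin p) = p ^ (2 * n + 1) := by
  simp [two_mul]

theorem card_adm_of_not_dvd (h : ¬ p ∣ 2 * n + 4) : Fintype.card (Adm p n) = p ^ (2 * n + 1) := by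
  rw [← card_idx_fin]
  refine Fintype.card_of_bijective (f := Adm.toFin) ⟨Adm.toFin_injective, fun β => ?_⟩
  exact ⟨⟨fun a => β a, fun a => (β a).isLt, fun h' => absurd h' h⟩, rfl⟩

theorem card_adm_of_dvd (h : p ∣ 2 * n + 4) : Fintype.card (Adm p n) + 1 = p ^ (2 * n + 1) := by
  classical
  rw [← card_idx_fin, ← Finset.card_univ, ← Finset.card_univ,
    ← Finset.card_erase_add_one (Finset.mem_univ (topIdx p n))]
  congr 1
  refine Finset.card_bij (fun α _ => Adm.toFin α) ?_ (fun α _ β _ h => Adm.toFin_injective h) ?_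
  · intro α _
    refine Finset.mem_erase.mpr ⟨fun h' => α.2.2 h ?_, Finset.mem_univ _⟩
    funext a
    exact congrArg Fin.val (congrFun h' a)
  · intro β hβ
    refine ⟨⟨fun a => β a, fun a => (β a).isLt, fun _ h' => ?_⟩, Finset.mem_univ _, rfl⟩
    exact (Finset.mem_erase.mp hβ).1 (funext fun a => Fin.ext (congrFun h' a))

variable [Fact (2 < p)]

/-- The derived algebra is spanned by brackets, for which the vanishing of the top coefficient is
`topCoeff_contactBracket`; the condition is linear. So no element outside the span of the admissible
fields can occur. -/
theorem exists_mem_contactAlg {X : contactFull K p n} (hX : X ∈ contactAlg K p n) :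
    ∃ f : DivPow K p n, (p ∣ 2 * n + 4 → topCoeff K p n f = 0) ∧ DKfull K p n f = X := by
  rw [contactAlg, ← LieSubmodule.mem_toSubmodule, LieSubmodule.lieIdeal_oper_eq_linear_span'] at hX
  induction hX using Submodule.span_induction with
  | mem X hX =>
    obtain ⟨⟨Y, f, rfl⟩, -, ⟨Z, g, rfl⟩, -, rfl⟩ := hX
    refine ⟨contactBracket (pd K p n) (xv K p n) f g,
      fun h => topCoeff_contactBracket h f g, ?_⟩
    exact Subtype.ext (DK_lie f g).symm
  | zero => exact ⟨0, by simp, by simp⟩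
  | add X Y _ _ hX hY =>
    obtain ⟨f, hf, rfl⟩ := hX
    obtain ⟨g, hg, rfl⟩ := hY
    exact ⟨f + g, fun h => by rw [map_add, hf h, hg h, add_zero], map_add _ _ _⟩
  | smul c X _ hX =>
    obtain ⟨f, hf, rfl⟩ := hX
    exact ⟨c • f, fun h => by rw [map_smul, hf h, smul_zero], map_smul _ _ _⟩

theorem span_DKelt : Submodule.span K (Set.range fun α : Adm p n => DKelt K p n α.1 α.2) = ⊤ := by
  rw [eq_top_iff]
  rintro ⟨X, hX⟩ -
  obtain ⟨f, hf, rfl⟩ := exists_mem_contactAlg hX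
  suffices h : DKfull K p n f ∈ (Submodule.span K (Set.range fun α : Adm p n =>
      DKelt K p n α.1 α.2)).map (contactAlg K p n).toSubmodule.subtype by
    obtain ⟨Y, hY, hY'⟩ := h
    rwa [← (Subtype.ext hY' : Y = ⟨DKfull K p n f, hX⟩)]
  rw [Submodule.map_span]
  rw [← (divBasis K p n).sum_repr f, map_sum]
  refine Submodule.sum_mem _ fun α _ => ?_
  rw [map_smul, divBasis_apply]
  by_cases h : p ∣ 2 * n + 4 ∧ α = topIdx p n
  · have := hf h.1
    rw [h.2]
    rw [topCoeff, Module.Basis.coord_apply] at this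
    rw [this, zero_smul]
    exact Submodule.zero_mem _
  · refine Submodule.smul_mem _ _ (Submodule.subset_span ?_)
    have hα : Admissible p n fun a => (α a : ℕ) := ⟨fun a => (α a).isLt, fun h1 h2 =>
      h ⟨h1, funext fun a => Fin.ext (congrFun h2 a)⟩⟩
    exact ⟨DKelt K p n _ hα, ⟨⟨_, hα⟩, rfl⟩, rfl⟩

theorem linearIndependent_DKelt :
    LinearIndependent K fun α : Adm p n => DKelt K p n α.1 α.2 := by
  refine LinearIndependent.of_comp ((contactAlg K p n).toSubmodule.subtype) ?_
  have h1 := ((divBasis K p n).linearIndependent.comp _ Adm.toFin_injective).map'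
    (DKfull K p n) (LinearMap.ker_eq_bot.mpr DKfull_injective)
  have e : (contactAlg K p n).toSubmodule.subtype ∘ (fun α : Adm p n => DKelt K p n α.1 α.2) =
      DKfull K p n ∘ divBasis K p n ∘ Adm.toFin := by
    funext α
    simp only [Function.comp_apply, divBasis_apply]
    rfl
  rw [e]
  exact h1

end DivPowBasis

end ContactHopf

namespace ContactHopf

/-! ### The `p`-th powers of the contact fields of monomials -/

section PowChar

variable {K : Type*} [Field K] {p : ℕ} [Fact p.Prime] [CharP K p]

theorem iterate_eq_sum_choose {M : Type*} [AddCommGroup M] [Module K M] (D : Module.End K M)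
    (f : ℕ → ℕ → M) (hf : ∀ i j, D (f i j) = f (i + 1) j + f i (j + 1)) (m : ℕ) :
    (D ^ m) (f 0 0) = ∑ ij ∈ Finset.HasAntidiagonal.antidiagonal m, m.choose ij.1 • f ij.1 ij.2 := by
  induction m with
  | zero => simp
  | succ m ih =>
    rw [pow_succ', Module.End.mul_apply, ih, map_sum, Finset.sum_antidiagonal_choose_succ_nsmul,
      ← Finset.sum_add_distrib]
    refine Finset.sum_congr rfl fun ij hij => ?_
    rw [map_nsmul, hf, smul_add, add_comm, Nat.choose_symm_of_eq_add
      (Finset.HasAntidiagonal.mem_antidiagonal.mp hij).symm]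

/-- An abstract Leibniz rule: a double array obeying Pascal's recursion under `D` has only its two
corner terms left after `p` steps, as the inner binomial coefficients vanish. It is applied to
products and also to arrays adapted to particular differential equations. -/
theorem pow_char_apply {M : Type*} [AddCommGroup M] [Module K M] (D : Module.End K M)
    (f : ℕ → ℕ → M) (hf : ∀ i j, D (f i j) = f (i + 1) j + f i (j + 1)) :
    (D ^ p) (f 0 0) = f p 0 + f 0 p := by
  have hp := (Fact.out : p.Prime).pos
  rw [iterate_eq_sum_choose D f hf,
    Finset.Nat.sum_antidiagonal_eq_sum_range_succ fun i j => p.choose i • f i j,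
    Finset.sum_range_succ, Finset.sum_eq_single_of_mem 0 (Finset.mem_range.mpr hp)]
  · simp [add_comm]
  · intro i hi h0
    have := (Fact.out : p.Prime).dvd_choose_self h0 (Finset.mem_range.mp hi)
    rw [← Nat.cast_smul_eq_nsmul K, (CharP.cast_eq_zero_iff K p _).mpr this, zero_smul]

variable {O : Type*} [CommRing O] [Algebra K O]

/-- The `p`-th power of a derivation in characteristic `p`. -/
def derivationPowChar (p : ℕ) [Fact p.Prime] [CharP K p] (D : Derivation K O O) :
    Derivation K O O :=
  Derivation.mk' ((D : Module.End K O) ^ p) fun a b => by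
    have h := pow_char_apply (K := K) (p := p) (D : Module.End K O)
      (fun i j => ((D : Module.End K O) ^ i) a * ((D : Module.End K O) ^ j) b) (fun i j => by
        rw [Derivation.coeFn_coe, Derivation.leibniz, pow_succ', pow_succ']
        simp only [Module.End.mul_apply, Derivation.coeFn_coe, smul_eq_mul]
        ring)
    simp only [pow_zero, Module.End.one_apply] at h
    rw [h]
    simp only [smul_eq_mul]
    ring

theorem derivationPowChar_apply (D : Derivation K O O) (a : O) :
    derivationPowChar p D a = ((D : Module.End K O) ^ p) a := rfl

theorem derivation_pow_smul {D : Derivation K O O} {G : O} {κ : K} (hG : D G = κ • (G * G)) (i : ℕ) :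
    D (G ^ i) = (i * κ) • G ^ (i + 1) := by
  rw [Derivation.leibniz_pow, hG]
  rcases i with _ | i
  · simp
  · simp only [Nat.add_sub_cancel, smul_eq_mul, nsmul_eq_mul]
    simp only [Algebra.smul_def, map_mul, map_natCast]
    ring

/-- The array has the rows `c_i G ^ i x` and `c_i G ^ i y` and zeros afterwards, with `c_i = ∏ (μ +
s κ)` forced by the equations. Its corners are a multiple of `G ^ p` and a zero entry. -/
theorem pow_char_apply_of_eq {D : Derivation K O O} {G x y : O} {κ μ : K}
    (hG : D G = κ • (G * G)) (hx : D x = μ • (G * x) + y) (hy : D y = μ • (G * y))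
    (hGp : G ^ p = 0) : ((D : Module.End K O) ^ p) x = 0 := by
  let c : ℕ → K := fun i => ∏ s ∈ Finset.range i, (μ + s * κ)
  have hc : ∀ i, c (i + 1) = c i * (μ + i * κ) := fun i => Finset.prod_range_succ _ _
  let f : ℕ → ℕ → O := fun i j => if j = 0 then c i • (G ^ i * x) else
    if j = 1 then c i • (G ^ i * y) else 0
  have h := pow_char_apply (K := K) (p := p) (D : Module.End K O) f (fun i j => by
    rcases j with _ | _ | j
    · simp only [f, Derivation.coeFn_coe, Derivation.map_smul, Derivation.leibniz, if_true, hx,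
        derivation_pow_smul hG, hc, smul_eq_mul]
      simp only [zero_add, one_ne_zero, if_true, if_false, mul_add, add_mul, add_smul, smul_add,
        mul_smul, Algebra.smul_def, map_mul, map_add, map_natCast]
      ring
    · simp only [f, zero_add, one_ne_zero, if_true, if_false, Derivation.coeFn_coe,
        Derivation.map_smul, Derivation.leibniz, hy, derivation_pow_smul hG, hc, smul_eq_mul]
      simp only [zero_add, one_ne_zero, if_true, if_false, mul_add, add_mul, add_smul, smul_add,
        mul_smul, Algebra.smul_def, map_mul, map_add, map_natCast]
      norm_num
      ring
    · simp [f])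
  have hp := (Fact.out : p.Prime).two_le
  have h0 : p ≠ 0 := by omega
  have h1 : p ≠ 1 := by omega
  simpa [f, c, hGp, h0, h1] using h

/-- The array is `c_i(κ) c_j(ν) G ^ i g ^ j x`; the two last hypotheses say precisely that its
corners vanish. -/
theorem pow_char_apply_of_eq' {D : Derivation K O O} {G g x : O} {κ ν : K}
    (hG : D G = κ • (G * G)) (hg : D g = ν • (g * g)) (hx : D x = G * x + g * x)
    (hGp : G ^ p = 0) (hgp : (∏ s ∈ Finset.range p, (1 + s * ν)) • g ^ p = 0) :
    ((D : Module.End K O) ^ p) x = 0 := by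
  let c : K → ℕ → K := fun κ i => ∏ s ∈ Finset.range i, (1 + s * κ)
  have hc : ∀ κ i, c κ (i + 1) = c κ i * (1 + i * κ) := fun κ i => Finset.prod_range_succ _ _
  let f : ℕ → ℕ → O := fun i j => (c κ i * c ν j) • (G ^ i * g ^ j * x)
  have h := pow_char_apply (K := K) (p := p) (D : Module.End K O) f (fun i j => by
    simp only [f, Derivation.coeFn_coe, Derivation.map_smul, Derivation.leibniz, hx,
      derivation_pow_smul hG, derivation_pow_smul hg, hc, smul_eq_mul]
    simp only [Algebra.smul_def, map_mul, map_add, map_natCast, map_one]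
    ring)
  have hf0 : f 0 0 = x := by simp [f, c]
  have hfp : f p 0 = 0 := by simp [f, hGp]
  have hfp' : f 0 p = 0 := by
    have h0 : c κ 0 = 1 := Finset.prod_range_zero _
    simp only [f, h0, one_mul, pow_zero]
    rw [← smul_mul_assoc, hgp, zero_mul]
  rw [hf0, hfp, hfp', add_zero] at h
  exact h

theorem pow_char_apply_eigen {D : Derivation K O O} {x : O} (c : ℤ) (hx : D x = (c : K) • x) :
    ((D : Module.End K O) ^ p) x = D x := by
  have : ∀ m : ℕ, ((D : Module.End K O) ^ m) x = (c : K) ^ m • x := by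
    intro m
    induction m with
    | zero => simp
    | succ m ih =>
      rw [pow_succ', Module.End.mul_apply, ih, map_smul, Derivation.coeFn_coe, hx, smul_smul,
        pow_succ]
  rw [this, hx, ← cst_intCast K (p := p), cst, ← map_pow, ZMod.pow_card]

/-- The ratio `(a - b) / b` is a nonzero element of the prime field, so some factor `1 + s (a - b) /
b` vanishes, namely for `s = -b / (a - b)`. -/
theorem prod_one_add_mul_eq_zero {a b : ℕ} (ha : a < p) (hb : b < p) (hab : a ≠ b) (hb0 : b ≠ 0) :
    ∏ s ∈ Finset.range p, (1 + (s : K) * (((a : K) - b) / b)) = 0 := by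
  have h1 : ((a : ZMod p) - (b : ZMod p)) ≠ 0 := by
    rw [sub_ne_zero, Ne, ZMod.natCast_eq_natCast_iff', Nat.mod_eq_of_lt ha, Nat.mod_eq_of_lt hb]
    exact hab
  have h2 : (b : K) ≠ 0 := by
    rw [Ne, CharP.cast_eq_zero_iff K p]
    exact Nat.not_dvd_of_pos_of_lt (Nat.pos_of_ne_zero hb0) hb
  let s : ZMod p := -(b : ZMod p) / ((a : ZMod p) - (b : ZMod p))
  have h3 : (b : ZMod p) + s * ((a : ZMod p) - (b : ZMod p)) = 0 := by
    simp only [s]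
    field_simp
    ring
  refine Finset.prod_eq_zero (Finset.mem_range.mpr (ZMod.val_lt s)) ?_
  have h4 := congrArg (cst K) h3
  have h5 : cst K s = (s.val : K) := by
    rw [← cst_natCast K (p := p), ZMod.natCast_zmod_val]
  have h6 : cst K (s * ((a : ZMod p) - (b : ZMod p))) = cst K s * ((a : K) - b) := by
    rw [cst, map_mul, map_sub, map_natCast, map_natCast]
    rfl
  rw [cst_add, cst_natCast, h6, h5, cst_zero] at h4
  field_simp
  linear_combination h4

end PowChar

end ContactHopf

namespace ContactHopf

/-! ### Differential relations of a monomial under its own contact field -/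

section Eigen

variable {K P : Type*} [Field K] [CommRing P] [IsDomain P] [Algebra K P]

theorem derivation_const_mul (D : Derivation K P P) (a : ℕ) (f : P) : D (a * f) = a * D f := by
  rw [← nsmul_eq_mul, map_nsmul, nsmul_eq_mul]

/-- In the application `f` is a monomial, `D` its contact field, `G = D_0 f`, `y` and `z` are the
derivatives of `f` in paired variables `x_v` and `x_u`, and `ε = ±1`. The identity comes from
applying `D` to `x_v y = v f`. This part is set in a domain because the variables must be cancelled,
which is impossible in the truncated algebra. -/
theorem eigen_deriv_mul {D : Derivation K P P} {f G y xv z : P} {v : ℕ} (ε : P)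
    (hf : D f = 2 * f * G) (hy : xv * y = v * f) (hDv : D xv = G * xv - ε * z) :
    xv * D y = xv * (G * y) + ε * y * z := by
  have h := congrArg D hy
  rw [derivation_const_mul, Derivation.leibniz, hf, hDv, smul_eq_mul, smul_eq_mul] at h
  linear_combination h - 2 * G * hy

theorem eigen_deriv_single {D : Derivation K P P} {f G y xv z : P} {v : ℕ} (ε : P) (hxv : xv ≠ 0)
    (hf : D f = 2 * f * G) (hy : xv * y = v * f) (hDv : D xv = G * xv - ε * z) (hz : z = 0) :
    D y = G * y := by
  refine mul_left_cancel₀ hxv ?_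
  rw [eigen_deriv_mul ε hf hy hDv, hz, mul_zero, add_zero]

/-- Here `g` is the mixed second derivative of `f`. Applying `D` to `x_u g = u y` and eliminating `D
y` gives, up to scalars, a Riccati equation `D g ∼ g ^ 2`, the form required by
`pow_char_apply_of_eq'`. -/
theorem eigen_deriv_double {D : Derivation K P P} {f G y xu xv z g : P} {u v : ℕ} (ε : P)
    (hxu : xu ≠ 0) (hxv : xv ≠ 0) (hf : D f = 2 * f * G)
    (hy : xv * y = v * f) (hDu : D xu = G * xu + ε * y)
    (hDv : D xv = G * xv - ε * z) (hgu : xu * g = u * y) (hgv : xv * g = v * z) :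
    (u * v * D g : P) = ε * ((u : P) - v) * (g * g) := by
  have h1 := eigen_deriv_mul ε hf hy hDv
  have h2 : (v : P) * D y = v * (G * y) + ε * y * g := by
    refine mul_left_cancel₀ hxv ?_
    linear_combination v * h1 - ε * y * hgv
  have h3 := congrArg D hgu
  rw [derivation_const_mul, Derivation.leibniz, hDu, smul_eq_mul, smul_eq_mul] at h3
  refine mul_left_cancel₀ hxu ?_
  linear_combination (u * v : P) * h3 + (u : P) * u * h2 - (u * v : P) * G * hgu - ε * u * g * hgu
    + v * ε * g * hgu

theorem eigen_deriv_zero {D : Derivation K P P} {f G x0 : P} {a : ℕ} {s : P} (hx0 : x0 ≠ 0)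
    (hf : D f = 2 * f * G) (hG : x0 * G = a * f) (hD : D x0 = (2 - s) * f) :
    (a : P) * D G = (2 * a - 2 + s) * (G * G) := by
  have h := congrArg D hG
  rw [derivation_const_mul, Derivation.leibniz, hf, hD, smul_eq_mul, smul_eq_mul] at h
  refine mul_left_cancel₀ hx0 ?_
  linear_combination (a : P) * h + (2 - s - 2 * a) * G * hG

end Eigen

/-! ### Contact fields of divided power monomials, lifted to polynomials -/

section ContactPow

variable {K : Type*} [Field K] {p n : ℕ} [CharP K p]

theorem DK_mk (f u : MvPolynomial (Idx n) K) : DK K p n (DivPow.mk K p n f) (DivPow.mk K p n u) =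
    DivPow.mk K p n (contactField MvPolynomial.pderiv MvPolynomial.X f u) := by
  rw [DK, contactField_apply, contactField_apply]
  simp only [eulerOp, poisson, pd_mk, xv, map_add, map_mul, map_sub, map_sum, map_ofNat]

variable [Fact p.Prime]

theorem natCast_ne_zero_of_lt (K : Type*) [Field K] [CharP K p] {a : ℕ} (h0 : a ≠ 0) (h : a < p) :
    (a : K) ≠ 0 := by
  rw [Ne, CharP.cast_eq_zero_iff K p]
  exact Nat.not_dvd_of_pos_of_lt (Nat.pos_of_ne_zero h0) h

theorem divMon_pow_char {β : Idx n → ℕ} (hβ : β ≠ 0) : divMon K p n β ^ p = 0 := by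
  obtain ⟨a, ha⟩ := Function.ne_iff.mp hβ
  have h : ∏ b, (xv K p n b ^ β b) ^ p = 0 :=
    Finset.prod_eq_zero (Finset.mem_univ a) (by
      rw [← pow_mul]
      exact xv_pow_eq_zero a (Nat.le_mul_of_pos_left p (Nat.pos_of_ne_zero ha)))
  rw [divMon, smul_pow, ← Finset.prod_pow, h, smul_zero]

theorem pd_divMon_eq_zero {a : Idx n} {α : Idx n → ℕ} (h : α a = 0) :
    pd K p n a (divMon K p n α) = 0 := by
  rw [divMon, Derivation.map_smul, pd_prod, h]
  simp

theorem eq_add_eps {a : Idx n} {α : Idx n → ℕ} (h : α a ≠ 0) :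
    ∃ β, α = β + eps a := by
  refine ⟨fun b => if b = a then α a - 1 else α b, funext fun b => ?_⟩
  by_cases hb : b = a
  · subst hb
    simp [eps]
    omega
  · simp [eps, hb]

/-- A derivative of a divided power monomial is zero or again such a monomial, and only the constant
one has a nonzero `p`-th power. -/
theorem pd_divMon_pow {a : Idx n} {α : Idx n → ℕ} (hα : α a < p) (h : α ≠ eps a) :
    pd K p n a (divMon K p n α) ^ p = 0 := by
  by_cases h0 : α a = 0
  · rw [pd_divMon_eq_zero h0, zero_pow (Fact.out : p.Prime).ne_zero]
  · obtain ⟨β, rfl⟩ := eq_add_eps h0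
    rw [pd_divMon a β (by simpa [eps] using hα), divMon_pow_char]
    rintro rfl
    exact h (zero_add _)

theorem pd_pd_divMon_pow {a b : Idx n} {α : Idx n → ℕ} (hα : ∀ a, α a < p)
    (hb : α b ≠ 0) (h : α ≠ eps a + eps b) :
    pd K p n a (pd K p n b (divMon K p n α)) ^ p = 0 := by
  obtain ⟨β, rfl⟩ := eq_add_eps hb
  rw [pd_divMon b β (by simpa [eps] using hα b), pd_divMon_pow]
  · have := hα a
    simp only [Pi.add_apply] at this
    omega
  · rintro rfl
    exact h rfl

/-- A polynomial representing a divided power monomial. -/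
noncomputable def divMonPoly (K : Type*) [Field K] {n : ℕ} (α : Idx n → ℕ) :
    MvPolynomial (Idx n) K :=
  MvPolynomial.monomial (Finsupp.equivFunOnFinite.symm α) (∏ a, ((α a).factorial : K))⁻¹

theorem X_mul_pderiv_divMonPoly (α : Idx n → ℕ) (a : Idx n) :
    MvPolynomial.X a * MvPolynomial.pderiv a (divMonPoly K α) = (α a : MvPolynomial (Idx n) K) *
      divMonPoly K α := by
  rw [divMonPoly, MvPolynomial.X_mul_pderiv_monomial, nsmul_eq_mul]
  rfl

/-- The sum of the entries of `α` other than `α 0`. -/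
def sideSum {n : ℕ} (α : Idx n → ℕ) : ℕ := ∑ i, (α (pos i) + α (neg i))

theorem eulerOp_divMonPoly (α : Idx n → ℕ) :
    eulerOp MvPolynomial.pderiv MvPolynomial.X (divMonPoly K α) =
      (sideSum α : MvPolynomial (Idx n) K) * divMonPoly K α := by
  simp only [eulerOp, X_mul_pderiv_divMonPoly, sideSum, Nat.cast_sum, Finset.sum_mul, Nat.cast_add,
    add_mul]

theorem poisson_self {P : Type*} [CommRing P] [Algebra K P] (d : Idx n → Derivation K P P) (f : P) :
    poisson d f f = 0 :=
  Finset.sum_eq_zero fun i _ => by ring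

section

variable (α : Idx n → ℕ)

theorem contactField_divMonPoly_self :
    contactField MvPolynomial.pderiv MvPolynomial.X (divMonPoly K α) (divMonPoly K α) =
    2 * divMonPoly K α * MvPolynomial.pderiv zi (divMonPoly K α) := by
  rw [contactField_apply, poisson_self]
  ring

theorem contactField_divMonPoly_zero :
    contactField MvPolynomial.pderiv MvPolynomial.X (divMonPoly K α) (MvPolynomial.X zi) =
    (2 - (sideSum α : MvPolynomial (Idx n) K)) * divMonPoly K α := by
  rw [contactField_apply, eulerOp_divMonPoly]
  simp [eulerOp, poisson, MvPolynomial.pderiv_X, sub_mul]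

theorem contactField_divMonPoly_pos (i : Fin n) :
    contactField MvPolynomial.pderiv MvPolynomial.X (divMonPoly K α) (MvPolynomial.X (pos i)) =
    MvPolynomial.pderiv zi (divMonPoly K α) * MvPolynomial.X (pos i) +
      1 * MvPolynomial.pderiv (neg i) (divMonPoly K α) := by
  rw [contactField_apply]
  simp [eulerOp, poisson, MvPolynomial.pderiv_X, Pi.single_apply]

theorem contactField_divMonPoly_neg (i : Fin n) :
    contactField MvPolynomial.pderiv MvPolynomial.X (divMonPoly K α) (MvPolynomial.X (neg i)) =
    MvPolynomial.pderiv zi (divMonPoly K α) * MvPolynomial.X (neg i) -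
      1 * MvPolynomial.pderiv (pos i) (divMonPoly K α) := by
  rw [contactField_apply]
  simp [eulerOp, poisson, MvPolynomial.pderiv_X, Pi.single_apply, sub_eq_add_neg]

end

end ContactPow

end ContactHopf

namespace ContactHopf

/-! ### Second derivatives of monomials -/

section PolyRelations

variable {K : Type*} [Field K] {n : ℕ}

theorem pderiv_pderiv_comm (a b : Idx n) (f : MvPolynomial (Idx n) K) :
    MvPolynomial.pderiv a (MvPolynomial.pderiv b f) =
      MvPolynomial.pderiv b (MvPolynomial.pderiv a f) := by
  have : ⁅MvPolynomial.pderiv (R := K) a, MvPolynomial.pderiv (R := K) b⁆ = 0 := by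
    refine MvPolynomial.derivation_ext fun c => ?_
    rw [Derivation.commutator_apply, MvPolynomial.pderiv_X, MvPolynomial.pderiv_X]
    simp only [Pi.single_apply]
    split_ifs <;> simp
  have := congrArg (fun D => D f) this
  simpa [Derivation.commutator_apply, sub_eq_zero] using this

theorem X_mul_pderiv_pderiv_divMonPoly (α : Idx n → ℕ) {a b : Idx n} (hab : a ≠ b) :
    MvPolynomial.X a * MvPolynomial.pderiv a (MvPolynomial.pderiv b (divMonPoly K α)) =
      (α a : MvPolynomial (Idx n) K) * MvPolynomial.pderiv b (divMonPoly K α) := by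
  have h := congrArg (MvPolynomial.pderiv b) (X_mul_pderiv_divMonPoly (K := K) α a)
  rw [derivation_const_mul, Derivation.leibniz, MvPolynomial.pderiv_X, Pi.single_apply,
    if_neg hab.symm.symm, smul_zero, add_zero, smul_eq_mul, pderiv_pderiv_comm] at h
  exact h

end PolyRelations

/-! ### The `p`-th power relations for the contact fields -/

section RestrictedPower

variable {K : Type*} [Field K] {p n : ℕ} [CharP K p] [Fact p.Prime]

theorem mk_divMonPoly (α : Idx n → ℕ) : DivPow.mk K p n (divMonPoly K α) = divMon K p n α :=
  (divMon_eq_mk α).symm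

theorem DK_divMon_mk (α : Idx n → ℕ) (u : MvPolynomial (Idx n) K) :
    DK K p n (divMon K p n α) (DivPow.mk K p n u) = DivPow.mk K p n
      (contactField MvPolynomial.pderiv MvPolynomial.X (divMonPoly K α) u) := by
  rw [← mk_divMonPoly, DK_mk]

/-- The relation is obtained for polynomials, where `x_0` can be cancelled, and is then divided by
`α_0`, invertible since `0 < α_0 < p`. -/
theorem DK_divMon_pd_zero {α : Idx n → ℕ} (hα : ∀ a, α a < p) :
    ∃ κ : K, DK K p n (divMon K p n α) (pd K p n zi (divMon K p n α)) =
      κ • (pd K p n zi (divMon K p n α) * pd K p n zi (divMon K p n α)) := by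
  by_cases h0 : α zi = 0
  · exact ⟨0, by rw [pd_divMon_eq_zero h0, map_zero, zero_smul]⟩
  · have ha := natCast_ne_zero_of_lt K h0 (hα zi)
    refine ⟨(α zi : K)⁻¹ * (2 * α zi - 2 + sideSum α), ?_⟩
    have h := congrArg (DivPow.mk K p n) (eigen_deriv_zero (MvPolynomial.X_ne_zero zi)
      (contactField_divMonPoly_self (K := K) α) (X_mul_pderiv_divMonPoly α zi)
      (contactField_divMonPoly_zero α))
    simp only [map_mul, ← DK_divMon_mk, ← pd_mk, mk_divMonPoly, map_add, map_sub, map_natCast,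
      map_ofNat] at h
    rw [mul_smul, eq_inv_smul_iff₀ ha, Algebra.smul_def, Algebra.smul_def]
    simpa [map_ofNat] using h

/-- `D x_0` is a multiple of `f = x^{(α)}`. If `α_0 = 0`, then `D f = 0`. Otherwise `f` is a
multiple of `x_0 D_0 f`. Both cases fit `pow_char_apply_of_eq`, and `α ≠ ε_0` ensures `(D_0 f) ^ p =
0`. -/
theorem DK_divMon_pow_zero {α : Idx n → ℕ} (hα : ∀ a, α a < p) (h : α ≠ eps zi) :
    ((DK K p n (divMon K p n α) : Module.End K (DivPow K p n)) ^ p) (xv K p n zi) = 0 := by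
  obtain ⟨κ, hκ⟩ := DK_divMon_pd_zero (K := K) hα
  have hx : DK K p n (divMon K p n α) (xv K p n zi) =
      (2 - (sideSum α : K)) • divMon K p n α := by
    rw [xv, DK_divMon_mk, contactField_divMonPoly_zero, map_mul, mk_divMonPoly, Algebra.smul_def]
    simp [map_ofNat]
  have hGp := pd_divMon_pow (K := K) (hα zi) h
  by_cases h0 : α zi = 0
  · have hf : DK K p n (divMon K p n α) (divMon K p n α) = 0 := by
      rw [← mk_divMonPoly, DK_mk, contactField_divMonPoly_self, map_mul, ← pd_mk, mk_divMonPoly,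
        pd_divMon_eq_zero h0, mul_zero]
    refine pow_char_apply_of_eq (μ := 0) hκ (by rw [hx, zero_smul, zero_add]) ?_ hGp
    rw [Derivation.map_smul, hf, smul_zero, zero_smul]
  · have ha := natCast_ne_zero_of_lt K h0 (hα zi)
    refine pow_char_apply_of_eq (μ := (2 - (sideSum α : K)) * (α zi : K)⁻¹) (y := 0) hκ ?_
      (by simp) hGp
    rw [hx, mul_comm (pd K p n zi _), xv_mul_pd_divMon, smul_smul, mul_assoc,
      inv_mul_cancel₀ ha, mul_one, add_zero]

/-- The variables `x_u` and `x_v` are paired, with `ε = ±1` covering both orders. If one of `α_u`,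
`α_v` is zero, `pow_char_apply_of_eq` applies; otherwise `pow_char_apply_of_eq'` does, and the toral
monomial `x_u x_v` is the only obstruction. -/
theorem DK_divMon_pow_side {α : Idx n → ℕ} (hα : ∀ a, α a < p) (h : α ≠ eps zi) {u v : Idx n}
    (huv : u ≠ v) (h' : α ≠ eps u + eps v) {ε : K}
    (hu : contactField MvPolynomial.pderiv MvPolynomial.X (divMonPoly K α) (MvPolynomial.X u) =
      MvPolynomial.pderiv zi (divMonPoly K α) * MvPolynomial.X u +
        MvPolynomial.C ε * MvPolynomial.pderiv v (divMonPoly K α))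
    (hv : contactField MvPolynomial.pderiv MvPolynomial.X (divMonPoly K α) (MvPolynomial.X v) =
      MvPolynomial.pderiv zi (divMonPoly K α) * MvPolynomial.X v -
        MvPolynomial.C ε * MvPolynomial.pderiv u (divMonPoly K α)) :
    ((DK K p n (divMon K p n α) : Module.End K (DivPow K p n)) ^ p) (xv K p n u) = 0 := by
  obtain ⟨κ, hκ⟩ := DK_divMon_pd_zero (K := K) hα
  have hGp := pd_divMon_pow (K := K) (hα zi) h
  have hC : ∀ c : K, DivPow.mk K p n (MvPolynomial.C c) = algebraMap K _ c :=
    (DivPow.mk K p n).commutes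
  have hx : DK K p n (divMon K p n α) (xv K p n u) =
      pd K p n zi (divMon K p n α) * xv K p n u + ε • pd K p n v (divMon K p n α) := by
    rw [xv, DK_divMon_mk, hu, map_add, map_mul, map_mul, ← pd_mk, ← pd_mk, mk_divMonPoly, hC,
      Algebra.smul_def]
  by_cases hv0 : α v = 0
  · refine pow_char_apply_of_eq (μ := 1) (y := 0) hκ ?_ (by simp) hGp
    rw [hx, pd_divMon_eq_zero hv0, smul_zero, one_smul]
  by_cases hu0 : α u = 0
  · have hz : MvPolynomial.pderiv u (divMonPoly K α) = 0 := by
      have := X_mul_pderiv_divMonPoly (K := K) α u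
      rw [hu0, Nat.cast_zero, zero_mul] at this
      exact (mul_eq_zero.mp this).resolve_left (MvPolynomial.X_ne_zero u)
    have hy := congrArg (DivPow.mk K p n) (eigen_deriv_single _ (MvPolynomial.X_ne_zero v)
      (contactField_divMonPoly_self (K := K) α) (X_mul_pderiv_divMonPoly α v) hv hz)
    rw [← DK_divMon_mk, map_mul, ← pd_mk, ← pd_mk, mk_divMonPoly] at hy
    refine pow_char_apply_of_eq (μ := 1) hκ (by rw [hx, one_smul]) ?_ hGp
    rw [Derivation.map_smul, hy, one_smul, mul_smul_comm]
  · have hau := natCast_ne_zero_of_lt K hu0 (hα u)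
    have hav := natCast_ne_zero_of_lt K hv0 (hα v)
    have hgu := X_mul_pderiv_pderiv_divMonPoly (K := K) α huv
    have hgv := X_mul_pderiv_pderiv_divMonPoly (K := K) α huv.symm
    rw [pderiv_pderiv_comm] at hgv
    have hg := congrArg (DivPow.mk K p n) (eigen_deriv_double _ (MvPolynomial.X_ne_zero u)
      (MvPolynomial.X_ne_zero v) (contactField_divMonPoly_self (K := K) α)
      (X_mul_pderiv_divMonPoly α v) hu hv hgu hgv)
    have hgu' := congrArg (DivPow.mk K p n) hgu
    simp only [map_mul, ← DK_divMon_mk, ← pd_mk, mk_divMonPoly, map_sub, map_natCast, hC]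
      at hg hgu'
    set g := pd K p n u (pd K p n v (divMon K p n α)) with hgdef
    have hg1 : DK K p n (divMon K p n α) g =
        ((α u : K)⁻¹ * (α v : K)⁻¹ * ε * ((α u : K) - α v)) • (g * g) := by
      have : ((α u : K) * α v) • DK K p n (divMon K p n α) g =
          (ε * ((α u : K) - α v)) • (g * g) := by
        rw [Algebra.smul_def, Algebra.smul_def]
        simpa using hg
      rw [← mul_inv, mul_assoc, mul_smul, ← this, inv_smul_smul₀ (mul_ne_zero hau hav)]
    have hgu1 : xv K p n u * g = (α u : K) • pd K p n v (divMon K p n α) := by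
      rw [Algebra.smul_def, map_natCast]
      exact hgu'
    -- The scaling of `g` is chosen so that `D x_u = G x_u + g x_u`, using `x_u D_u D_v f = α_u D_v
    -- f`; the constant `ν` is then forced.
    refine pow_char_apply_of_eq' (g := ((α u : K)⁻¹ * ε) • g) (ν := ((α u : K) - α v) / α v)
      hκ ?_ ?_ hGp ?_
    · rw [Derivation.map_smul, hg1, smul_mul_smul_comm, smul_smul, smul_smul]
      congr 1
      field_simp
    · rw [hx, smul_mul_assoc, mul_comm g, hgu1, smul_smul, mul_right_comm, inv_mul_cancel₀ hau,
        one_mul]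
    -- For equal exponents `ν = 0` and the product is `1`, so `g ^ p` has to vanish, which needs `α
    -- ≠ ε_u + ε_v`. For different exponents the product itself vanishes.
    · by_cases hne : α u = α v
      · rw [smul_pow, hgdef, pd_pd_divMon_pow hα hv0 h', smul_zero, smul_zero]
      · rw [prod_one_add_mul_eq_zero (hα u) (hα v) hne hv0, zero_smul]

/-- In characteristic `p` the `p`-th power of a derivation is a derivation, so vanishing on the
coordinates is enough. -/
theorem DK_divMon_pow_of_not_isToral {α : Idx n → ℕ} (hα : ∀ a, α a < p) (h : ¬ IsToral α) :
    (DK K p n (divMon K p n α) : Module.End K (DivPow K p n)) ^ p = 0 := by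
  have h0 : α ≠ eps zi := fun h' => h (Or.inl h')
  have hi : ∀ i, α ≠ eps (pos i) + eps (neg i) := fun i h' => h (Or.inr ⟨i, h'⟩)
  have : derivationPowChar p (DK K p n (divMon K p n α)) = 0 := by
    refine derivation_ext_xv _ _ fun a => ?_
    rw [derivationPowChar_apply, Derivation.zero_apply]
    rcases a with _ | i | i
    · exact DK_divMon_pow_zero hα h0
    · refine DK_divMon_pow_side hα h0 (v := neg i) (ε := 1) (by simp) (hi i) ?_ ?_
      · rw [contactField_divMonPoly_pos, map_one]
      · rw [contactField_divMonPoly_neg, map_one]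
    · refine DK_divMon_pow_side hα h0 (v := pos i) (ε := -1) (by simp)
        (by rw [add_comm]; exact hi i) ?_ ?_
      · rw [contactField_divMonPoly_neg, map_neg, map_one]
        ring
      · rw [contactField_divMonPoly_pos, map_neg, map_one]
        ring
  exact LinearMap.ext fun a => DFunLike.congr_fun this a

variable [Fact (2 < p)]

theorem prod_xv_pow_eps (a : Idx n) : ∏ b, xv K p n b ^ (eps a b) = xv K p n a := by
  rw [Finset.prod_eq_single_of_mem a (Finset.mem_univ a) fun b _ hb => by simp [eps, hb]]
  simp [eps]

theorem divMon_eps (a : Idx n) : divMon K p n (eps a) = xv K p n a := by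
  have h : ∀ b, (eps a b).factorial = 1 := fun b => by
    by_cases hb : b = a <;> simp [eps, hb]
  simp only [divMon, h, Nat.cast_one, Finset.prod_const_one, inv_one, one_smul]
  exact prod_xv_pow_eps a

theorem divMon_eps_add {a b : Idx n} (hab : a ≠ b) :
    divMon K p n (eps a + eps b) = xv K p n a * xv K p n b := by
  have h : ∀ c, ((eps a + eps b) c).factorial = 1 := fun c => by
    by_cases ha : c = a <;> by_cases hb : c = b <;> simp_all [eps]
  have h2 : ∏ c, (((eps a + eps b) c).factorial : K) = 1 :=
    Finset.prod_eq_one fun c _ => by rw [h, Nat.cast_one]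
  rw [divMon, h2, inv_one, one_smul]
  simp only [Pi.add_apply, pow_add]
  rw [Finset.prod_mul_distrib, prod_xv_pow_eps, prod_xv_pow_eps]

theorem DK_pow_of_eigen {f : DivPow K p n} (h : ∀ a, ∃ c : ℤ, DK K p n f (xv K p n a) =
    (c : K) • xv K p n a) : (DK K p n f : Module.End K (DivPow K p n)) ^ p = DK K p n f := by
  have : derivationPowChar p (DK K p n f) = DK K p n f := by
    refine derivation_ext_xv _ _ fun a => ?_
    obtain ⟨c, hc⟩ := h a
    exact pow_char_apply_eigen c hc
  exact LinearMap.ext fun a => DFunLike.congr_fun this a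

/-- All coordinates are eigenvectors with integral eigenvalues (`2` and `1` for `ε_0`; `1`, `-1` and
`0` for `ε_i + ε_{-i}`), and `c ^ p = c` in the prime field. -/
theorem DK_divMon_pow_of_isToral {α : Idx n → ℕ} (h : IsToral α) :
    (DK K p n (divMon K p n α) : Module.End K (DivPow K p n)) ^ p = DK K p n (divMon K p n α) := by
  refine DK_pow_of_eigen fun a => ?_
  rcases h with rfl | ⟨i, rfl⟩
  · rw [divMon_eps, DK, contactField_apply]
    rcases a with _ | j | j
    · exact ⟨2, by simp [eulerOp, poisson, pd_xv, Algebra.smul_def, map_ofNat]⟩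
    · exact ⟨1, by simp [eulerOp, poisson, pd_xv]⟩
    · exact ⟨1, by simp [eulerOp, poisson, pd_xv]⟩
  · rw [divMon_eps_add (by simp), DK, contactField_apply]
    rcases a with _ | j | j
    · refine ⟨0, ?_⟩
      simp [eulerOp, poisson, pd_xv, Finset.sum_add_distrib]
      ring
    · by_cases hj : j = i
      · exact ⟨1, by simp [eulerOp, poisson, pd_xv, hj]⟩
      · exact ⟨0, by simp [eulerOp, poisson, pd_xv, hj]⟩
    · by_cases hj : j = i
      · exact ⟨-1, by simp [eulerOp, poisson, pd_xv, hj]⟩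
      · exact ⟨0, by simp [eulerOp, poisson, pd_xv, hj]⟩

end RestrictedPower

end ContactHopf

namespace ContactHopf

/-! ### The restricted enveloping algebra: universal property, Hopf structure and basis -/

section RestrictedRep

variable (K : Type*) [Field K] (p n : ℕ) [CharP K p] [Fact p.Prime] [Fact (2 < p)]

/-- A linear map from the contact algebra to an associative algebra which satisfies the defining
relations of the restricted enveloping algebra. -/
structure RestrictedRep (B : Type*) [Ring B] [Algebra K B] where
  /-- The underlying linear map. -/
  toLin : contactAlg K p n →ₗ[K] B
  map_lie : ∀ X Y, toLin ⁅X, Y⁆ = toLin X * toLin Y - toLin Y * toLin X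
  toral : ∀ α (hα : Admissible p n α), IsToral α →
    toLin (DKelt K p n α hα) ^ p = toLin (DKelt K p n α hα)
  nil : ∀ α (hα : Admissible p n α), ¬ IsToral α → toLin (DKelt K p n α hα) ^ p = 0

variable {K p n}

/-- The image of an element of the contact algebra in its restricted enveloping algebra. -/
noncomputable def iota : RestrictedRep K p n (RestrictedEnv K p n) where
  toLin := (RestrictedEnv.mk K p n).toLinearMap ∘ₗ
    (UniversalEnvelopingAlgebra.ι K (L := contactAlg K p n) : _ →ₗ[K] _)
  map_lie X Y := by
    let : LieRing (UniversalEnvelopingAlgebra K (contactAlg K p n)) := LieRing.ofAssociativeRing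
    have h := (UniversalEnvelopingAlgebra.ι K (L := contactAlg K p n)).map_lie X Y
    rw [LieRing.of_associative_ring_bracket] at h
    have h' := congrArg (RestrictedEnv.mk K p n) h
    rw [map_sub, map_mul, map_mul] at h'
    exact h'
  toral α hα h := by
    simp only [LinearMap.comp_apply, AlgHom.toLinearMap_apply]
    rw [← map_pow]
    exact RingQuot.mkAlgHom_rel K (RestrictedRel.toral α hα h)
  nil α hα h := by
    simp only [LinearMap.comp_apply, AlgHom.toLinearMap_apply]
    rw [← map_pow]
    exact (RingQuot.mkAlgHom_rel K (RestrictedRel.nil α hα h)).trans (map_zero _)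

theorem iota_toLin (X : contactAlg K p n) : iota.toLin X =
    RestrictedEnv.mk K p n (UniversalEnvelopingAlgebra.ι K X) := rfl

theorem restrictedEnv_hom_ext {B : Type*} [Ring B] [Algebra K B] {f g : RestrictedEnv K p n →ₐ[K] B}
    (h : ∀ X, f (iota.toLin X) = g (iota.toLin X)) : f = g := by
  let : LieRing B := LieRing.ofAssociativeRing
  have h1 : f.comp (RestrictedEnv.mk K p n) = g.comp (RestrictedEnv.mk K p n) :=
    UniversalEnvelopingAlgebra.hom_ext K (LieHom.ext h)
  exact RingQuot.ringQuot_ext' K f g h1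

namespace RestrictedRep

variable {B : Type*} [Ring B] [Algebra K B] (ρ : RestrictedRep K p n B)

/-- The algebra homomorphism on the restricted enveloping algebra. -/
noncomputable def lift : RestrictedEnv K p n →ₐ[K] B :=
  letI : LieRing B := LieRing.ofAssociativeRing
  letI f : contactAlg K p n →ₗ⁅K⁆ B :=
    { ρ.toLin with
      map_lie' := fun {_ _} => by
        rw [LieRing.of_associative_ring_bracket]
        exact ρ.map_lie _ _ }
  RingQuot.liftAlgHom K ⟨UniversalEnvelopingAlgebra.lift K f, by
    intro a b h
    induction h with
    | toral α hα h =>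
      rw [map_pow, UniversalEnvelopingAlgebra.lift_ι_apply]
      exact ρ.toral α hα h
    | nil α hα h =>
      rw [map_pow, UniversalEnvelopingAlgebra.lift_ι_apply, map_zero]
      exact ρ.nil α hα h⟩

theorem lift_iota (X : contactAlg K p n) : ρ.lift (iota.toLin X) = ρ.toLin X := by
  let : LieRing B := LieRing.ofAssociativeRing
  rw [iota_toLin, lift, RestrictedEnv.mk]
  erw [RingQuot.liftAlgHom_mkAlgHom_apply]
  exact UniversalEnvelopingAlgebra.lift_ι_apply K _ X

/-- The zero representation. -/
noncomputable def zero (B : Type*) [Ring B] [Algebra K B] : RestrictedRep K p n B where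
  toLin := 0
  map_lie _ _ := by simp
  toral α hα h := by simp [(Fact.out : p.Prime).ne_zero]
  nil α hα h := by simp [(Fact.out : p.Prime).ne_zero]

/-- The representation `X ↦ -X` in the opposite algebra. -/
noncomputable def opp : RestrictedRep K p n Bᵐᵒᵖ where
  toLin := -((MulOpposite.opLinearEquiv K).toLinearMap ∘ₗ ρ.toLin)
  map_lie X Y := by
    simp only [LinearMap.neg_apply, LinearMap.comp_apply, ρ.map_lie, map_sub,
      LinearEquiv.coe_coe, MulOpposite.coe_opLinearEquiv, MulOpposite.op_mul]
    noncomm_ring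
  toral α hα h := by
    have hp : Odd p := (Fact.out : p.Prime).odd_of_ne_two (Fact.out : 2 < p).ne'
    simp only [LinearMap.neg_apply, LinearMap.comp_apply, hp.neg_pow,
      LinearEquiv.coe_coe, MulOpposite.coe_opLinearEquiv, ← MulOpposite.op_pow, ρ.toral α hα h]
  nil α hα h := by
    have hp : Odd p := (Fact.out : p.Prime).odd_of_ne_two (Fact.out : 2 < p).ne'
    simp only [LinearMap.neg_apply, LinearMap.comp_apply, hp.neg_pow,
      LinearEquiv.coe_coe, MulOpposite.coe_opLinearEquiv, ← MulOpposite.op_pow, ρ.nil α hα h]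
    simp

end RestrictedRep

theorem add_pow_char_of_commute_algebra (K : Type*) [Field K] {p : ℕ} [CharP K p] [Fact p.Prime]
    {B : Type*} [Ring B] [Algebra K B] {a b : B} (h : Commute a b) :
    (a + b) ^ p = a ^ p + b ^ p := by
  rcases subsingleton_or_nontrivial B with hB | hB
  · exact Subsingleton.elim _ _
  · have : CharP B p := charP_of_injective_algebraMap (algebraMap K B).injective p
    exact add_pow_char_of_commute p h

namespace RestrictedRep

variable {R B : Type*} [CommRing R] [Ring B] [Algebra K B] [Algebra R B] [Algebra K R]
  [IsScalarTower K R B] (ρ : RestrictedRep K p n B)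

/-- The two summands commute, so in characteristic `p` primitive elements have primitive `p`-th
powers; this is why the coproduct respects the restricted relations. -/
theorem primitive_pow (K : Type*) [Field K] [CharP K p] [Algebra K B] {R : Type*} [CommRing R]
    [Algebra K R] [Algebra R B] [IsScalarTower K R B] (b : B) : (b ⊗ₜ[R] (1 : B) + (1 : B) ⊗ₜ[R] b) ^ p =
    (b ^ p) ⊗ₜ[R] (1 : B) + (1 : B) ⊗ₜ[R] (b ^ p) := by
  have hc : Commute (b ⊗ₜ[R] (1 : B)) ((1 : B) ⊗ₜ[R] b) := by
    simp [Commute, SemiconjBy, Algebra.TensorProduct.tmul_mul_tmul]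
  rw [add_pow_char_of_commute_algebra K hc, Algebra.TensorProduct.tmul_pow,
    Algebra.TensorProduct.tmul_pow, one_pow]

variable (R) in
/-- The representation `X ↦ X ⊗ 1 + 1 ⊗ X`. -/
noncomputable def primitive : RestrictedRep K p n (B ⊗[R] B) where
  toLin :=
    { toFun := fun X => ρ.toLin X ⊗ₜ[R] 1 + 1 ⊗ₜ[R] ρ.toLin X
      map_add' := fun X Y => by
        rw [map_add, TensorProduct.add_tmul, TensorProduct.tmul_add]
        abel
      map_smul' := fun c X => by
        rw [map_smul, RingHom.id_apply, smul_add, TensorProduct.smul_tmul',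
          ← TensorProduct.tmul_smul] }
  map_lie X Y := by
    simp only [LinearMap.coe_mk, AddHom.coe_mk, ρ.map_lie, TensorProduct.sub_tmul,
      TensorProduct.tmul_sub, mul_add, add_mul, Algebra.TensorProduct.tmul_mul_tmul, one_mul,
      mul_one]
    abel
  toral α hα h := by
    simp only [LinearMap.coe_mk, AddHom.coe_mk]
    rw [primitive_pow K, ρ.toral α hα h]
  nil α hα h := by
    simp only [LinearMap.coe_mk, AddHom.coe_mk]
    rw [primitive_pow K, ρ.nil α hα h, TensorProduct.zero_tmul, TensorProduct.tmul_zero, add_zero]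

end RestrictedRep

/-- By the universal property the identity factors through the subalgebra generated by the image. -/
theorem adjoin_range_iota : Algebra.adjoin K (Set.range (iota (K := K) (p := p) (n := n)).toLin) = ⊤ := by
  let S := Algebra.adjoin K (Set.range (iota (K := K) (p := p) (n := n)).toLin)
  let ρ : RestrictedRep K p n S :=
    { toLin := iota.toLin.codRestrict S.toSubmodule
        fun X => Algebra.subset_adjoin (Set.mem_range_self X)
      map_lie := fun X Y => Subtype.ext (iota.map_lie X Y)
      toral := fun α hα h => Subtype.ext (iota.toral α hα h)
      nil := fun α hα h => Subtype.ext (iota.nil α hα h) }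
  have h : S.val.comp ρ.lift = AlgHom.id K _ := restrictedEnv_hom_ext fun X => by
    rw [AlgHom.comp_apply, ρ.lift_iota]
    rfl
  rw [eq_top_iff]
  intro a _
  have := DFunLike.congr_fun h a
  rw [AlgHom.id_apply] at this
  rw [← this]
  exact (ρ.lift a).2

theorem span_range_iota : Submodule.span K
    (Set.range fun α : Adm p n => iota.toLin (DKelt K p n α.1 α.2)) =
      LinearMap.range (iota (K := K) (p := p) (n := n)).toLin := by
  rw [LinearMap.range_eq_map, ← span_DKelt, Submodule.map_span, ← Set.range_comp]
  rfl

theorem adjoin_iota_DKelt : Algebra.adjoin K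
    (Set.range fun α : Adm p n => iota.toLin (DKelt K p n α.1 α.2)) = ⊤ := by
  rw [← Algebra.adjoin_span, span_range_iota, LinearMap.coe_range]
  exact adjoin_range_iota

instance : Nontrivial (RestrictedEnv K p n) :=
  (RestrictedRep.zero K : RestrictedRep K p n K).lift.toRingHom.domain_nontrivial

variable (K p n) in
/-- The Hopf algebra structure on the restricted enveloping algebra. -/
noncomputable def envHopf : HopfStructure K (RestrictedEnv K p n) :=
  primitiveHopf (Set.range iota.toLin) adjoin_range_iota (iota.primitive K).lift
    (RestrictedRep.zero K).lift iota.opp.lift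
    (by
      rintro _ ⟨X, rfl⟩
      exact RestrictedRep.lift_iota _ X)
    (by
      rintro _ ⟨X, rfl⟩
      exact RestrictedRep.lift_iota _ X)
    (by
      rintro _ ⟨X, rfl⟩
      exact RestrictedRep.lift_iota _ X)

theorem contactAlg_lie_val (X Y : contactAlg K p n) : (⁅X, Y⁆ : contactAlg K p n).1.1 =
    ⁅X.1.1, Y.1.1⁆ := rfl

variable (K p n) in
/-- The representation of the contact algebra on the divided power algebra. -/
noncomputable def natRep : RestrictedRep K p n (Module.End K (DivPow K p n)) where
  toLin :=
    { toFun := fun X => (X.1.1 : Module.End K (DivPow K p n))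
      map_add' := fun _ _ => rfl
      map_smul' := fun _ _ => rfl }
  map_lie X Y := by
    refine LinearMap.ext fun u => ?_
    change (⁅X, Y⁆ : contactAlg K p n).1.1 u = _
    rw [contactAlg_lie_val, Derivation.commutator_apply]
    rfl
  toral α hα h := DK_divMon_pow_of_isToral h
  nil α hα h := DK_divMon_pow_of_not_isToral hα.1 h

theorem natRep_injective : Function.Injective (natRep K p n).toLin := fun _ _ h =>
  Subtype.ext (Subtype.ext (Derivation.ext fun u => DFunLike.congr_fun h u))

variable (K p n) in
/-- The basis of the contact algebra given by the `D_K(x^{(α)})`. -/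
noncomputable def contactBasis : Module.Basis (Adm p n) K (contactAlg K p n) :=
  Module.Basis.mk linearIndependent_DKelt span_DKelt.ge

theorem contactBasis_apply (α : Adm p n) : contactBasis K p n α = DKelt K p n α.1 α.2 :=
  Module.Basis.mk_apply _ _ _

/-- The faithful action on the divided power algebra has a linear retraction onto the contact
algebra; its coordinates are functionals dual to the generators. Subtracting a multiple of the
counit makes them vanish at `1` without changing them on the generators. -/
theorem exists_functional (α : Adm p n) : ∃ φ : RestrictedEnv K p n →ₗ[K] K, φ 1 = 0 ∧
    ∀ β : Adm p n, φ (iota.toLin (DKelt K p n β.1 β.2)) = if β = α then 1 else 0 := by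
  obtain ⟨g, hg⟩ := LinearMap.exists_leftInverse_of_injective (natRep K p n).toLin
    (LinearMap.ker_eq_bot.mpr natRep_injective)
  let ψ : RestrictedEnv K p n →ₗ[K] K :=
    (contactBasis K p n).coord α ∘ₗ g ∘ₗ (natRep K p n).lift.toLinearMap
  let ε : RestrictedEnv K p n →ₐ[K] K := (RestrictedRep.zero K).lift
  refine ⟨ψ - ψ 1 • ε.toLinearMap, by simp, fun β => ?_⟩
  have h1 : ε (iota.toLin (DKelt K p n β.1 β.2)) = 0 := RestrictedRep.lift_iota _ _
  have h2 := LinearMap.congr_fun hg (contactBasis K p n β)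
  simp only [LinearMap.comp_apply, LinearMap.id_apply] at h2
  rw [LinearMap.sub_apply, LinearMap.smul_apply, AlgHom.toLinearMap_apply, h1, smul_zero, sub_zero]
  simp only [AlgHom.toLinearMap_apply, ψ, LinearMap.comp_apply, RestrictedRep.lift_iota, ← contactBasis_apply, h2,
    Module.Basis.coord_apply, Module.Basis.repr_self, Finsupp.single_apply]

variable (K p n) in
/-- The basis of ordered monomials of the restricted enveloping algebra. -/
noncomputable def envBasis : Module.Basis (Adm p n → Fin p) K (RestrictedEnv K p n) := by
  classical
  exact monomialBasis (x := fun α : Adm p n => iota.toLin (DKelt K p n α.1 α.2)) (envHopf K p n)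
    (fun α => RestrictedRep.lift_iota _ _) (fun α => (exists_functional α).choose)
    (fun α => (exists_functional α).choose_spec.1)
    (fun α β => (exists_functional α).choose_spec.2 β)
    (fun α β => by
      rw [span_range_iota, ← iota.map_lie]
      exact ⟨_, rfl⟩)
    (fun α => by
      by_cases h : IsToral α.1
      · rw [iota.toral _ _ h]
        exact Submodule.subset_span ⟨α, rfl⟩
      · rw [iota.nil _ _ h]
        exact Submodule.zero_mem _)
    adjoin_iota_DKelt

theorem finrank_restrictedEnv :
    Module.finrank K (RestrictedEnv K p n) = p ^ Fintype.card (Adm p n) := by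
  classical
  rw [Module.finrank_eq_card_basis (envBasis K p n), Fintype.card_fun, Fintype.card_fin]

end RestrictedRep

end ContactHopf

namespace ContactHopf

/-! ### Failure of cocommutativity -/

section TwistedToral

variable {K : Type*} [Field K] {p : ℕ} [Fact p.Prime] [CharP K p] {R : Type*} [CommRing R]
  [Algebra K R] {A : Type*} [Ring A] [Algebra K A] [Algebra R A] [IsScalarTower K R A] [CharP A p]
  {H : HopfStructure R A} {h y h' y' D : A} (P : IsToralNilPair p h y) (P' : IsToralNilPair p h' y')

theorem divAd_succ_eq_zero {y D : A} (h : y * D - D * y = 0) (m : ℕ) :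
    divAd K y (m + 1) D = 0 := by
  rw [divAd, LinearMap.smul_apply, pow_succ, Module.End.mul_apply, LinearMap.sub_apply,
    LinearMap.mulLeft_apply, LinearMap.mulRight_apply, h, map_zero, smul_zero]

theorem divAd_one (y D : A) : divAd K y 1 D = y * D - D * y := by
  simp [divAd]

theorem divAd_add_two_eq_zero {y D : A} (h : y * (y * D - D * y) - (y * D - D * y) * y = 0)
    (m : ℕ) : divAd K y (m + 2) D = 0 := by
  rw [divAd, LinearMap.smul_apply, pow_add, pow_two, Module.End.mul_apply, Module.End.mul_apply,
    LinearMap.sub_apply, LinearMap.sub_apply, LinearMap.mulLeft_apply, LinearMap.mulRight_apply,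
    LinearMap.mulLeft_apply, LinearMap.mulRight_apply, h, map_zero, smul_zero]

theorem rising_one (z : A) : rising z 1 = z := by
  rw [rising_succ_left, rising_zero, mul_one]

/-- For `D = h` only `l = 0` and `m ≤ 1` survive in the coproduct formula, since `y'` commutes with
`h` and `[y, h] = -y` commutes with `y`. -/
theorem twist_comul_toral (T : TwistDatum H (ZMod p × ZMod p))
    (hF : T.F = P.twistElt K R * P'.twistElt K R)
    (hh : Commute h h') (hy : Commute h y') (yy : Commute y y')
    (ch : H.comul h = h ⊗ₜ[R] 1 + 1 ⊗ₜ[R] h) :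
    T.comul h = h ⊗ₜ[R] (1 + oneSubPow P.nil (-1) * y) + 1 ⊗ₜ[R] h := by
  have h2 : 2 ≤ p := (Fact.out : p.Prime).two_le
  have hin : ∀ m, ∑ l ∈ Finset.range p, (-1 : ℤ) ^ (l + m) •
        ((rising h' l * rising h m) ⊗ₜ[R] (oneSubPow P'.nil (-(l : ZMod p)) *
          oneSubPow P.nil (-(m : ZMod p)) * divAd K y m (divAd K y' l h))) =
      (-1 : ℤ) ^ m • (rising h m ⊗ₜ[R] (oneSubPow P.nil (-(m : ZMod p)) * divAd K y m h)) := by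
    intro m
    rw [Finset.sum_eq_single_of_mem 0 (Finset.mem_range.mpr (by omega))]
    · simp [rising_zero, divAd_zero, oneSubPow_zero]
    · rintro (_ | l) _ hl
      · exact absurd rfl hl
      · rw [divAd_succ_eq_zero (sub_eq_zero.mpr hy.eq.symm), map_zero, mul_zero,
          TensorProduct.tmul_zero, smul_zero]
  have hyh : y * h - h * y = -y := by
    rw [P.comm, mul_add, mul_one]
    abel
  rw [comul_formula P P' T hF hh yy (c := 0) (c' := 0) (by simp) (by simpa using hh.eq.symm) ch]
  simp only [hin]
  rw [← Finset.sum_subset (Finset.range_subset_range.mpr h2)]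
  · rw [Finset.sum_range_succ, Finset.sum_range_one]
    simp only [rising_zero, rising_one, divAd_zero, divAd_one, hyh, oneSubPow_zero, Nat.cast_zero,
      neg_zero, Nat.cast_one, pow_zero, pow_one, one_smul, mul_neg, TensorProduct.tmul_neg,
      mul_one, one_mul, neg_smul, neg_neg, TensorProduct.tmul_add]
    abel
  · intro m _ hm
    obtain ⟨m, rfl⟩ := Nat.exists_eq_add_of_le (not_lt.mp (mt Finset.mem_range.mpr hm))
    rw [add_comm 2, divAd_add_two_eq_zero, mul_zero, TensorProduct.tmul_zero, smul_zero]
    rw [hyh]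
    simp

/-- Put `z = (1 - y)⁻¹ y`. Symmetry would force `z ⊗ h = h ⊗ z`, hence `z = r h` with `r = φ z`. As
`z` commutes with `y` and `[h, y] = y`, this gives `r y = 0`, so `y z = 0` and `y = (1 - y) z = z =
r h`, which is excluded. -/
theorem twist_comul_toral_ne (T : TwistDatum H (ZMod p × ZMod p))
    (hF : T.F = P.twistElt K R * P'.twistElt K R)
    (hh : Commute h h') (hy : Commute h y') (yy : Commute y y')
    (ch : H.comul h = h ⊗ₜ[R] 1 + 1 ⊗ₜ[R] h) (φ : A →ₗ[R] R) (hφ : φ h = 1)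
    (hne : ∀ r : R, y ≠ r • h) : TensorProduct.comm R A A (T.comul h) ≠ T.comul h := by
  intro heq
  rw [twist_comul_toral P P' T hF hh hy yy ch] at heq
  set z := oneSubPow P.nil (-1) * y with hz
  simp only [map_add, TensorProduct.comm_tmul, TensorProduct.tmul_add, TensorProduct.add_tmul] at heq
  have h1 : z ⊗ₜ[R] h = h ⊗ₜ[R] z := by
    have : z ⊗ₜ[R] h + (1 ⊗ₜ[R] h + h ⊗ₜ[R] 1) = h ⊗ₜ[R] z + (1 ⊗ₜ[R] h + h ⊗ₜ[R] 1) := by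
      convert heq using 1 <;> abel
    exact add_right_cancel this
  have h2 : z = φ z • h := by
    have := congrArg (fun a => TensorProduct.lid R A (φ.rTensor A a)) h1
    simpa [hφ] using this.symm
  have hzy : z * y = y * z := by
    rw [hz, mul_assoc, ← mul_assoc y, (commute_oneSubPow P.nil (Commute.refl y) (-1)).eq, mul_assoc]
  have hry : φ z • y = 0 := by
    rw [h2, smul_mul_assoc, mul_smul_comm, P.comm, mul_add, mul_one, smul_add] at hzy
    simpa using hzy
  have hy1 : y = (1 - y) * z := by
    rw [hz, ← mul_assoc, ← oneSubPow_one P.nil, oneSubPow_mul_neg, one_mul]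
  apply hne (φ z)
  rw [sub_mul, one_mul] at hy1
  have : y * z = 0 := by rw [h2, mul_smul_comm, ← smul_mul_assoc, hry, zero_mul]
  rw [this, sub_zero] at hy1
  exact hy1.trans h2

end TwistedToral

/-! ### Weights for `h(k)` and commutation of the `e(k)` -/

section Brackets

variable {K : Type*} [Field K] {p n : ℕ} [CharP K p] [Fact p.Prime] [Fact (2 < p)]

/-- The contact bracket with `x_k x_{-k}` is `x_k D_k - x_{-k} D_{-k}`, which is diagonal on
monomials. This is the origin of the exponents `α_k - α_{-k}`. -/
theorem DKelt_toral_lie (k : Fin n) (α : Idx n → ℕ) (hα : Admissible p n α) :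
    ⁅DKelt K p n (eps (pos k) + eps (neg k)) (admissible_eps_add (by simp)), DKelt K p n α hα⁆ =
      ((α (pos k) : K) - α (neg k)) • DKelt K p n α hα := by
  refine Subtype.ext (Subtype.ext ?_)
  rw [contactAlg_lie_val]
  change ⁅DK K p n (divMon K p n _), DK K p n (divMon K p n α)⁆ = _ • DK K p n (divMon K p n α)
  rw [DK_lie, ← map_smul, divMon_eps_add (by simp)]
  congr 1
  rw [contactBracket, contactField_apply, sub_smul, ← xv_mul_pd_divMon, ← xv_mul_pd_divMon]
  have h1 : eulerOp (pd K p n) (xv K p n) (xv K p n (pos k) * xv K p n (neg k)) =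
      2 * (xv K p n (pos k) * xv K p n (neg k)) := by
    simp [eulerOp, pd_xv, Finset.sum_add_distrib]
    ring
  rw [h1]
  simp [poisson, pd_xv, Finset.sum_sub_distrib]

theorem DKelt_nil_lie (k k' : Fin n) :
    ⁅DKelt K p n (eps (pos k) + eps zi) (admissible_eps_add (by simp)),
      DKelt K p n (eps (pos k') + eps zi) (admissible_eps_add (by simp))⁆ = 0 := by
  refine Subtype.ext (Subtype.ext ?_)
  rw [contactAlg_lie_val]
  change ⁅DK K p n (divMon K p n _), DK K p n (divMon K p n _)⁆ = 0
  rw [DK_lie, divMon_eps_add (by simp), divMon_eps_add (by simp)]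
  convert map_zero (DK K p n)
  rw [contactBracket, contactField_apply]
  simp [poisson, eulerOp, pd_xv]
  ring

end Brackets

end ContactHopf

namespace ContactHopf

/-! ### The base ring `K[t] / (t ^ p - q t)` -/

section TruncBase

variable (K : Type*) [Field K] (p : ℕ) [Fact p.Prime] (q : K)

theorem natDegree_sub_lt : (Polynomial.C q * Polynomial.X : Polynomial K).natDegree < p :=
  lt_of_le_of_lt (Polynomial.natDegree_C_mul_le q _) (by
    rw [Polynomial.natDegree_X]
    exact (Fact.out : p.Prime).one_lt)

theorem trunc_monic : (Polynomial.X ^ p - Polynomial.C q * Polynomial.X : Polynomial K).Monic :=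
  Polynomial.monic_X_pow_sub (lt_of_le_of_lt (Polynomial.degree_C_mul_X_le q)
    (by exact_mod_cast (Fact.out : p.Prime).one_lt))

theorem trunc_natDegree :
    (Polynomial.X ^ p - Polynomial.C q * Polynomial.X : Polynomial K).natDegree = p := by
  rw [Polynomial.natDegree_sub_eq_left_of_natDegree_lt] <;> rw [Polynomial.natDegree_X_pow]
  exact natDegree_sub_lt K p q

theorem finrank_truncBase : Module.finrank K (TruncBase K p q) = p := by
  rw [(AdjoinRoot.powerBasis' (trunc_monic K p q)).finrank, AdjoinRoot.powerBasis'_dim,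
    trunc_natDegree]

theorem tt_ne_zero : tt K p q ≠ 0 := by
  intro h
  rw [tt, ← AdjoinRoot.mk_X, AdjoinRoot.mk_eq_zero] at h
  have := Polynomial.natDegree_le_of_dvd h Polynomial.X_ne_zero
  rw [trunc_natDegree, Polynomial.natDegree_X] at this
  exact absurd this (not_le.mpr (Fact.out : p.Prime).one_lt)

instance : Nontrivial (TruncBase K p q) := ⟨⟨_, _, tt_ne_zero K p q⟩⟩

end TruncBase

/-! ### The twist of the base-changed enveloping algebra -/

section UTQ

variable {K : Type*} [Field K] {p n : ℕ} [CharP K p] [Fact p.Prime] [Fact (2 < p)] {q : K}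

variable (K p n q) in
/-- The inclusion of the contact algebra in `UTQ`. -/
noncomputable def inclRep : RestrictedRep K p n (UTQ K p n q) where
  toLin := (Algebra.TensorProduct.includeRight :
    RestrictedEnv K p n →ₐ[K] UTQ K p n q).toLinearMap ∘ₗ iota.toLin
  map_lie X Y := by
    simp only [LinearMap.comp_apply, AlgHom.toLinearMap_apply, iota.map_lie, map_sub, map_mul]
  toral α hα h := by
    simp only [LinearMap.comp_apply, AlgHom.toLinearMap_apply]
    rw [← map_pow, iota.toral α hα h]
  nil α hα h := by
    simp only [LinearMap.comp_apply, AlgHom.toLinearMap_apply]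
    rw [← map_pow, iota.nil α hα h, map_zero]

theorem incl_lie (X Y : contactAlg K p n) : incl K p n q ⁅X, Y⁆ =
    incl K p n q X * incl K p n q Y - incl K p n q Y * incl K p n q X :=
  (inclRep K p n q).map_lie X Y

theorem incl_smul (c : K) (X : contactAlg K p n) :
    incl K p n q (c • X) = c • incl K p n q X :=
  (inclRep K p n q).toLin.map_smul c X

theorem incl_zero : incl K p n q 0 = 0 := (inclRep K p n q).toLin.map_zero

theorem adjoin_range_incl :
    Algebra.adjoin (TruncBase K p q) (Set.range (incl K p n q)) = ⊤ := by
  have h := Algebra.TensorProduct.adjoin_one_tmul_image_eq_top (A := TruncBase K p q) _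
    (adjoin_range_iota (K := K) (p := p) (n := n))
  rw [← Set.range_comp] at h
  exact h

/-- The homomorphism on `UTQ` given by a representation of the contact algebra in an algebra over
`TruncBase`. -/
noncomputable def RestrictedRep.liftBase {B : Type*} [Ring B] [Algebra K B]
    [Algebra (TruncBase K p q) B] [IsScalarTower K (TruncBase K p q) B]
    (ρ : RestrictedRep K p n B) : UTQ K p n q →ₐ[TruncBase K p q] B :=
  Algebra.TensorProduct.lift (Algebra.ofId (TruncBase K p q) B) ρ.lift
    fun r b => by
      rw [Algebra.ofId_apply]
      exact Algebra.commute_algebraMap_left r (ρ.lift b)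

theorem RestrictedRep.liftBase_incl {B : Type*} [Ring B] [Algebra K B]
    [Algebra (TruncBase K p q) B] [IsScalarTower K (TruncBase K p q) B]
    (ρ : RestrictedRep K p n B) (X : contactAlg K p n) :
    ρ.liftBase (incl K p n q X) = ρ.toLin X := by
  rw [RestrictedRep.liftBase, incl, Algebra.TensorProduct.lift_tmul, map_one, one_mul]
  exact ρ.lift_iota X

instance : Nontrivial (UTQ K p n q) :=
  (RestrictedRep.zero (TruncBase K p q) :
    RestrictedRep K p n (TruncBase K p q)).liftBase.toRingHom.domain_nontrivial

instance : CharP (UTQ K p n q) p :=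
  charP_of_injective_algebraMap (algebraMap K (UTQ K p n q)).injective p

variable (K p n q) in
/-- The undeformed Hopf algebra structure on `UTQ`. -/
noncomputable def baseHopf : HopfStructure (TruncBase K p q) (UTQ K p n q) :=
  primitiveHopf (Set.range (incl K p n q)) adjoin_range_incl
    ((inclRep K p n q).primitive (TruncBase K p q)).liftBase
    (RestrictedRep.zero (TruncBase K p q)).liftBase (inclRep K p n q).opp.liftBase
    (by
      rintro _ ⟨X, rfl⟩
      exact RestrictedRep.liftBase_incl _ X)
    (by
      rintro _ ⟨X, rfl⟩
      exact RestrictedRep.liftBase_incl _ X)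
    (by
      rintro _ ⟨X, rfl⟩
      exact RestrictedRep.liftBase_incl _ X)

theorem baseHopf_comul (X : contactAlg K p n) : (baseHopf K p n q).comul (incl K p n q X) =
    incl K p n q X ⊗ₜ[TruncBase K p q] 1 + 1 ⊗ₜ[TruncBase K p q] incl K p n q X :=
  RestrictedRep.liftBase_incl _ X

theorem baseHopf_counit (X : contactAlg K p n) :
    (baseHopf K p n q).counit (incl K p n q X) = 0 :=
  RestrictedRep.liftBase_incl _ X

theorem baseHopf_antipode (X : contactAlg K p n) :
    (baseHopf K p n q).antipode (incl K p n q X) = -incl K p n q X :=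
  congrArg MulOpposite.unop (RestrictedRep.liftBase_incl (inclRep K p n q).opp X)

theorem baseHopf_antipode_mul (a b : UTQ K p n q) : (baseHopf K p n q).antipode (a * b) =
    (baseHopf K p n q).antipode b * (baseHopf K p n q).antipode a :=
  congrArg MulOpposite.unop (map_mul (inclRep K p n q).opp.liftBase a b)

theorem baseHopf_antipode_one : (baseHopf K p n q).antipode 1 = 1 :=
  congrArg MulOpposite.unop (map_one (inclRep K p n q).opp.liftBase)

/-- The weight passes through `ZMod p` because the powers of `1 - e(k) t` depend only on the
exponent modulo `p`. -/
theorem hElt_mul_incl (k : Fin n) {α : Idx n → ℕ} (hα : Admissible p n α) :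
    hElt K p n q k * incl K p n q (DKelt K p n α hα) = incl K p n q (DKelt K p n α hα) *
      (hElt K p n q k + algebraMap K _ (cst K (((α (pos k) : ℤ) - α (neg k) : ℤ) : ZMod p))) := by
  have h := incl_lie (q := q) (DKelt K p n (eps (pos k) + eps (neg k))
    (admissible_eps_add (by simp))) (DKelt K p n α hα)
  rw [DKelt_toral_lie, incl_smul] at h
  rw [cst_intCast, mul_add, ← Algebra.commutes, ← Algebra.smul_def]
  push_cast
  rw [h]
  exact (add_sub_cancel _ _).symm

theorem hElt_mul_eElt (k : Fin n) :
    hElt K p n q k * eElt K p n q k = eElt K p n q k * (hElt K p n q k + 1) := by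
  have h := hElt_mul_incl (K := K) (p := p) (q := q) k
    (admissible_eps_add (a := pos k) (b := zi) (by simp))
  have hc : (((eps (pos k) + eps zi : Idx n → ℕ) (pos k) : ℤ) -
      (eps (pos k) + eps zi : Idx n → ℕ) (neg k) : ℤ) = 1 := by simp [eps]
  rw [hc, cst_intCast, Int.cast_one, map_one] at h
  exact h

theorem commute_hElt_eElt {k k' : Fin n} (hkk' : k ≠ k') :
    Commute (hElt K p n q k) (eElt K p n q k') := by
  have h := hElt_mul_incl (K := K) (p := p) (q := q) k
    (admissible_eps_add (a := pos k') (b := zi) (by simp))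
  have hc : (((eps (pos k') + eps zi : Idx n → ℕ) (pos k) : ℤ) -
      (eps (pos k') + eps zi : Idx n → ℕ) (neg k) : ℤ) = 0 := by simp [eps, hkk']
  rw [hc, cst_intCast, Int.cast_zero, map_zero, add_zero] at h
  exact h

theorem commute_hElt_hElt (k k' : Fin n) :
    Commute (hElt K p n q k) (hElt K p n q k') := by
  have h := hElt_mul_incl (K := K) (p := p) (q := q) k
    (admissible_eps_add (a := pos k') (b := neg k') (by simp))
  have hc : (((eps (pos k') + eps (neg k') : Idx n → ℕ) (pos k) : ℤ) -
      (eps (pos k') + eps (neg k') : Idx n → ℕ) (neg k) : ℤ) = 0 := by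
    simp [eps, Pi.single_apply]
  rw [hc, cst_intCast, Int.cast_zero, map_zero, add_zero] at h
  exact h

theorem commute_eElt_eElt (k k' : Fin n) :
    Commute (eElt K p n q k) (eElt K p n q k') := by
  have h := incl_lie (K := K) (p := p) (q := q) (DKelt K p n (eps (pos k) + eps zi)
    (admissible_eps_add (by simp))) (DKelt K p n (eps (pos k') + eps zi)
    (admissible_eps_add (by simp)))
  rw [DKelt_nil_lie, incl_zero] at h
  exact sub_eq_zero.mp h.symm

theorem isToralNilPair (k : Fin n) :
    IsToralNilPair p (hElt K p n q k) (tt K p q • eElt K p n q k) where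
  toral := (inclRep K p n q).toral _ _ (Or.inr ⟨k, rfl⟩)
  nil := by rw [smul_pow, eElt_pow, smul_zero]
  comm := by rw [mul_smul_comm, hElt_mul_eElt, smul_mul_assoc]

theorem dOp_smul (k : Fin n) (m : ℕ) (r : TruncBase K p q) (D : UTQ K p n q) :
    dOp K p n q k m (r • D) = r • dOp K p n q k m D := by
  have : ∀ m : ℕ, ((LinearMap.mulLeft K (eElt K p n q k) -
      LinearMap.mulRight K (eElt K p n q k)) ^ m) (r • D) =
      r • ((LinearMap.mulLeft K (eElt K p n q k) -
        LinearMap.mulRight K (eElt K p n q k)) ^ m) D := by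
    intro m
    induction m with
    | zero => simp
    | succ m ih =>
      rw [pow_succ', Module.End.mul_apply, ih]
      simp only [Module.End.mul_apply, LinearMap.sub_apply, LinearMap.mulLeft_apply,
        LinearMap.mulRight_apply, mul_smul_comm, smul_mul_assoc, smul_sub]
  rw [dOp, LinearMap.smul_apply, LinearMap.smul_apply, this, smul_comm]

/-- `t` is central, so each application of `ad (e(k) t)` contributes one factor `t`; this yields the
powers of `t` in the final formulas. -/
theorem divAd_smul_eElt (k : Fin n) (m : ℕ) (D : UTQ K p n q) :
    divAd K (tt K p q • eElt K p n q k) m D = tt K p q ^ m • dOp K p n q k m D := by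
  have : ∀ m : ℕ, ((LinearMap.mulLeft K (tt K p q • eElt K p n q k) -
      LinearMap.mulRight K (tt K p q • eElt K p n q k)) ^ m) D =
      tt K p q ^ m • ((LinearMap.mulLeft K (eElt K p n q k) -
        LinearMap.mulRight K (eElt K p n q k)) ^ m) D := by
    intro m
    induction m with
    | zero => simp
    | succ m ih =>
      rw [pow_succ', Module.End.mul_apply, ih, pow_succ, mul_smul, pow_succ',
        Module.End.mul_apply]
      simp only [LinearMap.sub_apply, LinearMap.mulLeft_apply,
        LinearMap.mulRight_apply, mul_smul_comm, smul_mul_assoc, smul_sub]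
      congr 1
      rw [smul_comm]
  rw [dOp, divAd, LinearMap.smul_apply, LinearMap.smul_apply, this, smul_comm]

theorem divAd_divAd_smul_eElt (k k' : Fin n) (m l : ℕ) (D : UTQ K p n q) :
    divAd K (tt K p q • eElt K p n q k) m (divAd K (tt K p q • eElt K p n q k') l D) =
      tt K p q ^ (m + l) • dOp K p n q k m (dOp K p n q k' l D) := by
  rw [divAd_smul_eElt, divAd_smul_eElt, dOp_smul, smul_smul, pow_add]

theorem twist_eq (k : Fin n) :
    twist K p n q k = (isToralNilPair k).twistElt K (TruncBase K p q) := by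
  rw [← IsToralNilPair.sum_eq_twistElt, twist]
  simp only [smul_pow]
  rfl

theorem oneSubPow_eElt (k : Fin n) (c : ℤ) :
    oneSubPow (isToralNilPair (K := K) (p := p) (q := q) k).nil (c : ZMod p) =
      ((oneSubET K p n q k ^ c : (UTQ K p n q)ˣ) : UTQ K p n q) :=
  oneSubPow_intCast _ _

theorem oneSubPow_eElt_neg (k : Fin n) (m : ℕ) :
    oneSubPow (isToralNilPair (K := K) (p := p) (q := q) k).nil (-(m : ZMod p)) =
      ((oneSubET K p n q k ^ (-(m : ℤ)) : (UTQ K p n q)ˣ) : UTQ K p n q) := by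
  rw [← oneSubPow_eElt, Int.cast_neg, Int.cast_natCast]

theorem oneSubPow_eElt_neg_sub (k : Fin n) (a b : ℕ) :
    oneSubPow (isToralNilPair (K := K) (p := p) (q := q) k).nil (-(((a : ℤ) - b : ℤ) : ZMod p)) =
      ((oneSubET K p n q k ^ ((b : ℤ) - a) : (UTQ K p n q)ˣ) : UTQ K p n q) := by
  rw [← oneSubPow_eElt, ← Int.cast_neg, neg_sub]

theorem finrank_utq : Module.finrank K (UTQ K p n q) = p ^ (Fintype.card (Adm p n) + 1) := by
  rw [Module.finrank_tensorProduct, finrank_truncBase, finrank_restrictedEnv, pow_succ, mul_comm]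

/-- The `TruncBase`-linear extension of a linear functional. -/
noncomputable def baseFunctional (q : K) (φ : RestrictedEnv K p n →ₗ[K] K) :
    UTQ K p n q →ₗ[TruncBase K p q] TruncBase K p q :=
  (TensorProduct.AlgebraTensorModule.rid K (TruncBase K p q) (TruncBase K p q)).toLinearMap ∘ₗ
    φ.baseChange (TruncBase K p q)

theorem baseFunctional_incl (φ : RestrictedEnv K p n →ₗ[K] K) (X : contactAlg K p n) :
    baseFunctional q φ (incl K p n q X) = algebraMap K _ (φ (iota.toLin X)) := by
  rw [Algebra.algebraMap_eq_smul_one]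
  simp [baseFunctional, incl, iota_toLin]

/-- The base ring need not be a field (`t` is nilpotent for `q = 0`), so the independence of the
generators is expressed by functionals with values in it. -/
theorem exists_baseFunctional {α : Idx n → ℕ} (hα : Admissible p n α) :
    ∃ φ : UTQ K p n q →ₗ[TruncBase K p q] TruncBase K p q,
      ∀ (β : Idx n → ℕ) (hβ : Admissible p n β),
        φ (incl K p n q (DKelt K p n β hβ)) = if β = α then 1 else 0 := by
  obtain ⟨φ, -, h⟩ := exists_functional (K := K) (⟨α, hα⟩ : Adm p n)
  refine ⟨baseFunctional q φ, fun β hβ => ?_⟩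
  rw [baseFunctional_incl, h ⟨β, hβ⟩]
  simp only [Subtype.mk.injEq]
  split_ifs <;> simp

theorem tt_smul_eElt_ne_zero (k : Fin n) : tt K p q • eElt K p n q k ≠ 0 := by
  intro h
  obtain ⟨φ, hφ⟩ := exists_baseFunctional (K := K) (q := q)
    (admissible_eps_add (p := p) (a := pos k) (b := zi) (by simp))
  have := congrArg φ h
  rw [map_smul, map_zero, eElt, hφ, if_pos rfl, smul_eq_mul, mul_one] at this
  exact tt_ne_zero K p q this

/-- The functional dual to `h(k)` forces `r = 0`, and then `t e(k) = 0` contradicts `t ≠ 0`. -/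
theorem tt_smul_eElt_ne_smul_hElt (k : Fin n) (r : TruncBase K p q) :
    tt K p q • eElt K p n q k ≠ r • hElt K p n q k := by
  intro h
  obtain ⟨φ, hφ⟩ := exists_baseFunctional (K := K) (q := q)
    (admissible_eps_add (p := p) (a := pos k) (b := neg k) (by simp))
  have hr := congrArg φ h
  have hne : (eps (pos k) + eps zi : Idx n → ℕ) ≠ eps (pos k) + eps (neg k) := fun h' => by
    have := congrFun h' zi
    simp [eps] at this
  rw [map_smul, map_smul, eElt, hElt, hφ, hφ, if_pos rfl, if_neg hne, smul_zero, smul_eq_mul,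
    mul_one] at hr
  rw [← hr, zero_smul] at h
  exact tt_smul_eElt_ne_zero k h

variable (K p q) in
/-- The twist datum attached to the two pairs `(h(k), e(k) t)` and `(h(k'), e(k') t)`. -/
noncomputable def contactTwist {k k' : Fin n} (hkk' : k ≠ k') :
    TwistDatum (baseHopf K p n q) (ZMod p × ZMod p) :=
  twistDatum K (baseHopf K p n q) (isToralNilPair k) (isToralNilPair k')
    (commute_hElt_hElt k k') ((commute_hElt_eElt hkk').smul_right _)
    ((commute_hElt_eElt hkk'.symm).symm.smul_left _)
    (((commute_eElt_eElt k k').smul_left _).smul_right _)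
    (baseHopf_comul _)
    (by
      rw [map_smul, eElt, baseHopf_comul, smul_add, TensorProduct.smul_tmul',
        TensorProduct.tmul_smul])
    (baseHopf_comul _)
    (by
      rw [map_smul, eElt, baseHopf_comul, smul_add, TensorProduct.smul_tmul',
        TensorProduct.tmul_smul])
    (baseHopf_counit _)
    (by rw [map_smul, eElt, baseHopf_counit, smul_zero])
    (baseHopf_counit _)
    (by rw [map_smul, eElt, baseHopf_counit, smul_zero])
    (baseHopf_antipode _) (baseHopf_antipode _) baseHopf_antipode_mul baseHopf_antipode_one

theorem contactTwist_F {k k' : Fin n} (hkk' : k ≠ k') :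
    (contactTwist K p q hkk').F = (isToralNilPair k).twistElt K (TruncBase K p q) *
      (isToralNilPair k').twistElt K (TruncBase K p q) :=
  twistDatum_F _ _ _ (fun _ => rfl) fun _ => rfl

theorem contactTwist_w {k k' : Fin n} (hkk' : k ≠ k') :
    (contactTwist K p q hkk').w = (isToralNilPair k).w K * (isToralNilPair k').w K :=
  twistDatum_w _ _ ((commute_hElt_eElt hkk'.symm).symm.smul_left _) _ (fun _ => rfl) fun _ => rfl

theorem contactTwist_comul {k k' : Fin n} (hkk' : k ≠ k') {α : Idx n → ℕ}
    (hα : Admissible p n α) :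
    (contactTwist K p q hkk').comul (incl K p n q (DKelt K p n α hα)) =
      incl K p n q (DKelt K p n α hα) ⊗ₜ[TruncBase K p q]
        ((oneSubET K p n q k ^ ((α (pos k) : ℤ) - α (neg k)) *
          oneSubET K p n q k' ^ ((α (pos k') : ℤ) - α (neg k')) : (UTQ K p n q)ˣ) :
            UTQ K p n q) +
      ∑ m ∈ Finset.range p, ∑ l ∈ Finset.range p,
        (-1 : ℤ) ^ (l + m) •
          ((rising (hElt K p n q k') l * rising (hElt K p n q k) m) ⊗ₜ[TruncBase K p q]
            (tt K p q ^ (m + l) •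
              (((oneSubET K p n q k' ^ (-(l : ℤ)) * oneSubET K p n q k ^ (-(m : ℤ)) :
                  (UTQ K p n q)ˣ) : UTQ K p n q) *
                dOp K p n q k m (dOp K p n q k' l
                  (incl K p n q (DKelt K p n α hα)))))) := by
  have h := comul_formula (isToralNilPair k) (isToralNilPair k') (contactTwist K p q hkk')
    (contactTwist_F hkk') (commute_hElt_hElt k k')
    (((commute_eElt_eElt k k').smul_left _).smul_right _) (hElt_mul_incl k hα)
    (hElt_mul_incl k' hα) (baseHopf_comul _)
  rw [h, oneSubPow_eElt, oneSubPow_eElt, ← Units.val_mul]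
  congr 1
  refine Finset.sum_congr rfl fun m _ => Finset.sum_congr rfl fun l _ => ?_
  rw [oneSubPow_eElt_neg, oneSubPow_eElt_neg, ← Units.val_mul, divAd_divAd_smul_eElt,
    mul_smul_comm]

theorem contactTwist_antipode {k k' : Fin n} (hkk' : k ≠ k') {α : Idx n → ℕ}
    (hα : Admissible p n α) :
    (contactTwist K p q hkk').antipode (incl K p n q (DKelt K p n α hα)) =
      -(((oneSubET K p n q k' ^ ((α (neg k') : ℤ) - α (pos k')) *
          oneSubET K p n q k ^ ((α (neg k) : ℤ) - α (pos k)) : (UTQ K p n q)ˣ) :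
            UTQ K p n q) *
        ∑ m ∈ Finset.range p, ∑ l ∈ Finset.range p,
          tt K p q ^ (m + l) •
            (dOp K p n q k m (dOp K p n q k' l (incl K p n q (DKelt K p n α hα))) *
              rising (hElt K p n q k + 1) m * rising (hElt K p n q k' + 1) l)) := by
  have h := antipode_formula (isToralNilPair k) (isToralNilPair k') (contactTwist K p q hkk')
    (contactTwist_w hkk') (commute_hElt_hElt k k') ((commute_hElt_eElt hkk').smul_right _)
    ((commute_hElt_eElt hkk'.symm).symm.smul_left _)
    (((commute_eElt_eElt k k').smul_left _).smul_right _) (hElt_mul_incl k hα)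
    (hElt_mul_incl k' hα) (baseHopf_antipode _)
  rw [h, oneSubPow_eElt_neg_sub, oneSubPow_eElt_neg_sub, ← Units.val_mul]
  congr 2
  refine Finset.sum_congr rfl fun m _ => Finset.sum_congr rfl fun l _ => ?_
  rw [divAd_divAd_smul_eElt, smul_mul_assoc, smul_mul_assoc]

theorem exists_contactTwist_comul_ne {k k' : Fin n} (hkk' : k ≠ k') :
    ∃ a : UTQ K p n q, TensorProduct.comm (TruncBase K p q) (UTQ K p n q) (UTQ K p n q)
      ((contactTwist K p q hkk').comul a) ≠ (contactTwist K p q hkk').comul a := by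
  obtain ⟨φ, hφ⟩ := exists_baseFunctional (K := K) (q := q)
    (admissible_eps_add (p := p) (a := pos k) (b := neg k) (by simp))
  refine ⟨hElt K p n q k, twist_comul_toral_ne _ _ _ (contactTwist_F hkk')
    (commute_hElt_hElt k k') ((commute_hElt_eElt hkk').smul_right _)
    (((commute_eElt_eElt k k').smul_left _).smul_right _) (baseHopf_comul _) φ ?_
    (tt_smul_eElt_ne_smul_hElt k)⟩
  rw [hElt, hφ, if_pos rfl]

theorem contactTwist_F_eq {k k' : Fin n} (hkk' : k ≠ k') :
    (contactTwist K p q hkk').F = twist K p n q k * twist K p n q k' := by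
  rw [contactTwist_F, twist_eq, twist_eq]

end UTQ

end ContactHopf

open ContactHopf
-- Assembly of the theorem
theorem mainTheorem10 {K : Type*} [Field K] (p : ℕ) [Fact p.Prime] [Fact (2 < p)] [CharP K p]
    (n : ℕ) (k k' : Fin n) (hkk' : k ≠ k') (q : K) :
    (∃ H : HopfStructure (TruncBase K p q) (UTQ K p n q),
      (∃ a b : UTQ K p n q, a * b ≠ b * a) ∧
      (∃ a : UTQ K p n q,
        TensorProduct.comm (TruncBase K p q) (UTQ K p n q) (UTQ K p n q) (H.comul a) ≠
          H.comul a) ∧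
      (∀ (α : Idx n → ℕ) (hα : Admissible p n α),
        H.comul (incl K p n q (DKelt K p n α hα)) =
          incl K p n q (DKelt K p n α hα) ⊗ₜ[TruncBase K p q]
            ((oneSubET K p n q k ^ ((α (pos k) : ℤ) - α (neg k)) *
              oneSubET K p n q k' ^ ((α (pos k') : ℤ) - α (neg k')) : (UTQ K p n q)ˣ) :
                UTQ K p n q) +
          ∑ m ∈ Finset.range p, ∑ l ∈ Finset.range p,
            (-1 : ℤ) ^ (l + m) •
              ((rising (hElt K p n q k') l * rising (hElt K p n q k) m) ⊗ₜ[TruncBase K p q]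
                (tt K p q ^ (m + l) •
                  (((oneSubET K p n q k' ^ (-(l : ℤ)) * oneSubET K p n q k ^ (-(m : ℤ)) :
                      (UTQ K p n q)ˣ) : UTQ K p n q) *
                    dOp K p n q k m (dOp K p n q k' l
                      (incl K p n q (DKelt K p n α hα))))))) ∧
      (∀ (α : Idx n → ℕ) (hα : Admissible p n α),
        H.antipode (incl K p n q (DKelt K p n α hα)) =
          -(((oneSubET K p n q k' ^ ((α (neg k') : ℤ) - α (pos k')) *
              oneSubET K p n q k ^ ((α (neg k) : ℤ) - α (pos k)) : (UTQ K p n q)ˣ) :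
                UTQ K p n q) *
            ∑ m ∈ Finset.range p, ∑ l ∈ Finset.range p,
              tt K p q ^ (m + l) •
                (dOp K p n q k m (dOp K p n q k' l (incl K p n q (DKelt K p n α hα))) *
                  rising (hElt K p n q k + 1) m * rising (hElt K p n q k' + 1) l))) ∧
      (∀ (α : Idx n → ℕ) (hα : Admissible p n α),
        H.counit (incl K p n q (DKelt K p n α hα)) = 0) ∧
      IsUnit (twist K p n q k * twist K p n q k') ∧
      (∀ X : contactAlg K p n,
        H.comul (incl K p n q X) * (twist K p n q k * twist K p n q k') =
          (twist K p n q k * twist K p n q k') *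
            (incl K p n q X ⊗ₜ[TruncBase K p q] 1 + 1 ⊗ₜ[TruncBase K p q] incl K p n q X))) ∧
    (¬ p ∣ 2 * n + 4 → Module.finrank K (UTQ K p n q) = p ^ (p ^ (2 * n + 1) + 1)) ∧
    (p ∣ 2 * n + 4 → Module.finrank K (UTQ K p n q) = p ^ p ^ (2 * n + 1)) := by
  refine ⟨⟨(contactTwist K p q hkk').hopfStructure, ?_, exists_contactTwist_comul_ne hkk',
    fun α hα => contactTwist_comul hkk' hα, fun α hα => contactTwist_antipode hkk' hα,
    fun α hα => baseHopf_counit _, ?_, fun X => ?_⟩, fun h => ?_, fun h => ?_⟩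
  · refine ⟨hElt K p n q k, eElt K p n q k, fun h => ?_⟩
    -- If `h(k)` and `e(k)` commuted, the relation `h e = e (h + 1)` would give `e(k) = 0`.
    rw [hElt_mul_eElt, mul_add, mul_one, add_eq_left] at h
    exact tt_smul_eElt_ne_zero (q := q) k (by rw [h, smul_zero])
  · rw [← contactTwist_F_eq hkk']
    exact (contactTwist K p q hkk').Funit.isUnit
  · rw [← contactTwist_F_eq hkk', ← baseHopf_comul]
    exact (contactTwist K p q hkk').comul_mul_F _
  · rw [finrank_utq, card_adm_of_not_dvd h]
  -- The exponent is the number of admissible indices plus one for the base ring; this one makes up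
  -- for the missing index `τ`.
  · rw [finrank_utq, card_adm_of_dvd h]
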